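/- **Definitions.** Let $G$ be a finite group, written multiplicatively. A sequence over $G$ is a finite multiset $S$ of elements of $G$, of length $|S|$ (counted with multiplicity); a subsequence is a sub-multiset. $S$ is a *product-one sequence* if its terms can be ordered so that their product is $1$. Let $\exp(G)$ be the exponent of $G$. Then - $\mathsf d(G)$ is the maximal length of a sequence over $G$ that has no non-empty product-one subsequence; - $\mathsf E(G)$ is the smallest $\ell>0$ such that every sequence over $G$ of length at least $\ell$ has a product-one subsequence of length $|G|$; - $\eta(G)$ is the smallest $\ell>0$ such that every sequence over $G$ of length at least $\ell$ has a product-one subsequence of length between $1$ and $\exp(G)$; - $\mathsf s(G)$ is the smallest $\ell>0$ such that every sequence over $G$ of length at least $\ell$ has a product-one subsequence of length $\exp(G)$. **Theorem 1.1.** Let $n\ge 8$ be an even integer, let $s$ be an integer with $s^2\equiv 1 \pmod n$ and $s\not\equiv \pm 1 \pmod n$, and let $$G=\langle x,y \mid x^2=y^{n/2},\ y^n=1,\ yx=xy^s\rangle .$$ Then $G$ is finite and $$\mathsf d(G)=n,\qquad \eta(G)=n+1,\qquad \mathsf s(G)=\begin{cases}2n & \text{if } n\equiv 0 \pmod 4,\\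 3n & \text{if } n\equiv 2 \pmod 4,\end{cases}\qquad \mathsf E(G)=3n.$$ Consequently $G$ satisfies Gao's conjecture, $\mathsf s(G)=\eta(G)+\exp(G)-1$, and the Zhuang–Gao conjecture, $\mathsf E(G)=\mathsf d(G)+|G|$. -/

import Mathlib

/-! Zero-sum constants of a (multiplicative, not necessarily abelian) group.  A sequence over `G`
is an element of the free abelian monoid with basis `G`, that is, a `Multiset G`; its length is
`Multiset.card`, and `T ≤ S` says that `T` is a subsequence of `S`. -/

namespace ZeroSum

/-- The set `π(S)` of products of all terms of `S`, taken in any order. -/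
def products {G : Type*} [Group G] (S : Multiset G) : Set G :=
  {g | ∃ l : List G, (l : Multiset G) = S ∧ l.prod = g}

/-- `S` is a product-one sequence: its terms can be ordered so that their product is `1`. -/
def IsProductOne {G : Type*} [Group G] (S : Multiset G) : Prop :=
  (1 : G) ∈ products S

/-- `S` is product-one free: no non-empty subsequence of `S` is a product-one sequence. -/
def IsProductOneFree {G : Type*} [Group G] (S : Multiset G) : Prop :=
  ∀ T : Multiset G, T ≤ S → 1 ≤ T.card → ¬ IsProductOne T

/-- `S` has a product-one subsequence of length `m`. -/
def HasProductOneSubseq {G : Type*} [Group G] (m : ℕ) (S : Multiset G) : Prop :=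
  ∃ T : Multiset G, T ≤ S ∧ T.card = m ∧ IsProductOne T

/-- `S` has a short product-one subsequence: one of length between `1` and `exp(G)`. -/
def HasShortProductOneSubseq {G : Type*} [Group G] (S : Multiset G) : Prop :=
  ∃ T : Multiset G, T ≤ S ∧ 1 ≤ T.card ∧ T.card ≤ Monoid.exponent G ∧ IsProductOne T

/-- The small Davenport constant `d(G)`: the maximal length of a product-one free sequence. -/
noncomputable def smallDavenport (G : Type*) [Group G] : ℕ :=
  sSup {k : ℕ | ∃ S : Multiset G, S.card = k ∧ IsProductOneFree S}

/-- The Gao constant `E(G)`: the smallest `ℓ > 0` such that every sequence of length at least `ℓ`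
has a product-one subsequence of length `|G|`. -/
noncomputable def gaoConst (G : Type*) [Group G] : ℕ :=
  sInf {l : ℕ | 0 < l ∧ ∀ S : Multiset G, l ≤ S.card → HasProductOneSubseq (Nat.card G) S}

/-- The constant `η(G)`: the smallest `ℓ > 0` such that every sequence of length at least `ℓ`
has a short product-one subsequence. -/
noncomputable def etaConst (G : Type*) [Group G] : ℕ :=
  sInf {l : ℕ | 0 < l ∧ ∀ S : Multiset G, l ≤ S.card → HasShortProductOneSubseq S}

/-- The Erdős–Ginzburg–Ziv constant `s(G)`: the smallest `ℓ > 0` such that every sequence of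
length at least `ℓ` has a product-one subsequence of length `exp(G)`. -/
noncomputable def egzConst (G : Type*) [Group G] : ℕ :=
  sInf {l : ℕ | 0 < l ∧
    ∀ S : Multiset G, l ≤ S.card → HasProductOneSubseq (Monoid.exponent G) S}

/-- The relators of `⟨x, y ∣ x² = y^(n/2), yⁿ = 1, yx = xy^s⟩` in the free group on
`x = of 0` and `y = of 1`. -/
def rels (n : ℕ) (s : ℤ) : Set (FreeGroup (Fin 2)) :=
  let x : FreeGroup (Fin 2) := FreeGroup.of 0
  let y : FreeGroup (Fin 2) := FreeGroup.of 1
  {x ^ 2 * (y ^ (n / 2))⁻¹, y ^ n, y * x * (x * y ^ s)⁻¹}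

/-- The group `⟨x, y ∣ x² = y^(n/2), yⁿ = 1, yx = xy^s⟩`. -/
abbrev Grp (n : ℕ) (s : ℤ) : Type :=
  PresentedGroup (rels n s)

end ZeroSum

namespace ZeroSum

/-! ### Subsequences, blocks and the Erdős–Ginzburg–Ziv property -/

/-! Write `n = 2m`; every element of the group is `y^a` or `x y^a` with `a` modulo `n`. The sequence
of `x` and `n - 1` copies of `y` is product-one free, and adding `e - 1` ones to it leaves no
product-one subsequence of length `e`; this gives all lower bounds. The same padding turns an upper
bound for subsequences of length `exp(G)` into upper bounds for `d` and `η`. So (`constants_eq`) it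
is enough to find product-one subsequences of length `exp(G)` in sequences of length `n + exp(G)`,
and of length `|G| = 2n` in sequences of length `3n`.

If `m` is even, then `exp(G) = n`. Two terms of the same kind (`y^a` or `x y^a`) whose exponents
have equal parity multiply into `⟨y²⟩ ≅ ZMod m`. From `2n` terms one pairs off `2m - 2` such pairs,
with four terms left over. If no `m` pairs have sum zero, the inverse Erdős–Ginzburg–Ziv theorem
says that the pair values are `m - 1` copies of `g` and `m - 1` copies of `h`, with `g - h` a
generator. The sums of `m - 2` of them then miss a single value, so all orders of the four leftover
terms whose product lies in `⟨y²⟩` give the same product. Exchanging leftover terms with paired ones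
spreads the resulting commutation relations over the whole sequence and forces `s = 1` in `ZMod n`
(`hasProductOneSubseq_of_four_dvd`). Doing this twice gives length `2n`.

If `m` is odd, then `exp(G) = |G| = 2n`. With `N = gcd(m, s - 1)` and `k = m / N`, the group embeds
in the product of `ZMod N` and the dicyclic group of order `4k`, where `k ≥ 3` because `s ≢ 1`. If
at most one term lies outside the cyclic subgroup, the classical theorem for `ZMod N × ZMod (2k)`
suffices. Otherwise `6kN - 1` terms are already enough (`liftsTo`), by induction on the prime
factors of `N`: blocks of `l` terms with sum divisible by `l` are replaced by single terms, while
two terms outside the cyclic subgroup are kept. The base case `N = 1`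
(`Dicyclic.hasProductOneSubseq`) rests on the fact that two terms `xa b`, `xa c` allow every power
of `a` to enter with either sign. Exponents are split into a residue modulo `k`, where signs matter,
and a parity, where they do not. Either enough terms cancel in pairs, or the terms outside the
cyclic subgroup have nearly distinct residues and an addition theorem for signed sums applies. -/

theorem exists_le_map_eq {α β : Type*} (f : α → β) {T : Multiset β} :
    ∀ {S : Multiset α}, T ≤ S.map f → ∃ U ≤ S, U.map f = T := by
  induction T using Multiset.induction_on with
  | empty => exact fun _ => ⟨0, Multiset.zero_le _, rfl⟩
  | cons b T ih =>
    intro S h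
    have hb : b ∈ S.map f := Multiset.mem_of_le h (Multiset.mem_cons_self b T)
    obtain ⟨a, ha, rfl⟩ := Multiset.mem_map.1 hb
    obtain ⟨S', rfl⟩ := Multiset.exists_cons_of_mem ha
    rw [Multiset.map_cons, Multiset.cons_le_cons_iff] at h
    obtain ⟨U, hU, rfl⟩ := ih h
    exact ⟨a ::ₘ U, (Multiset.cons_le_cons_iff a).2 hU, Multiset.map_cons _ _ _⟩

theorem card_sum_of_forall {α : Type*} {B : Multiset (Multiset α)} {r : ℕ}
    (h : ∀ T ∈ B, T.card = r) : B.sum.card = B.card * r := by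
  induction B using Multiset.induction_on with
  | empty => simp
  | cons T B ih =>
    rw [Multiset.sum_cons, Multiset.card_add, h T (by simp), ih fun U hU => h U (by simp [hU]),
      Multiset.card_cons]
    ring

theorem exists_le_card_eq {α : Type*} {S : Multiset α} {n : ℕ} (h : n ≤ S.card) :
    ∃ T ≤ S, T.card = n := by
  induction S using Quotient.inductionOn with
  | h l =>
    exact ⟨(l.take n : List α), Multiset.coe_le.2 (List.take_sublist n l).subperm,
      by simpa using h⟩

/-- Greedy extraction of `t` disjoint blocks of length `r`. -/
theorem exists_blocks {α : Type*} {S : Multiset α} (P : Multiset α → Prop) {r c : ℕ}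
    (h : ∀ U ≤ S, c ≤ U.card → ∃ T ≤ U, T.card = r ∧ P T) (t : ℕ)
    (hS : c + t * r ≤ S.card + r) :
    ∃ B : Multiset (Multiset α), B.card = t ∧ (∀ T ∈ B, T.card = r ∧ P T) ∧ B.sum ≤ S := by
  classical
  induction t with
  | zero => exact ⟨0, by simp, by simp, by simp⟩
  | succ t ih =>
    have e : (t + 1) * r = t * r + r := by ring
    obtain ⟨B, hB, hP, hle⟩ := ih (by omega)
    have hc : B.sum.card = t * r := by
      rw [card_sum_of_forall fun T hT => (hP T hT).1, hB]
    obtain ⟨T, hT, hTr, hTP⟩ := h (S - B.sum) tsub_le_self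
      (by rw [Multiset.card_sub hle]; omega)
    refine ⟨T ::ₘ B, by simp [hB], ?_, ?_⟩
    · intro U hU
      rcases Multiset.mem_cons.1 hU with rfl | hU
      exacts [⟨hTr, hTP⟩, hP U hU]
    · rw [Multiset.sum_cons]
      exact (add_le_add_left hT _).trans (by rw [tsub_add_cancel_of_le hle])

theorem sum_le_sum_of_le {α : Type*} {B C : Multiset (Multiset α)} (h : B ≤ C) :
    B.sum ≤ C.sum := by
  obtain ⟨D, rfl⟩ := Multiset.le_iff_exists_add.1 h
  simp

theorem map_sum_sum {α A : Type*} [AddCommMonoid A] (f : α → A) (B : Multiset (Multiset α)) :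
    (B.sum.map f).sum = (B.map fun T => (T.map f).sum).sum := by
  induction B using Multiset.induction_on with
  | empty => simp
  | cons T B ih => simp [ih]

/-- Every sequence of length at least `2 k - 1` has a zero-sum subsequence of length `k`. -/
def IsEGZ (A : Type*) [AddCommMonoid A] (k : ℕ) : Prop :=
  ∀ S : Multiset A, 2 * k - 1 ≤ S.card → ∃ T ≤ S, T.card = k ∧ T.sum = 0

theorem isEGZ_zmod (k : ℕ) : IsEGZ (ZMod k) k :=
  fun S h => ZMod.erdos_ginzburg_ziv_multiset S h

theorem IsEGZ.exists_map {A α : Type*} [AddCommMonoid A] {k : ℕ} (h : IsEGZ A k) (f : α → A)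
    {S : Multiset α} (hS : 2 * k - 1 ≤ S.card) :
    ∃ T ≤ S, T.card = k ∧ (T.map f).sum = 0 := by
  obtain ⟨T, hT, hk, h0⟩ := h (S.map f) (by simpa using hS)
  obtain ⟨U, hU, rfl⟩ := exists_le_map_eq f hT
  exact ⟨U, hU, by simpa using hk, h0⟩

theorem IsEGZ.exists_map_mul {A α : Type*} [AddCommMonoid A] {k : ℕ} (h : IsEGZ A k) (hk : 0 < k)
    (f : α → A) {S : Multiset α} (j : ℕ) (hS : j * k + k ≤ S.card + 1) :
    ∃ T ≤ S, T.card = j * k ∧ (T.map f).sum = 0 := by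
  obtain ⟨B, hB, hP, hle⟩ := exists_blocks (S := S) (fun T => (T.map f).sum = 0) (r := k)
    (c := 2 * k - 1) (fun U _ hU => h.exists_map f hU) j (by omega)
  refine ⟨B.sum, hle, ?_, ?_⟩
  · rw [card_sum_of_forall fun T hT => (hP T hT).1, hB]
  · rw [map_sum_sum, Multiset.map_congr rfl (fun T hT => (hP T hT).2)]
    simp

/-- Two-step descent: `2 l - 1` disjoint blocks of length `k` vanish in `A`, and `l` of these blocks
have sum zero in `B`. -/
theorem IsEGZ.prod {A B : Type*} [AddCommMonoid A] [AddCommMonoid B] {k l : ℕ} (hA : IsEGZ A k)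
    (hB : IsEGZ B l) (hk : 0 < k) (hl : 0 < l) : IsEGZ (A × B) (k * l) := by
  intro S hS
  have e : (2 * l - 1) * k + k = 2 * (k * l) := by
    obtain ⟨l, rfl⟩ : ∃ l', l = l' + 1 := ⟨l - 1, by omega⟩
    rw [show 2 * (l + 1) - 1 = 2 * l + 1 by omega]; ring
  have : 0 < k * l := Nat.mul_pos hk hl
  obtain ⟨C, hC, hP, hle⟩ := exists_blocks (S := S) (fun T => (T.map Prod.fst).sum = 0) (r := k)
    (c := 2 * k - 1) (fun U _ hU => hA.exists_map Prod.fst hU) (2 * l - 1) (by omega)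
  obtain ⟨D, hD, hDl, h0⟩ := hB.exists_map (fun T => (T.map Prod.snd).sum) hC.ge
  refine ⟨D.sum, (sum_le_sum_of_le hD).trans hle, ?_, ?_⟩
  · rw [card_sum_of_forall fun T hT => (hP T (Multiset.mem_of_le hD hT)).1, hDl, mul_comm]
  · have h1 : (D.sum.map Prod.fst).sum = 0 := by
      rw [map_sum_sum,
        Multiset.map_congr rfl (fun T hT => (hP T (Multiset.mem_of_le hD hT)).2)]
      simp
    have h2 : (D.sum.map Prod.snd).sum = 0 := by rw [map_sum_sum, h0]
    have h3 : ∀ E : Multiset (A × B), E.sum = ((E.map Prod.fst).sum, (E.map Prod.snd).sum) := by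
      intro E
      induction E using Multiset.induction_on with
      | empty => rfl
      | cons a E ih => simp [ih, Prod.ext_iff]
    rw [h3, h1, h2]; rfl

theorem IsEGZ.of_injective {A B : Type*} [AddCommMonoid A] [AddCommMonoid B] {k : ℕ}
    (h : IsEGZ B k) (f : A →+ B) (hf : Function.Injective f) : IsEGZ A k := by
  intro S hS
  obtain ⟨T, hT, hk, h0⟩ := h.exists_map f hS
  exact ⟨T, hT, hk, hf (by rw [map_multiset_sum, h0, map_zero])⟩

theorem isEGZ_of_isAddCyclic (A : Type*) [AddCommGroup A] [hA : IsAddCyclic A] :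
    IsEGZ A (Nat.card A) :=
  (isEGZ_zmod _).of_injective (zmodAddCyclicAddEquiv hA).symm.toAddMonoidHom
    (zmodAddCyclicAddEquiv hA).symm.injective

/-! ### Products of sequences -/

theorem mul_mem_products_add {G : Type*} [Group G] {S T : Multiset G} {g h : G}
    (hg : g ∈ products S) (hh : h ∈ products T) : g * h ∈ products (S + T) := by
  obtain ⟨l, rfl, rfl⟩ := hg
  obtain ⟨l', rfl, rfl⟩ := hh
  exact ⟨l ++ l', by simp, by simp⟩

theorem one_mem_products_zero {G : Type*} [Group G] : (1 : G) ∈ products (0 : Multiset G) :=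
  ⟨[], rfl, rfl⟩

theorem self_mem_products_singleton {G : Type*} [Group G] (g : G) :
    g ∈ products ({g} : Multiset G) := ⟨[g], rfl, by simp⟩

theorem map_sum_mem_products {G A ι : Type*} [Group G] [AddCommMonoid A]
    (φ : Multiplicative A →* G) (b : ι → Multiset G) (c : ι → A) (B : Multiset ι)
    (h : ∀ i ∈ B, φ (.ofAdd (c i)) ∈ products (b i)) :
    φ (.ofAdd (B.map c).sum) ∈ products (B.map b).sum := by
  induction B using Multiset.induction_on with
  | empty => simpa using one_mem_products_zero
  | cons i B ih =>
    rw [Multiset.map_cons, Multiset.map_cons, Multiset.sum_cons, Multiset.sum_cons, ofAdd_add,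
      map_mul]
    exact mul_mem_products_add (h i (by simp)) (ih fun j hj => h j (by simp [hj]))

theorem map_mem_products {G H : Type*} [Group G] [Group H] (φ : G →* H) {S : Multiset G} {g : G}
    (h : g ∈ products S) : φ g ∈ products (S.map φ) := by
  obtain ⟨l, rfl, rfl⟩ := h
  exact ⟨l.map φ, by simp, by simp [map_list_prod]⟩

theorem IsProductOne.add {G : Type*} [Group G] {S T : Multiset G} (hS : IsProductOne S)
    (hT : IsProductOne T) : IsProductOne (S + T) := by
  have := mul_mem_products_add hS hT
  rwa [mul_one] at this

/-! ### Invariance under isomorphism -/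

section MulEquiv

variable {G H : Type*} [Group G] [Group H]

theorem isProductOne_map_iff (e : G ≃* H) {S : Multiset G} :
    IsProductOne (S.map e) ↔ IsProductOne S := by
  constructor
  · intro h
    have := map_mem_products e.symm.toMonoidHom h
    simpa [IsProductOne, Multiset.map_map] using this
  · intro h
    have := map_mem_products e.toMonoidHom h
    simpa [IsProductOne] using this

theorem HasProductOneSubseq.map (e : G ≃* H) {m : ℕ} {S : Multiset G}
    (h : HasProductOneSubseq m S) : HasProductOneSubseq m (S.map e) := by
  obtain ⟨T, hT, hm, h1⟩ := h
  exact ⟨T.map e, Multiset.map_le_map hT, by simpa using hm, (isProductOne_map_iff e).2 h1⟩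

theorem IsProductOneFree.map (e : G ≃* H) {S : Multiset G} (h : IsProductOneFree S) :
    IsProductOneFree (S.map e) := by
  intro T hT hc h1
  obtain ⟨U, hU, rfl⟩ := exists_le_map_eq e hT
  exact h U hU (by simpa using hc) ((isProductOne_map_iff e).1 h1)

end MulEquiv

end ZeroSum

namespace ZeroSum

/-! ### The inverse Erdős–Ginzburg–Ziv theorem -/

theorem replicate_add_filter_ne {A : Type*} [DecidableEq A] (E : Multiset A) (a : A) :
    Multiset.replicate (E.count a) a + E.filter (· ≠ a) = E := by
  rw [← Multiset.filter_eq', Multiset.filter_add_not]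

section Inverse

open Pointwise

variable {A : Type*} [AddCommGroup A]

/-- The **Scherk–Moser theorem** for two sets. -/
theorem card_add_card_le_card_add_add_one [DecidableEq A] (n : ℕ) :
    ∀ X Y : Finset A, Y.card ≤ n → 0 ∈ X → 0 ∈ Y →
      (∀ x ∈ X, ∀ y ∈ Y, x + y = 0 → y = 0) → X.card + Y.card ≤ (X + Y).card + 1 := by
  induction n with
  | zero =>
    intro X Y hn _ hY _
    rw [Finset.card_eq_zero.1 (Nat.le_zero.1 hn)] at hY
    simp at hY
  | succ n ih =>
    intro X Y hn hX hY h
    by_cases hb : ∃ b ∈ Y, b ≠ 0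
    · obtain ⟨b, hb, hb0⟩ := hb
      -- Otherwise `X + b = X` contains `0 = a + b` with `a ∈ X`, which forces `b = 0`.
      have ha : ∃ a ∈ X, a + b ∉ X := by
        by_contra! hc
        have hsub : X.image (· + b) ⊆ X := by
          intro z hz
          obtain ⟨a, ha, rfl⟩ := Finset.mem_image.1 hz
          exact hc a ha
        have heq := Finset.eq_of_subset_of_card_le hsub
          (by rw [Finset.card_image_of_injective _ (add_left_injective b)])
        rw [← heq] at hX
        obtain ⟨a, ha, hab⟩ := Finset.mem_image.1 hX
        exact hb0 (h a ha b hb hab)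
      obtain ⟨a, ha, hab⟩ := ha
      -- Dyson's transform: `a + Y₀` moves into `X`. This preserves the total size, keeps the sumset
      -- inside `X + Y`, and makes `Y` smaller because `b ∈ Y₀`.
      set Y₀ := Y.filter fun y => a + y ∉ X with hY₀
      set Y₁ := Y.filter fun y => a + y ∈ X with hY₁
      have hcard : Y₁.card + Y₀.card = Y.card := Finset.card_filter_add_card_filter_not _
      have hpos : 0 < Y₀.card := Finset.card_pos.2 ⟨b, by simp [hY₀, hb, hab]⟩
      set X' := X ∪ Y₀.image (a + ·) with hX'
      have hX'c : X'.card = X.card + Y₀.card := by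
        rw [hX', Finset.card_union_of_disjoint, Finset.card_image_of_injective _
          (add_right_injective a)]
        rw [Finset.disjoint_left]
        intro z hz hz'
        obtain ⟨y, hy, rfl⟩ := Finset.mem_image.1 hz'
        exact (Finset.mem_filter.1 hy).2 hz
      have := ih X' Y₁ (by omega) (Finset.mem_union_left _ hX) (by simp [hY₁, hY, ha]) (by
        intro x hx y hy hxy
        have hyY := (Finset.mem_filter.1 hy)
        rcases Finset.mem_union.1 hx with hx | hx
        · exact h x hx y hyY.1 hxy
        · obtain ⟨y₀, hy₀, rfl⟩ := Finset.mem_image.1 hx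
          have hy₀' := Finset.mem_filter.1 hy₀
          have := h (a + y) hyY.2 y₀ hy₀'.1 (by rw [← hxy]; abel)
          simp [this, ha] at hy₀')
      have hsub : X' + Y₁ ⊆ X + Y := by
        intro z hz
        obtain ⟨x, hx, y, hy, rfl⟩ := Finset.mem_add.1 hz
        have hyY := (Finset.mem_filter.1 hy)
        rcases Finset.mem_union.1 hx with hx | hx
        · exact Finset.add_mem_add hx hyY.1
        · obtain ⟨y₀, hy₀, rfl⟩ := Finset.mem_image.1 hx
          have hy₀' := Finset.mem_filter.1 hy₀
          rw [show a + y₀ + y = (a + y) + y₀ by abel]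
          exact Finset.add_mem_add hyY.2 hy₀'.1
      have := Finset.card_le_card hsub
      omega
    · push Not at hb
      have : Y = {0} := by
        ext y
        simp only [Finset.mem_singleton]
        exact ⟨hb y, fun hy => hy ▸ hY⟩
      subst this
      simp

/-! ### Sums of short subsequences and the structure of extremal sequences -/

variable [Fintype A]

open Classical in
/-- The sums of the subsequences of length at most `t`. -/
noncomputable def shortSums (t : ℕ) (R : Multiset A) : Finset A :=
  Finset.univ.filter fun a => ∃ T ≤ R, T.card ≤ t ∧ T.sum = a

theorem mem_shortSums {t : ℕ} {R : Multiset A} {a : A} :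
    a ∈ shortSums t R ↔ ∃ T ≤ R, T.card ≤ t ∧ T.sum = a := by
  simp [shortSums]

/-- One copy of each distinct term is split off, and Scherk–Moser is applied to the short sums of
the rest and to `{0}` together with the split-off set. The multiplicities of the rest drop by one,
in step with the permitted length. -/
theorem card_add_one_le_card_shortSums [DecidableEq A] (t : ℕ) :
    ∀ R : Multiset A, (∀ a, R.count a ≤ t) →
      (∀ T ≤ R, 1 ≤ T.card → T.card ≤ t → T.sum ≠ 0) → R.card + 1 ≤ (shortSums t R).card := by
  induction t with
  | zero =>
    intro R hR _
    have : R = 0 := Multiset.eq_zero_of_forall_notMem fun a ha => by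
      have := Multiset.count_pos.2 ha
      have := hR a
      omega
    subst this
    exact Finset.card_pos.2 ⟨0, mem_shortSums.2 ⟨0, by simp⟩⟩
  | succ t ih =>
    intro R hR h
    have hle : R.toFinset.val ≤ R := Multiset.dedup_le R
    set R' := R - R.toFinset.val with hR'
    have hcard : R'.card + R.toFinset.card = R.card := by
      rw [hR', Multiset.card_sub hle]
      exact Nat.sub_add_cancel (Multiset.card_le_card hle)
    have hadd : R' + R.toFinset.val = R := tsub_add_cancel_of_le hle
    have hC := ih R' (by
      intro a
      have h1 := hR a
      rw [hR', Multiset.count_sub]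
      by_cases ha : a ∈ R
      · have : 1 ≤ Multiset.count a R.toFinset.val := Multiset.one_le_count_iff_mem.2 (by simpa)
        omega
      · simp [Multiset.count_eq_zero_of_notMem ha]) (fun T hT h1 h2 =>
        h T (hT.trans tsub_le_self) h1 (by omega))
    have h0 : (0 : A) ∉ R.toFinset := fun h0 =>
      h {0} (by simpa using h0) (by simp) (by simp) (by simp)
    have key := card_add_card_le_card_add_add_one _ (shortSums t R') (insert 0 R.toFinset) le_rfl
      (mem_shortSums.2 ⟨0, by simp⟩) (by simp) (by
        intro x hx y hy hxy
        by_contra hy0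
        obtain ⟨T, hT, hTc, rfl⟩ := mem_shortSums.1 hx
        have hyR : y ∈ R.toFinset := by simpa [hy0] using hy
        refine h (T + {y}) ?_ (by simp) (by simpa using hTc) (by simpa using hxy)
        rw [← hadd]
        exact add_le_add hT (by simpa using hyR))
    have hsub : shortSums t R' + insert 0 R.toFinset ⊆ shortSums (t + 1) R := by
      intro z hz
      obtain ⟨x, hx, y, hy, rfl⟩ := Finset.mem_add.1 hz
      obtain ⟨T, hT, hTc, rfl⟩ := mem_shortSums.1 hx
      rcases Finset.mem_insert.1 hy with rfl | hy
      · exact mem_shortSums.2 ⟨T, hT.trans tsub_le_self, by omega, by simp⟩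
      · refine mem_shortSums.2 ⟨T + {y}, ?_, by simpa using hTc, by simp⟩
        rw [← hadd]
        exact add_le_add hT (by simpa using hy)
    have := Finset.card_le_card hsub
    rw [Finset.card_insert_of_notMem h0] at key
    omega

/-- Adding `r` repeatedly gives closure of `X` under differences of distinct elements. Then `r - r'`
and `r' - r` lie in `X` and must coincide, since their sum is `0 ∉ X`; so all elements of `X` have
the same double. Applied to `r`, `r'`, `r + r'` this gives `2r = 2r' = 0`, and `huniq` finishes. -/
theorem eq_of_add_mem_of_ne {X : Finset A}
    (huniq : ∀ r r' : A, r + r = 0 → r' + r' = 0 → r ≠ 0 → r' ≠ 0 → r = r') (h0 : (0 : A) ∉ X)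
    (h : ∀ r ∈ X, ∀ r' ∈ X, r ≠ r' → r + r' ∈ X) {r r' : A} (hr : r ∈ X) (hr' : r' ∈ X) :
    r = r' := by
  have hz : ∀ {r}, r ∈ X → r ≠ 0 := fun hr e => h0 (e ▸ hr)
  have hsub : ∀ r ∈ X, ∀ r' ∈ X, r ≠ r' → r' - r ∈ X := by
    intro r hr r' hr' hne
    have key : ∀ j : ℕ, r' + j • r ∈ X ∧ r' + j • r ≠ r := by
      intro j
      induction j with
      | zero => simpa using ⟨hr', hne.symm⟩
      | succ j ih =>
        have e : r' + (j + 1) • r = r + (r' + j • r) := by rw [succ_nsmul]; abel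
        rw [e]
        exact ⟨h r hr _ ih.1 ih.2.symm, fun h => hz ih.1 (by simpa using h)⟩
    have hc := (key (Fintype.card A - 1)).1
    have : (Fintype.card A - 1) • r = -r := by
      rw [eq_neg_iff_add_eq_zero, ← succ_nsmul, Nat.sub_add_cancel Fintype.card_pos,
        card_nsmul_eq_zero]
    rwa [this, ← sub_eq_add_neg] at hc
  have hdbl : ∀ r ∈ X, ∀ r' ∈ X, r ≠ r' → r + r = r' + r' := by
    intro r hr r' hr' hne
    have h1 := hsub r hr r' hr' hne
    have h2 := hsub r' hr' r hr hne.symm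
    by_contra hc
    have := h _ h1 _ h2 (fun e => hc (by
      rw [sub_eq_sub_iff_add_eq_add] at e
      exact e.symm))
    rw [sub_add_sub_cancel, sub_self] at this
    exact h0 this
  by_contra hne
  have hs := h r hr r' hr' hne
  have h1 := hdbl _ hs r hr (by simpa using hz hr')
  have h2 := hdbl _ hs r' hr' (by simpa using hz hr)
  refine hne (huniq r r' ?_ ?_ (hz hr) (hz hr'))
  · have : r' + r' + (r + r) = r' + r' + 0 := by
      calc _ = r + r' + (r + r') := by abel
        _ = _ := by rw [h2, add_zero]
    exact add_left_cancel this
  · have : r + r + (r' + r') = r + r + 0 := by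
      calc _ = r + r' + (r + r') := by abel
        _ = _ := by rw [h1, add_zero]
    exact add_left_cancel this

/-- Translate the most frequent term to `0`, with multiplicity `h`, and suppose `h + 1 < m`. Remove
from the nonzero terms a longest zero-sum `W` with `|W| + h < m`. The rest `R` has at least `m - 1`
terms and no zero-sum subsequence of length between `1` and `h + 1`. Counting sums shows that the
support of `R` is closed under sums of distinct elements, hence a singleton, so `|R| ≤ h`, a
contradiction. -/
theorem exists_card_le_count_add_one [DecidableEq A]
    (huniq : ∀ r r' : A, r + r = 0 → r' + r' = 0 → r ≠ 0 → r' ≠ 0 → r = r') {E : Multiset A}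
    (hE : 2 * Fintype.card A ≤ E.card + 2)
    (hno : ∀ T ≤ E, T.card = Fintype.card A → T.sum ≠ 0) :
    ∃ g, Fintype.card A ≤ E.count g + 1 := by
  set m := Fintype.card A with hm
  by_contra! hcon
  obtain ⟨g, -, hg⟩ := Finset.exists_max_image (Finset.univ : Finset A) (fun a => E.count a)
    ⟨0, Finset.mem_univ _⟩
  set F := E.map (· - g) with hF
  have hFE : ∀ a, F.count a = E.count (a + g) := by
    intro a
    have := Multiset.count_map_eq_count' (· - g) E (sub_left_injective) (a + g)
    simpa using this
  have hFc : F.card = E.card := by simp [hF]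
  have hFno : ∀ T ≤ F, T.card = m → T.sum ≠ 0 := by
    intro T hT hc h0
    obtain ⟨U, hU, rfl⟩ := exists_le_map_eq _ hT
    have hUc : U.card = m := by simpa using hc
    refine hno U hU hUc ?_
    rw [Multiset.sum_map_sub] at h0
    simpa [hUc, hm, card_nsmul_eq_zero] using h0
  set h := F.count 0 with hh
  have hmax : ∀ a, F.count a ≤ h := by
    intro a
    rw [hh, hFE, hFE, zero_add]
    exact hg _ (Finset.mem_univ _)
  have hhm : h + 1 < m := by rw [hh, hFE]; exact hcon _
  have hFpos : 0 < F.card := by omega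
  have hpos : 0 < h := by
    obtain ⟨a, ha⟩ := Multiset.card_pos_iff_exists_mem.1 hFpos
    exact (Multiset.count_pos.2 ha).trans_le (hmax a)
  set T := F.filter (· ≠ 0) with hT
  have hFT : Multiset.replicate h 0 + T = F := replicate_add_filter_ne F 0
  have hTc : h + T.card = F.card := by rw [← hFT]; simp
  have hTno : ∀ W ≤ T, m ≤ W.card + h → W.card ≤ m → W.sum ≠ 0 := by
    intro W hW h1 h2 h0
    refine hFno (Multiset.replicate (m - W.card) 0 + W) ?_ (by simp; omega) (by simpa using h0)
    rw [← hFT]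
    exact add_le_add (Multiset.replicate_le_replicate 0 |>.2 (by omega)) hW
  obtain ⟨W, hW, hWmax⟩ := Finset.exists_max_image
    ((T.powerset.toFinset).filter fun W => W.sum = 0 ∧ W.card + h < m) Multiset.card
    ⟨0, by simp; omega⟩
  simp only [Finset.mem_filter, Multiset.mem_toFinset, Multiset.mem_powerset] at hW hWmax
  obtain ⟨hWT, hW0, hWc⟩ := hW
  set R := T - W with hR
  have hRW : R + W = T := tsub_add_cancel_of_le hWT
  have hRc : R.card + W.card = T.card := by rw [← hRW]; simp
  have hRF : R ≤ F := tsub_le_self.trans (Multiset.filter_le _ _)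
  have hRno : ∀ V ≤ R, 1 ≤ V.card → V.card ≤ h + 1 → V.sum ≠ 0 := by
    intro V hV h1 h2 h0
    have hVW : V + W ≤ T := by rw [← hRW]; exact add_le_add_left hV W
    have hs : (V + W).sum = 0 := by simp [h0, hW0]
    have hVWc := Multiset.card_add V W
    -- The length of `V + W` is at most `(h + 1) + (m - 1 - h) = m`: either zeros fill it up to
    -- length `m`, or it contradicts the maximality of `W`.
    by_cases hc : m ≤ (V + W).card + h
    · exact hTno _ hVW hc (by simp; omega) hs
    · have := hWmax (V + W) ⟨hVW, hs, by omega⟩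
      omega
  set X := R.toFinset with hX
  have h0X : (0 : A) ∉ X := fun h0 =>
    hRno {0} (by simpa [hX] using h0) (by simp) (by simp) (by simp)
  have hle : X.val ≤ R := Multiset.dedup_le R
  set R' := R - X.val with hR'
  have hR'X : R' + X.val = R := tsub_add_cancel_of_le hle
  have hR'c : R'.card + X.card = R.card := by rw [← hR'X]; simp
  have hC := card_add_one_le_card_shortSums (h - 1) R' (by
    intro a
    have h1 : R.count a ≤ h := (Multiset.count_le_of_le a hRF).trans (hmax a)
    rw [hR', Multiset.count_sub]
    by_cases ha : a ∈ R
    · have : 1 ≤ Multiset.count a X.val := Multiset.one_le_count_iff_mem.2 (by simpa [hX])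
      omega
    · simp [Multiset.count_eq_zero_of_notMem ha]) (fun T hT h1 h2 =>
        hRno T (hT.trans tsub_le_self) h1 (by omega))
  set C := shortSums (h - 1) R'
  have hmiss : ∀ V ≤ X.val, 1 ≤ V.card → V.card ≤ 2 → -V.sum ∉ C := by
    intro V hV h1 h2 hmem
    obtain ⟨U, hU, hUc, hUs⟩ := mem_shortSums.1 hmem
    refine hRno (U + V) ?_ (by simp; omega) (by simp; omega) (by simp [hUs])
    rw [← hR'X]
    exact add_le_add hU hV
  have hdisj : Disjoint C (X.image (- ·)) := by
    rw [Finset.disjoint_right]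
    intro z hz
    obtain ⟨r, hr, rfl⟩ := Finset.mem_image.1 hz
    simpa using hmiss {r} (by simpa using hr) (by simp) (by simp)
  have hXneg : (X.image (- ·)).card = X.card := Finset.card_image_of_injective _ neg_injective
  -- By the count, `|C| ≥ |R| - |X| + 1 ≥ m - |X|`, so the two disjoint sets leave nothing out.
  have huniv : C ∪ X.image (- ·) = Finset.univ := by
    apply Finset.eq_univ_of_card
    have h1 := Finset.card_union_of_disjoint hdisj
    have h2 := Finset.card_le_univ (C ∪ X.image (- ·))
    omega
  -- The bound `h - 1` in `C` leaves room for two terms of `X` within length `h + 1`.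
  have hclosed : ∀ r ∈ X, ∀ r' ∈ X, r ≠ r' → r + r' ∈ X := by
    intro r hr r' hr' hne
    have h1 : -(r + r') ∉ C := by
      have := hmiss {r, r'} ((Multiset.le_iff_subset (by simp [hne])).2 (by
        intro z hz
        simp at hz
        rcases hz with rfl | rfl <;> assumption)) (by simp) (by simp)
      simpa using this
    have h2 : -(r + r') ∈ C ∪ X.image (- ·) := by rw [huniv]; simp
    rcases Finset.mem_union.1 h2 with h2 | h2
    · exact absurd h2 h1
    · obtain ⟨z, hz, hze⟩ := Finset.mem_image.1 h2
      rwa [← neg_injective hze]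
  have hRpos : 0 < R.card := by omega
  obtain ⟨r, hr⟩ := Multiset.card_pos_iff_exists_mem.1 hRpos
  have hall : ∀ b ∈ R, b = r := fun b hb =>
    eq_of_add_mem_of_ne huniq h0X hclosed (by simpa [hX] using hb) (by simpa [hX] using hr)
  have h1 : R.count r = R.card := Multiset.count_eq_card.2 fun b hb => (hall b hb).symm
  have h2 : R.count r ≤ h := (Multiset.count_le_of_le r hRF).trans (hmax r)
  omega

/-- The **inverse Erdős–Ginzburg–Ziv theorem**. -/
theorem exists_eq_replicate_add_replicate
    (huniq : ∀ r r' : A, r + r = 0 → r' + r' = 0 → r ≠ 0 → r' ≠ 0 → r = r') {E : Multiset A}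
    (hE : E.card + 2 = 2 * Fintype.card A) (h1A : 1 < Fintype.card A)
    (hno : ∀ T ≤ E, T.card = Fintype.card A → T.sum ≠ 0) :
    ∃ g h, E = Multiset.replicate (Fintype.card A - 1) g +
      Multiset.replicate (Fintype.card A - 1) h := by
  classical
  set m := Fintype.card A with hm
  obtain ⟨g, hg⟩ := exists_card_le_count_add_one huniq hE.ge hno
  have hgE : E.count g + 1 = m := by
    by_contra hne
    refine hno (Multiset.replicate m g) (Multiset.le_count_iff_replicate_le.1 (by omega))
      (by simp) ?_
    rw [Multiset.sum_replicate, hm, card_nsmul_eq_zero]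
  have hET := replicate_add_filter_ne E g
  set T := E.filter (· ≠ g) with hT
  have hTc : E.count g + T.card = E.card := by
    conv_rhs => rw [← hET]
    simp
  -- Copies of `g` fill `V` up to length `m`, and `m • g = 0`; so after translation by `g` the other
  -- `m - 1` terms are zero-sum free.
  have hfree : ∀ V ≤ T, 1 ≤ V.card → (V.map (· - g)).sum ≠ 0 := by
    intro V hV h1 h0
    have hVc := Multiset.card_le_card hV
    refine hno (Multiset.replicate (m - V.card) g + V) ?_ (by simp; omega) ?_
    · rw [← hET]
      exact add_le_add (Multiset.replicate_le_replicate g |>.2 (by omega)) hV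
    · have e : V.sum = V.card • g := by
        rw [Multiset.sum_map_sub, sub_eq_zero] at h0
        simpa using h0
      rw [Multiset.sum_add, Multiset.sum_replicate, e, ← add_nsmul,
        Nat.sub_add_cancel (by omega), hm, card_nsmul_eq_zero]
  have hTpos : 0 < T.card := by omega
  obtain ⟨h, hh⟩ := Multiset.card_pos_iff_exists_mem.1 hTpos
  refine ⟨g, h, ?_⟩
  have hall : ∀ b ∈ T, b = h := by
    intro b hb
    by_contra hne
    obtain ⟨T₁, hT₁⟩ := Multiset.exists_cons_of_mem hh
    have hb' : b ∈ T₁ := by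
      rw [hT₁] at hb
      exact (Multiset.mem_cons.1 hb).resolve_left hne
    obtain ⟨T₂, rfl⟩ := Multiset.exists_cons_of_mem hb'
    have hR : ∀ V ≤ T₂.map (· - g), ∀ W : Multiset A, W ≤ {h, b} →
        1 ≤ V.card + W.card → V.sum + (W.map (· - g)).sum ≠ 0 := by
      intro V hV W hW h1
      obtain ⟨U, hU, rfl⟩ := exists_le_map_eq _ hV
      have := hfree (U + W) (by
        rw [hT₁, show h ::ₘ b ::ₘ T₂ = T₂ + {h, b} by rw [add_comm]; simp]
        exact add_le_add hU hW) (by simpa using h1)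
      simpa using this
    -- With `b ≠ h`, the remaining `m - 3` terms have at least `m - 2` sums, which avoid three
    -- distinct elements: more than a group of order `m` can hold.
    have hC := card_add_one_le_card_shortSums (T₂.map (· - g)).card (T₂.map (· - g))
      (fun a => Multiset.count_le_card _ _) (fun V hV h1 _ => by
        simpa using hR V hV 0 (by simp) (by simpa using h1))
    set C := shortSums (T₂.map (· - g)).card (T₂.map (· - g))
    have hmiss : ∀ W : Multiset A, W ≤ {h, b} → 1 ≤ W.card → -(W.map (· - g)).sum ∉ C := by
      intro W hW h1 hmem
      obtain ⟨V, hV, -, hVs⟩ := mem_shortSums.1 hmem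
      exact hR V hV W hW (by omega) (by simp [hVs])
    have m1 := hmiss {h} (by simp) (by simp)
    have m2 := hmiss {b} (by simp) (by simp)
    have m3 := hmiss {h, b} le_rfl (by simp)
    simp only [Multiset.map_singleton, Multiset.sum_singleton, Multiset.insert_eq_cons,
      Multiset.map_cons, Multiset.sum_cons] at m1 m2 m3
    have hg1 : h - g ≠ 0 := sub_ne_zero.2 (by simpa using (Multiset.mem_filter.1 hh).2)
    have hg2 : b - g ≠ 0 := sub_ne_zero.2 (by simpa using (Multiset.mem_filter.1 hb).2)
    have hsub : C ⊆ Finset.univ \ {-(h - g), -(b - g), -(h - g + (b - g))} := by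
      intro z hz
      simp only [Finset.mem_sdiff, Finset.mem_univ, true_and, Finset.mem_insert,
        Finset.mem_singleton, not_or]
      exact ⟨fun e => m1 (e ▸ hz), fun e => m2 (e ▸ hz), fun e => m3 (e ▸ hz)⟩
    have hc3 : ({-(h - g), -(b - g), -(h - g + (b - g))} : Finset A).card = 3 := by
      rw [Finset.card_eq_three]
      refine ⟨_, _, _, fun e => hne ?_, fun e => hg2 ?_, fun e => hg1 ?_, rfl⟩
      · exact (sub_left_injective (neg_injective e)).symm
      · simpa using neg_injective e
      · simpa using neg_injective e
    have hcc := Finset.card_le_card hsub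
    rw [Finset.card_sdiff_of_subset (Finset.subset_univ _), hc3, Finset.card_univ, ← hm] at hcc
    rw [hT₁] at hTc
    simp only [Multiset.card_cons, Multiset.card_map] at hTc hC
    omega
  conv_lhs => rw [← hET, Multiset.eq_replicate_card.2 hall]
  rw [show E.count g = m - 1 by omega, show T.card = m - 1 by omega]

/-- If a sequence of length `2 |A| - 2` has no zero-sum subsequence of length `|A|`, then it has
two distinct terms whose difference generates `A`, and the sums of its subsequences of length
`|A| - 2` are all the elements of `A` but one. -/
theorem exists_generator_of_forall_sum_ne_zero
    (huniq : ∀ r r' : A, r + r = 0 → r' + r' = 0 → r ≠ 0 → r' ≠ 0 → r = r') {E : Multiset A}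
    (hE : E.card + 2 = 2 * Fintype.card A) (h1A : 1 < Fintype.card A)
    (hno : ∀ T ≤ E, T.card = Fintype.card A → T.sum ≠ 0) :
    ∃ g ∈ E, ∃ h ∈ E, (∀ z, ∃ i : ℕ, i • (g - h) = z) ∧
      ∀ e, e ≠ g + h → ∃ T ≤ E, T.card + 2 = Fintype.card A ∧ T.sum + e = 0 := by
  obtain ⟨g, h, rfl⟩ := exists_eq_replicate_add_replicate huniq hE h1A hno
  set m := Fintype.card A with hm
  have hmh : ∀ z : A, m • z = 0 := fun z => card_nsmul_eq_zero
  have hle : ∀ i j, i < m → j < m → Multiset.replicate i g + Multiset.replicate j h ≤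
      Multiset.replicate (m - 1) g + Multiset.replicate (m - 1) h := fun i j hi hj =>
    add_le_add ((Multiset.replicate_le_replicate g).2 (by omega))
      ((Multiset.replicate_le_replicate h).2 (by omega))
  have hne : ∀ i, 0 < i → i < m → i • (g - h) ≠ 0 := by
    intro i h0 hi he
    refine hno _ (hle i (m - i) hi (by omega)) (by simp; omega) ?_
    rw [nsmul_sub, sub_eq_zero] at he
    rw [Multiset.sum_add, Multiset.sum_replicate, Multiset.sum_replicate, he, ← add_nsmul,
      Nat.add_sub_cancel' hi.le, hmh]
  have hinj : Function.Injective fun i : Fin m => (i : ℕ) • (g - h) := by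
    have aux : ∀ i j : Fin m, (i : ℕ) • (g - h) = (j : ℕ) • (g - h) → i ≤ j → i = j := by
      intro i j hij hle
      by_contra hc
      refine hne (j - i) (by omega) (by omega) ?_
      rw [sub_nsmul _ hle, hij, add_neg_cancel]
    intro i j hij
    rcases le_total i j with hle | hle
    exacts [aux i j hij hle, (aux j i hij.symm hle).symm]
  have hsurj : ∀ z, ∃ i < m, i • (g - h) = z := by
    intro z
    have hbij := (Fintype.bijective_iff_injective_and_card _).2 ⟨hinj, by simp [hm]⟩
    obtain ⟨i, hi⟩ := hbij.2 z
    exact ⟨i, i.2, hi⟩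
  refine ⟨g, ?_, h, ?_, fun z => ?_, fun e he => ?_⟩
  · exact Multiset.mem_add.2 (.inl (Multiset.mem_replicate.2 ⟨by omega, rfl⟩))
  · exact Multiset.mem_add.2 (.inr (Multiset.mem_replicate.2 ⟨by omega, rfl⟩))
  · obtain ⟨i, -, hi⟩ := hsurj z
    exact ⟨i, hi⟩
  · obtain ⟨i, hi, hie⟩ := hsurj (2 • h - e)
    -- The index `i = m - 1` is the one that `m - 2` terms cannot reach; it corresponds to the
    -- excluded value `e = g + h`.
    have him : i + 1 ≠ m := by
      intro h1
      apply he
      have h2 := hmh (g - h)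
      rw [← h1, succ_nsmul, hie] at h2
      have h3 : 2 • h - e + (g - h) + e = 0 + e := by rw [h2]
      rw [zero_add] at h3
      rw [← h3, two_nsmul]; abel
    refine ⟨_, hle i (m - 2 - i) hi (by omega), by simp; omega, ?_⟩
    have h4 : (m - 2 - i) • h + (i + 2) • h = 0 := by
      rw [← add_nsmul, show m - 2 - i + (i + 2) = m by omega, hmh]
    rw [nsmul_sub] at hie
    have h5 : i • g = 2 • h - e + i • h := by rw [← hie]; abel
    rw [Multiset.sum_add, Multiset.sum_replicate, Multiset.sum_replicate, h5, ← h4, add_nsmul]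
    abel

end Inverse

end ZeroSum

namespace ZeroSum

/-! ### The constants of a group from its extremal sequences -/

theorem sInf_eq_of_forall {α : Type*} {d m : ℕ} (hm : 1 ≤ m) {P : Multiset α → Prop}
    {S : Multiset α}
    (hS : S.card + 1 = d + m) (hPS : ¬ P S) (h : ∀ S : Multiset α, d + m ≤ S.card → P S) :
    sInf {l : ℕ | 0 < l ∧ ∀ S : Multiset α, l ≤ S.card → P S} = d + m := by
  refine IsLeast.csInf_eq ⟨⟨by omega, h⟩, fun l hl => ?_⟩
  by_contra hc
  exact hPS (hl.2 S (by omega))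

section Constants

variable {G : Type*} [Group G]

theorem IsProductOne.filter_ne_one [DecidableEq G] {T : Multiset G} (h : IsProductOne T) :
    IsProductOne (T.filter (· ≠ 1)) := by
  have key : ∀ l : List G, (l.filter (· ≠ 1)).prod = l.prod := by
    intro l
    induction l with
    | nil => rfl
    | cons a l ih =>
      by_cases ha : a = 1
      · subst ha; simpa using ih
      · rw [List.filter_cons_of_pos (by simpa using ha), List.prod_cons, List.prod_cons, ih]
  obtain ⟨l, rfl, hl⟩ := h
  exact ⟨l.filter (· ≠ 1), by simp, by rw [key, hl]⟩

theorem isProductOne_singleton_one : IsProductOne ({1} : Multiset G) :=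
  ⟨[1], rfl, by simp⟩

/-- Padding with `m - 1` ones turns product-one subsequences of length between `1` and `m` into
those of length `m`. -/
theorem HasProductOneSubseq.exists_of_add_replicate {S : Multiset G} {m : ℕ} (hm : 1 ≤ m)
    (h : HasProductOneSubseq m (S + Multiset.replicate (m - 1) 1)) :
    ∃ T ≤ S, 1 ≤ T.card ∧ T.card ≤ m ∧ IsProductOne T := by
  classical
  obtain ⟨T, hT, hTm, h1⟩ := h
  by_cases h1S : (1 : G) ∈ S
  · exact ⟨{1}, by simpa using h1S, by simp, by simpa using hm, isProductOne_singleton_one⟩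
  refine ⟨T.filter (· ≠ 1), ?_, ?_, ?_, h1.filter_ne_one⟩
  · refine (Multiset.filter_le_filter _ hT).trans ?_
    rw [Multiset.filter_add]
    have : (Multiset.replicate (m - 1) (1 : G)).filter (· ≠ 1) = 0 := by
      rw [Multiset.filter_eq_nil]
      intro a ha
      simp [Multiset.eq_of_mem_replicate ha]
    rw [this, add_zero]
    exact Multiset.filter_le _ _
  · have h2 := Multiset.count_le_of_le 1 hT
    rw [Multiset.count_add, Multiset.count_eq_zero_of_notMem h1S,
      Multiset.count_replicate_self] at h2
    have h3 := congrArg Multiset.card (replicate_add_filter_ne T 1)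
    rw [Multiset.card_add, Multiset.card_replicate] at h3
    omega
  · exact (Multiset.card_le_card (Multiset.filter_le _ _)).trans hTm.le

theorem IsProductOneFree.not_hasProductOneSubseq {S : Multiset G} (hS : IsProductOneFree S)
    {m : ℕ} (hm : 1 ≤ m) :
    ¬ HasProductOneSubseq m (S + Multiset.replicate (m - 1) 1) := fun h => by
  obtain ⟨T, hT, h1, -, h2⟩ := h.exists_of_add_replicate hm
  exact hS T hT h1 h2

theorem exists_of_forall_hasProductOneSubseq {d m : ℕ} (hm : 1 ≤ m)
    (h : ∀ S : Multiset G, d + m ≤ S.card → HasProductOneSubseq m S) {S : Multiset G}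
    (hS : d + 1 ≤ S.card) : ∃ T ≤ S, 1 ≤ T.card ∧ T.card ≤ m ∧ IsProductOne T :=
  (h (S + Multiset.replicate (m - 1) 1) (by simp; omega)).exists_of_add_replicate hm

/-- A product-one free sequence of length `d`, padded with ones, gives the lower bounds for `s` and
`E`, which match `hs` and `hE`. Removing the padding from `hs` gives the upper bounds for `d` and
`η`. -/
theorem constants_eq {d : ℕ} (hcard : 1 ≤ Nat.card G) (hexp : 1 ≤ Monoid.exponent G)
    {S₀ : Multiset G} (hS₀ : S₀.card = d) (hfree : IsProductOneFree S₀)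
    (hs : ∀ S : Multiset G, d + Monoid.exponent G ≤ S.card →
      HasProductOneSubseq (Monoid.exponent G) S)
    (hE : ∀ S : Multiset G, d + Nat.card G ≤ S.card → HasProductOneSubseq (Nat.card G) S) :
    smallDavenport G = d ∧ etaConst G = d + 1 ∧ egzConst G = d + Monoid.exponent G ∧
      gaoConst G = d + Nat.card G := by
  refine ⟨?_, ?_, ?_, ?_⟩
  · refine IsGreatest.csSup_eq ⟨⟨S₀, hS₀, hfree⟩, ?_⟩
    rintro k ⟨S, rfl, hS⟩
    by_contra hc
    obtain ⟨T, hT, h1, -, h2⟩ := exists_of_forall_hasProductOneSubseq hexp hs (S := S) (by omega)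
    exact hS T hT h1 h2
  · refine sInf_eq_of_forall (P := HasShortProductOneSubseq) le_rfl (S := S₀) (by omega) ?_ ?_
    · rintro ⟨T, hT, h1, -, h2⟩
      exact hfree T hT h1 h2
    · intro S hS
      obtain ⟨T, hT, h1, h2, h3⟩ := exists_of_forall_hasProductOneSubseq hexp hs hS
      exact ⟨T, hT, h1, h2, h3⟩
  · exact sInf_eq_of_forall hexp (S := S₀ + Multiset.replicate (Monoid.exponent G - 1) 1)
      (by simp; omega) (hfree.not_hasProductOneSubseq hexp) hs
  · exact sInf_eq_of_forall hcard (S := S₀ + Multiset.replicate (Nat.card G - 1) 1)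
      (by simp; omega) (hfree.not_hasProductOneSubseq hcard) hE

end Constants

/-! ### Normal form of the group -/

/-- The conditions on `n` and `s` under which `x² = y^(n/2)`, `yⁿ = 1`, `yx = xy^s` presents a
group of order `2 n`. -/
structure IsAdmissible (n : ℕ) (s : ℤ) : Prop where
  even : Even n
  sq : s ^ 2 ≡ 1 [ZMOD (n : ℤ)]

theorem IsAdmissible.natCast_half_add {n : ℕ} {s : ℤ} (h : IsAdmissible n s) :
    ((n / 2 : ℕ) : ZMod n) + ((n / 2 : ℕ) : ZMod n) = 0 := by
  obtain ⟨m, rfl⟩ := h.even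
  rw [← Nat.cast_add, show (m + m) / 2 + (m + m) / 2 = m + m by omega, ZMod.natCast_self]

theorem IsAdmissible.mul_self {n : ℕ} {s : ℤ} (h : IsAdmissible n s) :
    (s : ZMod n) * s = 1 := by
  have := (ZMod.intCast_eq_intCast_iff _ _ _).2 h.sq
  push_cast at this
  rw [← this, _root_.sq]

theorem IsAdmissible.odd {n : ℕ} {s : ℤ} (h : IsAdmissible n s) : Odd s := by
  have h2 : (2 : ℤ) ∣ s ^ 2 - 1 :=
    (by exact_mod_cast h.even.two_dvd : (2 : ℤ) ∣ n).trans h.sq.symm.dvd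
  rcases Int.even_or_odd s with he | ho
  · have : (2 : ℤ) ∣ s ^ 2 := (he.two_dvd).trans (dvd_pow_self s two_ne_zero)
    omega
  · exact ho

theorem IsAdmissible.mul_natCast_half {n : ℕ} {s : ℤ} (h : IsAdmissible n s) :
    (s : ZMod n) * ((n / 2 : ℕ) : ZMod n) = ((n / 2 : ℕ) : ZMod n) := by
  obtain ⟨t, ht⟩ := h.odd
  rw [ht]
  push_cast
  linear_combination (t : ZMod n) * h.natCast_half_add

/-- The elements `y^a` and `x y^a` of the group. -/
inductive NormalForm (n : ℕ) (s : ℤ) : Type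
  /-- The element `y^a`. -/
  | y : ZMod n → NormalForm n s
  /-- The element `x y^a`. -/
  | x : ZMod n → NormalForm n s

namespace NormalForm

variable {n : ℕ} {s : ℤ}

/-- Multiplication of normal forms. -/
protected def mul : NormalForm n s → NormalForm n s → NormalForm n s
  | y a, y b => y (a + b)
  | y a, x b => x (s * a + b)
  | x a, y b => x (a + b)
  | x a, x b => y ((n / 2 : ℕ) + s * a + b)

/-- Inverses of normal forms. -/
protected def inv : NormalForm n s → NormalForm n s
  | y a => y (-a)
  | x a => x ((n / 2 : ℕ) - s * a)

variable (n s) in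
/-- Normal forms as a disjoint union of two copies of `ZMod n`. -/
def equivSum : NormalForm n s ≃ ZMod n ⊕ ZMod n where
  toFun | y a => .inl a
        | x a => .inr a
  invFun | .inl a => y a
         | .inr a => x a
  left_inv := by rintro (a | a) <;> rfl
  right_inv := by rintro (a | a) <;> rfl

theorem natCard [NeZero n] : Nat.card (NormalForm n s) = 2 * n := by
  rw [Nat.card_congr (equivSum n s), Nat.card_sum, Nat.card_zmod]
  ring

variable [h : Fact (IsAdmissible n s)]

instance : Group (NormalForm n s) where
  mul := NormalForm.mul
  one := y 0
  inv := NormalForm.inv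
  mul_assoc := by
    have h1 := h.out.mul_natCast_half
    have h2 := h.out.mul_self
    rintro (a | a) (b | b) (c | c)
    · exact congrArg y (by ring)
    · exact congrArg x (by ring)
    · exact congrArg x (by ring)
    · exact congrArg y (by linear_combination a * h2)
    · exact congrArg x (by ring)
    · exact congrArg y (by ring)
    · exact congrArg y (by ring)
    · exact congrArg x (by linear_combination h1 + a * h2)
  one_mul := by
    rintro (a | a)
    · exact congrArg y (by ring)
    · exact congrArg x (by ring)
  mul_one := by
    rintro (a | a)
    · exact congrArg y (by ring)
    · exact congrArg x (by ring)
  inv_mul_cancel := by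
    have h1 := h.out.mul_natCast_half
    have h2 := h.out.mul_self
    have h3 := h.out.natCast_half_add
    rintro (a | a)
    · exact congrArg y (by ring)
    · exact congrArg y (by linear_combination h3 + h1 - a * h2)

theorem y_mul_y (a b : ZMod n) : (y a * y b : NormalForm n s) = y (a + b) := rfl
theorem y_mul_x (a b : ZMod n) : (y a * x b : NormalForm n s) = x ((s : ZMod n) * a + b) := rfl
theorem x_mul_y (a b : ZMod n) : (x a * y b : NormalForm n s) = x (a + b) := rfl
theorem x_mul_x (a b : ZMod n) :
    (x a * x b : NormalForm n s) = y (((n / 2 : ℕ) : ZMod n) + (s : ZMod n) * a + b) := rfl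
theorem one_def : (1 : NormalForm n s) = y 0 := rfl

/-- The embedding of the cyclic subgroup generated by `y`. -/
def yHom : Multiplicative (ZMod n) →* NormalForm n s where
  toFun a := y a.toAdd
  map_one' := rfl
  map_mul' _ _ := rfl

theorem y_pow (a : ZMod n) (k : ℕ) : (y a : NormalForm n s) ^ k = y (k • a) :=
  (map_pow (yHom (n := n) (s := s)) (Multiplicative.ofAdd a) k).symm

theorem y_zpow (a : ZMod n) (k : ℤ) : (y a : NormalForm n s) ^ k = y (k • a) :=
  (map_zpow (yHom (n := n) (s := s)) (Multiplicative.ofAdd a) k).symm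

/-- The homomorphism that counts the occurrences of `x` modulo `2`. -/
def parity : NormalForm n s →* Multiplicative (ZMod 2) where
  toFun | y _ => 1
        | x _ => Multiplicative.ofAdd 1
  map_one' := rfl
  map_mul' := by
    rintro (a | a) (b | b)
    · rfl
    · rfl
    · rfl
    · exact (by decide : (1 : Multiplicative (ZMod 2)) =
        Multiplicative.ofAdd 1 * Multiplicative.ofAdd 1)

theorem parity_y (a : ZMod n) : parity (y a : NormalForm n s) = 1 := rfl
theorem parity_x (a : ZMod n) : parity (x a : NormalForm n s) = Multiplicative.ofAdd 1 := rfl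

theorem x_sq (a : ZMod n) :
    (x a : NormalForm n s) ^ 2 = y (((n / 2 : ℕ) : ZMod n) + ((s : ZMod n) + 1) * a) := by
  rw [_root_.sq, x_mul_x]
  congr 1; ring

/-- The homomorphism from the presented group to the normal forms. -/
def ofPresented : Grp n s →* NormalForm n s :=
  PresentedGroup.toGroup (f := fun i : Fin 2 => if i = 0 then x 0 else y 1) (by
    intro r hr
    rcases hr with rfl | rfl | rfl
    · simp only [map_mul, map_inv, map_pow, FreeGroup.lift_apply_of, if_true, one_ne_zero,
        if_false, mul_inv_eq_one]
      rw [x_sq, y_pow]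
      simp
    · simp only [map_pow, FreeGroup.lift_apply_of, one_ne_zero, if_false]
      rw [y_pow, one_def]
      simp
    · simp only [map_mul, map_inv, map_zpow, FreeGroup.lift_apply_of, if_true, one_ne_zero,
        if_false, mul_inv_eq_one]
      rw [y_zpow, y_mul_x, x_mul_y]
      simp)

theorem ofPresented_of_zero :
    ofPresented (PresentedGroup.of 0 : Grp n s) = x 0 := by
  simp [ofPresented]

theorem ofPresented_of_one :
    ofPresented (PresentedGroup.of 1 : Grp n s) = y 1 := by
  simp [ofPresented]

end NormalForm

/-! ### The presented group is isomorphic to the group of normal forms -/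

section Presentation

variable {n : ℕ} {s : ℤ}

theorem presented_x_sq :
    (PresentedGroup.of 0 : Grp n s) ^ 2 = PresentedGroup.of 1 ^ (n / 2) := by
  have : PresentedGroup.mk (rels n s) (FreeGroup.of 0 ^ 2 * (FreeGroup.of 1 ^ (n / 2))⁻¹) = 1 :=
    PresentedGroup.one_of_mem (Or.inl rfl)
  rw [map_mul, map_inv, mul_inv_eq_one] at this
  exact this

theorem presented_y_pow : (PresentedGroup.of 1 : Grp n s) ^ n = 1 :=
  PresentedGroup.one_of_mem (rels := rels n s) (x := FreeGroup.of 1 ^ n) (Or.inr (Or.inl rfl))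

theorem presented_y_mul_x : (PresentedGroup.of 1 : Grp n s) * PresentedGroup.of 0 =
    PresentedGroup.of 0 * PresentedGroup.of 1 ^ s := by
  have : PresentedGroup.mk (rels n s)
      (FreeGroup.of 1 * FreeGroup.of 0 * (FreeGroup.of 0 * FreeGroup.of 1 ^ s)⁻¹) = 1 :=
    PresentedGroup.one_of_mem (Or.inr (Or.inr rfl))
  rw [map_mul, map_inv, mul_inv_eq_one] at this
  exact this

theorem presented_y_zpow_mul_x (k : ℤ) :
    (PresentedGroup.of 1 : Grp n s) ^ k * PresentedGroup.of 0 =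
      PresentedGroup.of 0 * PresentedGroup.of 1 ^ (s * k) := by
  have h : (PresentedGroup.of 0 : Grp n s)⁻¹ * PresentedGroup.of 1 * PresentedGroup.of 0 =
      PresentedGroup.of 1 ^ s := by
    rw [mul_assoc, presented_y_mul_x, inv_mul_cancel_left]
  have h2 := conj_zpow (i := k) (a := (PresentedGroup.of 0 : Grp n s)⁻¹)
    (b := PresentedGroup.of 1)
  rw [inv_inv, h, ← zpow_mul] at h2
  rw [h2, mul_assoc, mul_inv_cancel_left]

/-- The powers of the generator `y` of the presented group. -/
def presentedY (n : ℕ) (s : ℤ) : ZMod n →+ Additive (Grp n s) :=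
  ZMod.lift n ⟨zmultiplesHom _ (Additive.ofMul (PresentedGroup.of 1)), by
    rw [zmultiplesHom_apply, natCast_zsmul, ← ofMul_pow, presented_y_pow, ofMul_one]⟩

theorem presentedY_intCast (k : ℤ) :
    (presentedY n s (k : ZMod n)).toMul = PresentedGroup.of 1 ^ k := by
  rw [presentedY, ZMod.lift_coe]
  rfl

variable [h : Fact (IsAdmissible n s)]

/-- The homomorphism from the normal forms to the presented group. -/
def NormalForm.toPresented : NormalForm n s →* Grp n s :=
  MonoidHom.mk' (fun | .y a => (presentedY n s a).toMul
                     | .x a => PresentedGroup.of 0 * (presentedY n s a).toMul) (by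
    have hadd : ∀ a b : ZMod n, (presentedY n s (a + b)).toMul =
        (presentedY n s a).toMul * (presentedY n s b).toMul := fun a b => by
      rw [map_add]; rfl
    have hx : ∀ a : ZMod n, (presentedY n s a).toMul * PresentedGroup.of 0 =
        PresentedGroup.of 0 * (presentedY n s (s * a)).toMul := by
      intro a
      obtain ⟨k, rfl⟩ := ZMod.intCast_surjective a
      rw [presentedY_intCast, ← Int.cast_mul, presentedY_intCast, presented_y_zpow_mul_x]
    have hm : (presentedY n s ((n / 2 : ℕ) : ZMod n)).toMul =
        PresentedGroup.of 0 * PresentedGroup.of 0 := by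
      rw [← Int.cast_natCast, presentedY_intCast, zpow_natCast, ← presented_x_sq, _root_.sq]
    rintro (a | a) (b | b)
    · exact hadd a b
    · show PresentedGroup.of 0 * (presentedY n s (s * a + b)).toMul = _
      rw [hadd, ← mul_assoc, ← hx, mul_assoc]
    · show PresentedGroup.of 0 * (presentedY n s (a + b)).toMul = _
      rw [hadd, ← mul_assoc]
    · show (presentedY n s (((n / 2 : ℕ) : ZMod n) + (s : ZMod n) * a + b)).toMul = _
      rw [hadd, hadd, hm, mul_assoc (PresentedGroup.of 0 : Grp n s), ← hx]
      simp only [mul_assoc])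

/-- The presented group is the group of normal forms. -/
def equivNormalForm : Grp n s ≃* NormalForm n s where
  toFun := NormalForm.ofPresented
  invFun := NormalForm.toPresented
  left_inv := by
    intro g
    have : NormalForm.toPresented.comp NormalForm.ofPresented = MonoidHom.id (Grp n s) := by
      refine PresentedGroup.ext fun i => ?_
      have h1 := presentedY_intCast (n := n) (s := s) 1
      fin_cases i
      · show NormalForm.toPresented (NormalForm.ofPresented (PresentedGroup.of 0)) = _
        rw [NormalForm.ofPresented_of_zero]
        show PresentedGroup.of 0 * (presentedY n s 0).toMul = _
        rw [map_zero, toMul_zero, mul_one]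
        rfl
      · show NormalForm.toPresented (NormalForm.ofPresented (PresentedGroup.of 1)) = _
        rw [NormalForm.ofPresented_of_one]
        rw [Int.cast_one, zpow_one] at h1
        exact h1
    exact DFunLike.congr_fun this g
  right_inv := by
    have hy : ∀ a : ZMod n, NormalForm.ofPresented (presentedY n s a).toMul =
        NormalForm.y a := by
      intro a
      obtain ⟨k, rfl⟩ := ZMod.intCast_surjective a
      rw [presentedY_intCast, map_zpow, NormalForm.ofPresented_of_one, NormalForm.y_zpow]
      simp
    rintro (a | a)
    · exact hy a
    · show NormalForm.ofPresented (PresentedGroup.of 0 * (presentedY n s a).toMul) = _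
      rw [map_mul, hy, NormalForm.ofPresented_of_zero, NormalForm.x_mul_y, zero_add]
  map_mul' := map_mul _

end Presentation

/-! ### The exponent and a product-one free sequence of length `n` -/

namespace NormalForm

variable {n : ℕ} {s : ℤ} [h : Fact (IsAdmissible n s)]

theorem dvd_exponent : n ∣ Monoid.exponent (NormalForm n s) := by
  have h1 : (y 1 : NormalForm n s) ^ Monoid.exponent (NormalForm n s) = y 0 :=
    Monoid.pow_exponent_eq_one _
  rw [y_pow] at h1
  injection h1 with h1
  rwa [nsmul_eq_mul, mul_one, ZMod.natCast_eq_zero_iff] at h1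

theorem exponent_of_four_dvd [NeZero n] (h4 : 4 ∣ n) :
    Monoid.exponent (NormalForm n s) = n := by
  refine Nat.dvd_antisymm (Monoid.exponent_dvd_of_forall_pow_eq_one ?_) dvd_exponent
  obtain ⟨m, hm⟩ := h4
  obtain ⟨t, ht⟩ := h.out.odd
  have h4m : (4 : ZMod n) * m = 0 := by
    have : ((4 * m : ℕ) : ZMod n) = 0 := (ZMod.natCast_eq_zero_iff _ _).2 hm.dvd
    exact_mod_cast this
  rintro (a | a)
  · rw [y_pow, one_def]; simp
  · have : (x a : NormalForm n s) ^ n = (x a ^ 2) ^ (2 * m) := by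
      rw [← pow_mul]; congr 1; omega
    rw [this, x_sq, y_pow, one_def, show n / 2 = 2 * m by omega, ht, nsmul_eq_mul]
    congr 1
    push_cast
    linear_combination (m + (t + 1) * a : ZMod n) * h4m

/-- The exponent is `n` or `2 n`, and `x^n = (x²)^m = y^(m²)` is not `1` because `m` is odd. -/
theorem exponent_of_odd_half [NeZero n] {m : ℕ} (hm : Odd m) (hn : n = 2 * m) :
    Monoid.exponent (NormalForm n s) = 2 * n := by
  have hpos : 0 < n := Nat.pos_of_ne_zero (NeZero.ne n)
  obtain ⟨d, hd⟩ := dvd_exponent (n := n) (s := s)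
  have h2 : Monoid.exponent (NormalForm n s) ∣ 2 * n := by
    rw [← natCard (n := n) (s := s)]; exact Group.exponent_dvd_nat_card
  rw [hd, mul_comm 2 n] at h2
  have h3 : d ∣ 2 := Nat.dvd_of_mul_dvd_mul_left hpos h2
  rcases (Nat.dvd_prime Nat.prime_two).1 h3 with rfl | rfl
  · exfalso
    have h4 : (x 0 : NormalForm n s) ^ n = y 0 := by
      have := Monoid.pow_exponent_eq_one (x 0 : NormalForm n s)
      rwa [hd, mul_one] at this
    have h5 : (x 0 : NormalForm n s) ^ n = (x 0 ^ 2) ^ m := by rw [← pow_mul]; exact congrArg _ hn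
    rw [h5, x_sq, y_pow] at h4
    injection h4 with h4
    rw [mul_zero, add_zero, nsmul_eq_mul, ← Nat.cast_mul, ZMod.natCast_eq_zero_iff,
      show n / 2 = m by omega, hn] at h4
    have : 2 ∣ m := Nat.dvd_of_mul_dvd_mul_right (by omega : 0 < m) h4
    obtain ⟨t, rfl⟩ := hm
    omega
  · rw [hd, mul_comm]

/-- A single `x` is excluded by parity, and without it fewer than `n` copies of `y` remain. -/
theorem isProductOneFree (hn : 1 ≤ n) :
    IsProductOneFree (x 0 ::ₘ Multiset.replicate (n - 1) (y 1 : NormalForm n s)) := by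
  rintro T hT h1 hone
  have hpar : (T.map parity).prod = 1 := by
    obtain ⟨l, rfl, hl⟩ := hone
    simpa [hl] using (map_list_prod (parity (n := n) (s := s)) l).symm
  by_cases hx : (x 0 : NormalForm n s) ∈ T
  · obtain ⟨U, rfl⟩ := Multiset.exists_cons_of_mem hx
    obtain ⟨j, -, rfl⟩ := Multiset.le_replicate_iff.1 ((Multiset.cons_le_cons_iff _).1 hT)
    rw [Multiset.map_cons, Multiset.map_replicate, parity_y, Multiset.prod_cons,
      Multiset.prod_replicate, one_pow, mul_one, parity_x] at hpar
    exact absurd hpar (by decide)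
  · obtain ⟨j, hj, rfl⟩ := Multiset.le_replicate_iff.1 ((Multiset.le_cons_of_notMem hx).1 hT)
    obtain ⟨l, hl, hl1⟩ := hone
    rw [← Multiset.coe_replicate, Multiset.coe_eq_coe, List.perm_replicate] at hl
    rw [hl, List.prod_replicate, y_pow, one_def] at hl1
    injection hl1 with hl1
    rw [nsmul_eq_mul, mul_one, ZMod.natCast_eq_zero_iff] at hl1
    rw [Multiset.card_replicate] at h1
    exact absurd (Nat.le_of_dvd h1 hl1) (by omega)

end NormalForm

end ZeroSum

namespace ZeroSum

/-! ### Sequences over the group when `4 ∣ n` -/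

theorem exists_map_eq_of_forall {α β : Type*} (f : α → β) (Q : α → Prop) {B : Multiset β}
    (h : ∀ b ∈ B, ∃ a, f a = b ∧ Q a) : ∃ C : Multiset α, C.map f = B ∧ ∀ a ∈ C, Q a := by
  induction B using Multiset.induction_on with
  | empty => exact ⟨0, by simp⟩
  | cons b B ih =>
    obtain ⟨C, rfl, hC⟩ := ih fun b hb => h b (by simp [hb])
    obtain ⟨a, rfl, ha⟩ := h b (by simp)
    refine ⟨a ::ₘ C, by simp, ?_⟩
    intro c hc
    rcases Multiset.mem_cons.1 hc with rfl | hc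
    exacts [ha, hC c hc]

/-- The isomorphism of `ZMod m` with the subgroup `2 ZMod (2 m)`. -/
def doubling (m : ℕ) : ZMod m →+ ZMod (2 * m) :=
  ZMod.lift m ⟨zmultiplesHom _ (2 : ZMod (2 * m)), by
    rw [zmultiplesHom_apply, natCast_zsmul, nsmul_eq_mul]
    have := ZMod.natCast_self (2 * m)
    push_cast at this
    rw [mul_comm (m : ZMod (2 * m)) 2, this]⟩

theorem doubling_intCast (m : ℕ) (k : ℤ) : doubling m k = 2 * k := by
  rw [doubling, ZMod.lift_coe]
  simp [mul_comm]

/-- Reduction modulo `2`. -/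
def parityMod (m : ℕ) : ZMod (2 * m) →+* ZMod 2 := ZMod.castHom (dvd_mul_right 2 m) (ZMod 2)

theorem exists_doubling_eq {m : ℕ} {c : ZMod (2 * m)} (h : parityMod m c = 0) :
    ∃ d, doubling m d = c := by
  obtain ⟨k, rfl⟩ := ZMod.intCast_surjective c
  rw [map_intCast, ZMod.intCast_zmod_eq_zero_iff_dvd] at h
  obtain ⟨d, rfl⟩ := h
  exact ⟨d, by rw [doubling_intCast]; push_cast; ring⟩

theorem parityMod_intCast_of_odd {m : ℕ} {s : ℤ} (h : Odd s) : parityMod m s = 1 := by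
  rw [map_intCast]
  exact (ZMod.intCast_eq_one_iff_odd).2 h

theorem parityMod_natCast_of_even {m k : ℕ} (h : Even k) : parityMod m k = 0 := by
  rw [map_natCast]
  exact (ZMod.natCast_eq_zero_iff_even).2 h

namespace NormalForm

variable {m : ℕ} {s : ℤ}

/-- The type (power of `y` or not) and the parity of the exponent of `y`. -/
def parityClass : NormalForm (2 * m) s → Bool × ZMod 2
  | y a => (false, parityMod m a)
  | x a => (true, parityMod m a)

/-- Four distinct classes exhaust `Bool × ZMod 2`. Only the difference of the two parities is
recorded, so that either index can be the even one when terms are exchanged later. -/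
theorem exists_four_terms {L : Multiset (NormalForm (2 * m) s)} (hL : L.card = 4)
    (h : ∀ u v, {u, v} ≤ L → parityClass u ≠ parityClass v) :
    ∃ a₀ a₁ b₀ b₁, L = {x b₀, x b₁, y a₀, y a₁} ∧ parityMod m a₁ = parityMod m a₀ + 1 ∧
      parityMod m b₁ = parityMod m b₀ + 1 := by
  have hnd : (L.map parityClass).Nodup := by
    rw [Multiset.nodup_iff_le]
    intro c hc
    obtain ⟨U, hU, hUc⟩ := exists_le_map_eq _ hc
    obtain ⟨u, v, rfl⟩ := Multiset.card_eq_two.1 (by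
      rw [← Multiset.card_map parityClass U, hUc]; rfl : U.card = 2)
    simp only [Multiset.insert_eq_cons, Multiset.map_cons, Multiset.map_singleton] at hUc
    have h1 : parityClass u ∈ c ::ₘ c ::ₘ 0 := by rw [← hUc]; simp
    have h2 : parityClass v ∈ c ::ₘ c ::ₘ 0 := by rw [← hUc]; simp
    simp at h1 h2
    exact h u v hU (h1.trans h2.symm)
  have hall : ∀ c, c ∈ L.map parityClass := by
    intro c
    have := Finset.eq_univ_of_card (⟨_, hnd⟩ : Finset (Bool × ZMod 2))
      (by rw [Finset.card_mk, Multiset.card_map, hL]; rfl)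
    have hc := Finset.mem_univ c
    rw [← this] at hc
    exact hc
  have hy : ∀ e, ∃ a, y a ∈ L ∧ parityMod m a = e := by
    intro e
    obtain ⟨u, hu, hue⟩ := Multiset.mem_map.1 (hall (false, e))
    rcases u with a | a <;> simp [parityClass] at hue
    exact ⟨a, hu, hue⟩
  have hx : ∀ e, ∃ a, x a ∈ L ∧ parityMod m a = e := by
    intro e
    obtain ⟨u, hu, hue⟩ := Multiset.mem_map.1 (hall (true, e))
    rcases u with a | a <;> simp [parityClass] at hue
    exact ⟨a, hu, hue⟩
  obtain ⟨a₀, ha₀, pa₀⟩ := hy 0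
  obtain ⟨a₁, ha₁, pa₁⟩ := hy 1
  obtain ⟨b₀, hb₀, pb₀⟩ := hx 0
  obtain ⟨b₁, hb₁, pb₁⟩ := hx 1
  have hne : ∀ {z w : ZMod (2 * m)}, parityMod m z = 0 → parityMod m w = 1 → z ≠ w := by
    rintro z w hz hw rfl
    rw [hz] at hw
    exact absurd hw (by decide)
  refine ⟨a₀, a₁, b₀, b₁, (Multiset.eq_of_le_of_card_le ?_ (by simp [hL])).symm,
    by rw [pa₀, pa₁, zero_add], by rw [pb₀, pb₁, zero_add]⟩
  refine (Multiset.le_iff_subset ?_).2 ?_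
  · simp [hne pa₀ pa₁, hne pb₀ pb₁]
  · intro z hz
    simp at hz
    rcases hz with rfl | rfl | rfl | rfl <;> assumption

variable [hF : Fact (IsAdmissible (2 * m) s)]

/-- Powers of `y²`. -/
def evenHom : Multiplicative (ZMod m) →* NormalForm (2 * m) s :=
  yHom.comp (doubling m).toMultiplicative

theorem evenHom_ofAdd (d : ZMod m) :
    evenHom (s := s) (Multiplicative.ofAdd d) = y (doubling m d) := rfl

theorem half_eq : ((2 * m / 2 : ℕ) : ZMod (2 * m)) = m := by
  rw [Nat.mul_div_cancel_left m (by norm_num)]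

/-- Modulo `2` both `s = 1` and `m = 0`, so the exponent of `u * v` is a sum of two equal parities.
-/
theorem exists_evenHom_eq_mul (hm : Even m) {u v : NormalForm (2 * m) s}
    (h : parityClass u = parityClass v) :
    ∃ d, evenHom (Multiplicative.ofAdd d) = u * v := by
  have h2 : ∀ z : ZMod 2, z + z = 0 := by decide
  rcases u with a | a <;> rcases v with b | b <;> simp only [parityClass, Prod.mk.injEq] at h
  · obtain ⟨d, hd⟩ := exists_doubling_eq (m := m) (c := a + b) (by rw [map_add, h.2, h2])
    exact ⟨d, by rw [evenHom_ofAdd, hd, y_mul_y]⟩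
  · simp at h
  · simp at h
  · obtain ⟨d, hd⟩ := exists_doubling_eq (m := m)
      (c := ((2 * m / 2 : ℕ) : ZMod (2 * m)) + (s : ZMod (2 * m)) * a + b) (by
        rw [map_add, map_add, map_mul, half_eq, parityMod_natCast_of_even hm,
          parityMod_intCast_of_odd hF.out.odd, h.2, zero_add, one_mul, h2])
    exact ⟨d, by rw [evenHom_ofAdd, hd, x_mul_x]⟩

open Classical in
/-- Half the exponent of the product of two terms of the same parity class. -/
noncomputable def halfExp (p : NormalForm (2 * m) s × NormalForm (2 * m) s) : ZMod m :=
  if h : ∃ d, evenHom (Multiplicative.ofAdd d) = p.1 * p.2 then h.choose else 0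

theorem evenHom_halfExp (hm : Even m) {p : NormalForm (2 * m) s × NormalForm (2 * m) s}
    (h : parityClass p.1 = parityClass p.2) :
    evenHom (Multiplicative.ofAdd (halfExp p)) = p.1 * p.2 := by
  have h1 := exists_evenHom_eq_mul hm h
  rw [halfExp, dif_pos h1]
  exact h1.choose_spec

/-- The sequence formed by two terms. -/
def pairSeq {α : Type*} (p : α × α) : Multiset α := {p.1, p.2}

theorem evenHom_sum_mem_products (hm : Even m)
    {C : Multiset (NormalForm (2 * m) s × NormalForm (2 * m) s)}
    (hC : ∀ p ∈ C, parityClass p.1 = parityClass p.2) :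
    evenHom (Multiplicative.ofAdd (C.map halfExp).sum) ∈ products (C.map pairSeq).sum := by
  refine map_sum_mem_products evenHom pairSeq halfExp C fun p hp => ?_
  rw [evenHom_halfExp hm (hC p hp)]
  exact ⟨[p.1, p.2], rfl, by simp⟩

theorem card_sum_pairSeq {α : Type*} (C : Multiset (α × α)) :
    (C.map pairSeq).sum.card = C.card * 2 := by
  rw [card_sum_of_forall (r := 2), Multiset.card_map]
  intro T hT
  obtain ⟨p, -, rfl⟩ := Multiset.mem_map.1 hT
  rfl

/-- Here `U` is either empty or the four terms left outside the pairs. -/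
theorem hasProductOneSubseq_of_sum_eq_zero (hm : Even m)
    {C : Multiset (NormalForm (2 * m) s × NormalForm (2 * m) s)}
    (hC : ∀ p ∈ C, parityClass p.1 = parityClass p.2) {S U : Multiset (NormalForm (2 * m) s)}
    (hS : (C.map pairSeq).sum + U ≤ S) {d : ZMod m}
    (hd : evenHom (Multiplicative.ofAdd d) ∈ products U)
    (hcard : C.card * 2 + U.card = 2 * m) (h0 : (C.map halfExp).sum + d = 0) :
    HasProductOneSubseq (2 * m) S := by
  refine ⟨_, hS, by rw [Multiset.card_add, card_sum_pairSeq, hcard], ?_⟩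
  have := mul_mem_products_add (evenHom_sum_mem_products hm hC) hd
  rwa [← map_mul, ← ofAdd_add, h0, ofAdd_zero, map_one] at this

theorem hasProductOneSubseq_of_pairs (hm : Even m)
    {C : Multiset (NormalForm (2 * m) s × NormalForm (2 * m) s)}
    (hC : ∀ p ∈ C, parityClass p.1 = parityClass p.2) {S : Multiset (NormalForm (2 * m) s)}
    (hS : (C.map pairSeq).sum ≤ S) {E : Multiset (ZMod m)} (hE : E ≤ C.map halfExp)
    (hEm : E.card = m) (h0 : E.sum = 0) : HasProductOneSubseq (2 * m) S := by
  obtain ⟨D, hD, rfl⟩ := exists_le_map_eq _ hE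
  refine hasProductOneSubseq_of_sum_eq_zero hm (fun p hp => hC p (Multiset.mem_of_le hD hp))
    (U := 0) (d := 0) ?_ (by simpa using one_mem_products_zero) ?_ (by simpa using h0)
  · rw [add_zero]
    exact (sum_le_sum_of_le (Multiset.map_le_map hD)).trans hS
  · rw [Multiset.card_map] at hEm
    simp [hEm, mul_comm]

/-- This is the hypothesis `huniq` of the inverse theorem for a cyclic group: such an element has `2
* z.val = m`. -/
theorem add_self_eq_zero_unique (hm : 0 < m) (r r' : ZMod m) (h : r + r = 0) (h' : r' + r' = 0)
    (h0 : r ≠ 0) (h0' : r' ≠ 0) : r = r' := by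
  have : NeZero m := ⟨hm.ne'⟩
  have key : ∀ z : ZMod m, z + z = 0 → z ≠ 0 → 2 * z.val = m := by
    intro z hz hz0
    have h1 : ((2 * z.val : ℕ) : ZMod m) = 0 := by
      push_cast
      rw [ZMod.natCast_zmod_val, two_mul, hz]
    rw [ZMod.natCast_eq_zero_iff] at h1
    obtain ⟨c, hc⟩ := h1
    have h2 := ZMod.val_lt z
    have h3 : 0 < z.val := Nat.pos_of_ne_zero fun h => hz0 ((ZMod.val_eq_zero z).1 h)
    have h4 : c < 2 := by
      by_contra h5
      have : m * 2 ≤ m * c := Nat.mul_le_mul_left _ (by omega)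
      omega
    interval_cases c <;> omega
  have h1 := key r h h0
  have h2 := key r' h' h0'
  exact ZMod.val_injective m (by omega)

/-- If all but four terms are paired off within their parity classes and there is no product-one
subsequence of length `2 m`, then the four terms commute with one another as far as the parity
classes allow. -/
theorem four_terms (hm : Even m) (hm2 : 2 ≤ m)
    {C : Multiset (NormalForm (2 * m) s × NormalForm (2 * m) s)}
    (hC : ∀ p ∈ C, parityClass p.1 = parityClass p.2) {S : Multiset (NormalForm (2 * m) s)}
    {a₀ a₁ b₀ b₁ : ZMod (2 * m)} (hS : (C.map pairSeq).sum + {x b₀, x b₁, y a₀, y a₁} = S)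
    (hCc : C.card + 2 = 2 * m) (ha : parityMod m a₁ = parityMod m a₀ + 1)
    (hb : parityMod m b₁ = parityMod m b₀ + 1) (hno : ¬ HasProductOneSubseq (2 * m) S) :
    (s - 1 : ZMod (2 * m)) * a₀ = 0 ∧ (s - 1 : ZMod (2 * m)) * a₁ = 0 ∧
      (s - 1 : ZMod (2 * m)) * (b₀ - b₁) = 0 ∧
      ∃ p ∈ C, ∃ q ∈ C, ∀ z, ∃ i : ℕ, i • (halfExp p - halfExp q) = z := by
  have : NeZero m := ⟨by omega⟩
  obtain ⟨g, hg, h, hh, hgen, hsum⟩ := exists_generator_of_forall_sum_ne_zero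
    (E := C.map halfExp) (add_self_eq_zero_unique (by omega)) (by simpa [ZMod.card] using hCc)
    (by rw [ZMod.card]; omega) (fun T hT hc h0 => hno (hasProductOneSubseq_of_pairs hm hC
      ((Multiset.le_add_right _ _).trans hS.le) hT (by simpa [ZMod.card] using hc) h0))
  -- Any other even exponent would be cancelled by `m - 2` pairs, giving `2(m - 2) + 4 = 2m` terms
  -- with product one.
  have key : ∀ c, y c ∈ products ({x b₀, x b₁, y a₀, y a₁} : Multiset (NormalForm (2 * m) s)) →
      parityMod m c = 0 → c = doubling m (g + h) := by
    intro c hc hpar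
    obtain ⟨d, rfl⟩ := exists_doubling_eq hpar
    by_contra hne
    obtain ⟨T, hT, hTc, hT0⟩ := hsum d (fun e => hne (by rw [e]))
    obtain ⟨D, hD, rfl⟩ := exists_le_map_eq _ hT
    refine hno (hasProductOneSubseq_of_sum_eq_zero hm
      (fun p hp => hC p (Multiset.mem_of_le hD hp)) (U := {x b₀, x b₁, y a₀, y a₁}) (d := d) ?_
      hc ?_ hT0)
    · rw [← hS]
      exact add_le_add_left (sum_le_sum_of_le (Multiset.map_le_map hD)) _
    · rw [Multiset.card_map, ZMod.card] at hTc
      simp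
      omega
  have hps := parityMod_intCast_of_odd (m := m) hF.out.odd
  have hpm := parityMod_natCast_of_even (m := m) hm
  have h2 : ∀ z w : ZMod 2, z + (z + 1) + (w + (w + 1)) = 0 := by decide
  -- Four orders of the same terms must give one exponent. Comparing with the first order: moving `y
  -- a₀` or `y a₁` past `x b₁` gives the first two relations, exchanging the two `x`-terms the
  -- third.
  have e1 := key (m + s * b₀ + b₁ + a₀ + a₁)
    ⟨[x b₀, x b₁, y a₀, y a₁], rfl, by
      simp only [List.prod_cons, List.prod_nil, mul_one, y_mul_y, x_mul_y, x_mul_x, half_eq]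
      congr 1; ring⟩ (by
        simp only [map_add, map_mul, hps, hpm, ha, hb]
        linear_combination h2 (parityMod m b₀) (parityMod m a₀))
  have e2 := key (m + s * (b₀ + a₀) + b₁ + a₁)
    ⟨[x b₀, y a₀, x b₁, y a₁], by
      rw [← Multiset.cons_coe, ← Multiset.cons_coe, ← Multiset.cons_coe, Multiset.cons_swap (y a₀)]
      rfl, by
      simp only [List.prod_cons, List.prod_nil, mul_one, y_mul_x, x_mul_y, x_mul_x, half_eq]
      congr 1; ring⟩ (by
        simp only [map_add, map_mul, hps, hpm, ha, hb]
        linear_combination h2 (parityMod m b₀) (parityMod m a₀))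
  have e3 := key (m + s * (b₀ + a₁) + b₁ + a₀)
    ⟨[x b₀, y a₁, x b₁, y a₀], by
      rw [← Multiset.cons_coe, ← Multiset.cons_coe, ← Multiset.cons_coe, Multiset.cons_swap (y a₁),
        ← Multiset.cons_coe, Multiset.cons_swap (y a₁)]
      rfl, by
      simp only [List.prod_cons, List.prod_nil, mul_one, y_mul_x, x_mul_y, x_mul_x, half_eq]
      congr 1; ring⟩ (by
        simp only [map_add, map_mul, hps, hpm, ha, hb]
        linear_combination h2 (parityMod m b₀) (parityMod m a₀))
  have e4 := key (m + s * b₁ + b₀ + a₀ + a₁)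
    ⟨[x b₁, x b₀, y a₀, y a₁], by
      rw [← Multiset.cons_coe, ← Multiset.cons_coe, Multiset.cons_swap]
      rfl, by
      simp only [List.prod_cons, List.prod_nil, mul_one, y_mul_y, x_mul_y, x_mul_x, half_eq]
      congr 1; ring⟩ (by
        simp only [map_add, map_mul, hps, hpm, ha, hb]
        linear_combination h2 (parityMod m b₀) (parityMod m a₀))
  rw [← e1] at e2 e3 e4
  refine ⟨by linear_combination e2, by linear_combination e3, by linear_combination -e4, ?_⟩
  obtain ⟨p, hp, rfl⟩ := Multiset.mem_map.1 hg
  obtain ⟨q, hq, rfl⟩ := Multiset.mem_map.1 hh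
  exact ⟨p, hp, q, hq, hgen⟩

/-- A sequence without such a subsequence is so commutative that `s - 1` annihilates both `2` and an
odd element of `ZMod (2 * m)`, against `hs`. -/
theorem hasProductOneSubseq_of_four_dvd (hm : Even m) (hm2 : 2 ≤ m)
    (hs : ¬ s ≡ 1 [ZMOD ((2 * m : ℕ) : ℤ)]) {S : Multiset (NormalForm (2 * m) s)}
    (hS : 2 * (2 * m) ≤ S.card) : HasProductOneSubseq (2 * m) S := by
  classical
  obtain ⟨S', hS', hSc⟩ := exists_le_card_eq hS
  by_contra hno'
  have hno : ¬ HasProductOneSubseq (2 * m) S' := fun ⟨T, hT, h⟩ => hno' ⟨T, hT.trans hS', h⟩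
  clear hno'
  have hpair : ∀ U : Multiset (NormalForm (2 * m) s), 5 ≤ U.card →
      ∃ u v, {u, v} ≤ U ∧ parityClass u = parityClass v := by
    intro U hU
    obtain ⟨L, hL, hLc⟩ := exists_le_card_eq (n := 4) (by omega : 4 ≤ U.card)
    by_contra! hcon
    obtain ⟨a₀, a₁, b₀, b₁, rfl, ha, hb⟩ :=
      exists_four_terms hLc fun u v h => hcon u v (h.trans hL)
    obtain ⟨D, rfl⟩ := Multiset.le_iff_exists_add.1 hL
    rw [Multiset.card_add, hLc] at hU
    obtain ⟨w, hw⟩ := Multiset.card_pos_iff_exists_mem.1 (by omega : 0 < D.card)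
    have hz : ∀ z ∈ ({x b₀, x b₁, y a₀, y a₁} : Multiset (NormalForm (2 * m) s)),
        parityClass z ≠ parityClass w := by
      intro z hz
      refine hcon z w ?_
      rw [Multiset.insert_eq_cons, ← Multiset.singleton_add]
      exact add_le_add (by simpa using hz) (by simpa using hw)
    have hdec : ∀ p q : ZMod 2, p ≠ q → p + 1 = q := by decide
    rcases w with a | b
    · have h1 := hz (y a₀) (by simp)
      have h2 := hz (y a₁) (by simp)
      simp only [parityClass, ne_eq, Prod.mk.injEq, true_and] at h1 h2
      exact h2 (ha ▸ hdec _ _ h1)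
    · have h1 := hz (x b₀) (by simp)
      have h2 := hz (x b₁) (by simp)
      simp only [parityClass, ne_eq, Prod.mk.injEq, true_and] at h1 h2
      exact h2 (hb ▸ hdec _ _ h1)
  obtain ⟨B, hBc, hB, hBS⟩ := exists_blocks (S := S')
    (fun T => ∃ u v, T = {u, v} ∧ parityClass u = parityClass v) (r := 2) (c := 5)
    (fun U _ hU => by
      obtain ⟨u, v, h1, h2⟩ := hpair U hU
      exact ⟨_, h1, by simp, u, v, rfl, h2⟩) (2 * m - 2) (by omega)
  obtain ⟨C, rfl, hC⟩ := exists_map_eq_of_forall pairSeq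
    (fun p => parityClass p.1 = parityClass p.2) (B := B) (fun T hT => by
      obtain ⟨-, u, v, rfl, h⟩ := hB T hT
      exact ⟨(u, v), rfl, h⟩)
  rw [Multiset.card_map] at hBc
  have hLc : (S' - (C.map pairSeq).sum).card = 4 := by
    rw [Multiset.card_sub hBS, card_sum_pairSeq]; omega
  have hLS : (C.map pairSeq).sum + (S' - (C.map pairSeq).sum) = S' := add_tsub_cancel_of_le hBS
  -- Two leftover terms of one class would form pair number `2m - 1`, enough for Erdős–Ginzburg–Ziv
  -- in `ZMod m`.
  obtain ⟨a₀, a₁, b₀, b₁, hL, ha, hb⟩ := exists_four_terms hLc (by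
    intro u v huv heq
    obtain ⟨E, hE, hEc, hE0⟩ := isEGZ_zmod m (((u, v) ::ₘ C).map halfExp) (by simp; omega)
    refine hno (hasProductOneSubseq_of_pairs hm (C := (u, v) ::ₘ C) ?_ ?_ hE hEc hE0)
    · intro p hp
      rcases Multiset.mem_cons.1 hp with rfl | hp
      exacts [heq, hC p hp]
    · rw [Multiset.map_cons, Multiset.sum_cons, add_comm]
      conv_rhs => rw [← hLS]
      exact add_le_add_right huv _)
  rw [hL] at hLS
  obtain ⟨h0, h1, hb01, p, hp, q, hq, hgen⟩ :=
    four_terms hm hm2 hC hLS (by omega) ha hb hno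
  -- Exchanging a paired term `u` with the leftover term of its class gives another configuration of
  -- the same shape, so the relations of `four_terms` hold for `u` too.
  have hswap : ∀ u v, (u, v) ∈ C ∨ (v, u) ∈ C →
      (∀ a, u = y a → (s - 1 : ZMod (2 * m)) * a = 0) ∧
      (∀ b, u = x b → (s - 1 : ZMod (2 * m)) * (b - b₁) = 0) := by
    intro u v huv
    obtain ⟨D, hD, hcls⟩ : ∃ D : Multiset (NormalForm (2 * m) s × NormalForm (2 * m) s),
        ((C.map pairSeq).sum = {u, v} + (D.map pairSeq).sum ∧ D.card + 1 = C.card ∧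
          ∀ p ∈ D, parityClass p.1 = parityClass p.2) ∧ parityClass u = parityClass v := by
      rcases huv with h | h
      · obtain ⟨D, rfl⟩ := Multiset.exists_cons_of_mem h
        exact ⟨D, ⟨by simp [pairSeq], by simp, fun p hp => hC p (by simp [hp])⟩, hC _ h⟩
      · obtain ⟨D, rfl⟩ := Multiset.exists_cons_of_mem h
        refine ⟨D, ⟨?_, by simp, fun p hp => hC p (by simp [hp])⟩, (hC _ h).symm⟩
        rw [Multiset.map_cons, Multiset.sum_cons, Multiset.pair_comm]
        rfl
    obtain ⟨hDs, hDc, hDp⟩ := hD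
    have happ : ∀ w, parityClass w = parityClass v → ∀ a₀' a₁' b₀' b₁' : ZMod (2 * m),
        ({u} : Multiset (NormalForm (2 * m) s)) + {x b₀, x b₁, y a₀, y a₁} =
          {w} + {x b₀', x b₁', y a₀', y a₁'} →
        parityMod m a₁' = parityMod m a₀' + 1 → parityMod m b₁' = parityMod m b₀' + 1 →
        (s - 1 : ZMod (2 * m)) * a₀' = 0 ∧ (s - 1 : ZMod (2 * m)) * a₁' = 0 ∧
          (s - 1 : ZMod (2 * m)) * (b₀' - b₁') = 0 := by
      intro w hw a₀' a₁' b₀' b₁' he ha' hb'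
      have := four_terms (C := (w, v) ::ₘ D) (S := S') hm hm2 (by
        intro p hp
        rcases Multiset.mem_cons.1 hp with rfl | hp
        exacts [hw, hDp p hp]) (by
          have h3 : ({w, v} : Multiset (NormalForm (2 * m) s)) = {w} + {v} := rfl
          have h4 : ({u, v} : Multiset (NormalForm (2 * m) s)) = {u} + {v} := rfl
          rw [Multiset.map_cons, Multiset.sum_cons, ← hLS, hDs]
          show {w, v} + _ + _ = _
          rw [h3, h4]
          calc _ = ({w} + {x b₀', x b₁', y a₀', y a₁'}) + {v} + (D.map pairSeq).sum := by abel
            _ = _ := by rw [← he]; abel) (by simp; omega) ha' hb' hno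
      exact ⟨this.1, this.2.1, this.2.2.1⟩
    have hdec : ∀ p q r : ZMod 2, p ≠ q → r = p + 1 → q = r := by decide
    constructor
    · rintro a rfl
      by_cases hpa : parityMod m a = parityMod m a₀
      · refine (happ (y a₀) ?_ a a₁ b₀ b₁ ?_ (by rw [ha, hpa]) hb).1
        · rw [← hcls]; simp [parityClass, hpa]
        · simp only [Multiset.insert_eq_cons, ← Multiset.singleton_add]
          abel
      · have hpa' := hdec _ _ _ (Ne.symm hpa) ha
        refine (happ (y a₁) ?_ a₀ a b₀ b₁ ?_ (by rw [hpa', ha]) hb).2.1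
        · rw [← hcls]; simp [parityClass, hpa']
        · simp only [Multiset.insert_eq_cons, ← Multiset.singleton_add]
          abel
    · rintro b rfl
      by_cases hpb : parityMod m b = parityMod m b₀
      · refine (happ (x b₀) ?_ a₀ a₁ b b₁ ?_ ha (by rw [hb, hpb])).2.2
        · rw [← hcls]; simp [parityClass, hpb]
        · simp only [Multiset.insert_eq_cons, ← Multiset.singleton_add]
          abel
      · have hpb' := hdec _ _ _ (Ne.symm hpb) hb
        have := (happ (x b₁) (by rw [← hcls]; simp [parityClass, hpb']) a₀ a₁ b₀ b (by
          simp only [Multiset.insert_eq_cons, ← Multiset.singleton_add]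
          abel) ha (by rw [hpb', hb])).2.2
        linear_combination hb01 - this
  -- For two `x`-terms the exponent is `m + s a + b`, and `(s - 1) s a = -(s - 1) a` by `s² = 1`, so
  -- only `(s - 1)(b - a) = 0` is needed.
  have hval : ∀ p ∈ C, (s - 1 : ZMod (2 * m)) * doubling m (halfExp p) = 0 := by
    rintro ⟨u, v⟩ hp
    have h2 := evenHom_halfExp hm (hC _ hp)
    have h3 := hswap u v (.inl hp)
    have h4 := hswap v u (.inr hp)
    have h5 := hC _ hp
    rw [evenHom_ofAdd] at h2
    have h6 := hF.out.mul_natCast_half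
    have h7 := hF.out.mul_self
    rcases u with a | a <;> rcases v with b | b <;> simp [parityClass] at h5
    · have h2 : _ = y (a + b) := h2
      injection h2 with h2
      rw [h2]
      linear_combination h3.1 a rfl + h4.1 b rfl
    · have h2 : _ = y _ := h2
      injection h2 with h2
      rw [h2]
      linear_combination h6 + h4.2 b rfl - h3.2 a rfl + a * h7
  -- Since the difference of two pair values generates `ZMod m`, the annihilation of all pair values
  -- passes to `doubling m 1 = 2`.
  obtain ⟨i, hi⟩ := hgen 1
  have h2 : (s - 1 : ZMod (2 * m)) * 2 = 0 := by
    have e : doubling m 1 = 2 := by simpa using doubling_intCast m 1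
    rw [← e, ← hi, map_nsmul, map_sub, nsmul_eq_mul]
    linear_combination (i : ZMod (2 * m)) * (hval p hp) - (i : ZMod (2 * m)) * (hval q hq)
  have hodd : ∀ a : ZMod (2 * m), parityMod m a = 1 → (s - 1 : ZMod (2 * m)) * a = 0 →
      (s - 1 : ZMod (2 * m)) = 0 := by
    intro a hpa ha
    obtain ⟨d, hd⟩ := exists_doubling_eq (m := m) (c := a - 1) (by rw [map_sub, hpa]; simp)
    obtain ⟨k, rfl⟩ := ZMod.intCast_surjective d
    rw [doubling_intCast] at hd
    linear_combination ha + (s - 1 : ZMod (2 * m)) * hd - (k : ZMod (2 * m)) * h2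
  have hfin : (s - 1 : ZMod (2 * m)) = 0 := by
    have hdec : ∀ p : ZMod 2, p = 1 ∨ p + 1 = 1 := by decide
    rcases hdec (parityMod m a₀) with h | h
    · exact hodd a₀ h h0
    · exact hodd a₁ (by rw [ha, h]) h1
  refine hs ((ZMod.intCast_eq_intCast_iff _ _ _).1 ?_)
  push_cast
  linear_combination hfin

end NormalForm

end ZeroSum

namespace ZeroSum

/-! ### Sequences over dicyclic groups -/

theorem exists_pair_le_of_not_nodup {α β : Type*} {f : α → β} {U : Multiset α}
    (h : ¬ (U.map f).Nodup) : ∃ u v, {u, v} ≤ U ∧ f u = f v := by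
  rw [Multiset.nodup_iff_le] at h
  push Not at h
  obtain ⟨c, hc⟩ := h
  obtain ⟨V, hV, hVc⟩ := exists_le_map_eq _ hc
  obtain ⟨u, v, rfl⟩ := Multiset.card_eq_two.1 (by
    rw [← Multiset.card_map f V, hVc]; rfl : V.card = 2)
  have h1 : f u ∈ c ::ₘ c ::ₘ 0 := by rw [← hVc]; simp
  have h2 : f v ∈ c ::ₘ c ::ₘ 0 := by rw [← hVc]; simp
  simp at h1 h2
  exact ⟨u, v, hV, h1.trans h2.symm⟩

theorem exists_pair_le_of_lt_card {α : Type*} {f : α → ℕ} {U : Multiset α} {N : ℕ}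
    (hf : ∀ u, f u < N) (h : N < U.card) : ∃ u v, {u, v} ≤ U ∧ f u = f v := by
  refine exists_pair_le_of_not_nodup fun hnd => ?_
  have hsub : (⟨U.map f, hnd⟩ : Finset ℕ) ⊆ Finset.range N := by
    intro c hc
    obtain ⟨u, -, rfl⟩ := Multiset.mem_map.1 (show c ∈ U.map f from hc)
    exact Finset.mem_range.2 (hf u)
  have := Finset.card_le_card hsub
  rw [Finset.card_mk, Multiset.card_map, Finset.card_range] at this
  omega

theorem one_add_eq_zero_or_of_ne_zero :
    ∀ {p : ZMod 3}, p ≠ 0 → 1 + p = 0 ∨ 1 + -p = 0 := by decide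

namespace Dicyclic

open QuaternionGroup

variable {k : ℕ}

/-- Reduction modulo `k`. -/
def residue (k : ℕ) : ZMod (2 * k) →+* ZMod k := ZMod.castHom (dvd_mul_left k 2) (ZMod k)

theorem eq_zero_of_residue_of_parityMod (hk : Odd k) {c : ZMod (2 * k)} (h : residue k c = 0)
    (h2 : parityMod k c = 0) : c = 0 := by
  obtain ⟨z, rfl⟩ := ZMod.intCast_surjective c
  rw [map_intCast, ZMod.intCast_zmod_eq_zero_iff_dvd] at h h2
  rw [ZMod.intCast_zmod_eq_zero_iff_dvd]
  push_cast
  refine IsCoprime.mul_dvd ?_ (by exact_mod_cast h2) h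
  exact_mod_cast Nat.isCoprime_iff_coprime.2 ((Nat.coprime_two_left).2 hk)

theorem residue_natCast_self : residue k k = 0 := by rw [map_natCast, ZMod.natCast_self]

theorem parityMod_natCast_self (hk : Odd k) : parityMod k k = 1 := by
  rw [map_natCast]
  exact (ZMod.natCast_eq_one_iff_odd).2 hk

/-- The embedding of the cyclic subgroup. -/
def aHom : Multiplicative (ZMod (2 * k)) →* QuaternionGroup k where
  toFun c := a c.toAdd
  map_one' := rfl
  map_mul' _ _ := rfl

theorem a_sum_mem_products (F : Multiset (ZMod (2 * k))) : a F.sum ∈ products (F.map a) := by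
  have := map_sum_mem_products (aHom (k := k)) (fun c => {a c}) id F
    (fun c _ => self_mem_products_singleton (a c))
  rw [Multiset.map_id] at this
  have h2 : (F.map fun c => ({a c} : Multiset (QuaternionGroup k))).sum = F.map a := by
    induction F using Multiset.induction_on with
    | empty => rfl
    | cons c F ih =>
      rw [Multiset.map_cons, Multiset.sum_cons, ih (by
        simpa using map_sum_mem_products (aHom (k := k)) (fun c => {a c}) id F
          (fun c _ => self_mem_products_singleton (a c)))]
      simp
  rwa [h2] at this

/-- The residues of the signed sums of a sequence. -/
def signedSums (U : Multiset (ZMod (2 * k))) : Set (ZMod k) :=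
  {z | ∃ P Q, P + Q = U ∧ residue k Q.sum - residue k P.sum = z}

theorem zero_mem_signedSums_zero : (0 : ZMod k) ∈ signedSums (0 : Multiset (ZMod (2 * k))) :=
  ⟨0, 0, by simp, by simp⟩

theorem add_mem_signedSums {U V : Multiset (ZMod (2 * k))} {z w : ZMod k}
    (hz : z ∈ signedSums U) (hw : w ∈ signedSums V) : z + w ∈ signedSums (U + V) := by
  obtain ⟨P, Q, rfl, rfl⟩ := hz
  obtain ⟨P', Q', rfl, rfl⟩ := hw
  exact ⟨P + P', Q + Q', by abel, by simp; ring⟩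

theorem residue_mem_signedSums (c : ZMod (2 * k)) :
    residue k c ∈ signedSums {c} := ⟨0, {c}, by simp, by simp⟩

theorem neg_residue_mem_signedSums (c : ZMod (2 * k)) :
    -residue k c ∈ signedSums {c} := ⟨{c}, 0, by simp, by simp⟩

/-- Two terms `xa b`, `xa c` allow arbitrary signs for the exponents of the powers of `a`. -/
theorem isProductOne_of_signedSums (hk : Odd k) {b c : ZMod (2 * k)} {U : Multiset (ZMod (2 * k))}
    {W : Multiset (QuaternionGroup k)} {w : ZMod (2 * k)} (hw : a w ∈ products W) {z : ZMod k}
    (hz : z ∈ signedSums U) (hr : residue k c - residue k b + z + residue k w = 0)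
    (he : 1 + parityMod k b + parityMod k c + parityMod k U.sum + parityMod k w = 0) :
    IsProductOne ({xa b, xa c} + U.map a + W) := by
  obtain ⟨P, Q, rfl, rfl⟩ := hz
  obtain ⟨lP, hlP, hP⟩ := a_sum_mem_products P
  obtain ⟨lQ, hlQ, hQ⟩ := a_sum_mem_products Q
  -- The powers of `a` placed between `xa b` and `xa c` enter negatively, those placed after `xa c`
  -- positively.
  have h1 : a ((k : ZMod (2 * k)) + c - (b + P.sum) + Q.sum) ∈ products ({xa b, xa c} + (P + Q).map a) := by
    refine ⟨xa b :: (lP ++ xa c :: lQ), ?_, ?_⟩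
    · rw [Multiset.map_add, ← hlP, ← hlQ, ← Multiset.cons_coe, ← Multiset.coe_add,
        ← Multiset.cons_coe, Multiset.insert_eq_cons, ← Multiset.singleton_add,
        ← Multiset.singleton_add, ← Multiset.singleton_add (xa b)]
      abel
    · rw [List.prod_cons, List.prod_append, List.prod_cons, hP, hQ, xa_mul_a, ← mul_assoc,
        xa_mul_a, xa_mul_xa]
      congr 1
      ring
  have h2 := mul_mem_products_add h1 hw
  rw [a_mul_a] at h2
  have h3 : (k : ZMod (2 * k)) + c - (b + P.sum) + Q.sum + w = 0 := by
    apply eq_zero_of_residue_of_parityMod hk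
    · simp only [map_add, map_sub, residue_natCast_self]
      linear_combination hr
    · have hn : ∀ t : ZMod 2, -t = t := by decide
      simp only [map_add, map_sub, parityMod_natCast_self hk]
      simp only [sub_eq_add_neg, hn]
      rw [Multiset.sum_add, map_add] at he
      linear_combination he
  rw [h3] at h2
  exact h2

/-! ### Dicyclic groups: pairing off terms of equal class -/

/-- The class of a term: the residue of the exponent, up to sign for powers of `a`. -/
def termClass : QuaternionGroup k → ℕ
  | a c => (residue k c).valMinAbs.natAbs
  | xa c => k / 2 + 1 + (residue k c).val

theorem termClass_lt [NeZero k] (u : QuaternionGroup k) : termClass u < k / 2 + 1 + k := by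
  rcases u with c | c
  · have := ZMod.natAbs_valMinAbs_le (residue k c)
    simp only [termClass]
    omega
  · have := ZMod.val_lt (residue k c)
    simp only [termClass]
    omega

theorem termClass_a_ne_xa [NeZero k] (c d : ZMod (2 * k)) :
    termClass (a c : QuaternionGroup k) ≠ termClass (xa d) := by
  have := ZMod.natAbs_valMinAbs_le (residue k c)
  simp only [termClass]
  omega

theorem residue_eq_of_termClass_a {c d : ZMod (2 * k)}
    (h : termClass (a c : QuaternionGroup k) = termClass (a d)) :
    residue k c = residue k d ∨ residue k c = - residue k d := by
  simp only [termClass] at h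
  rcases Int.natAbs_eq_natAbs_iff.1 h with h | h
  · left
    rw [← ZMod.coe_valMinAbs (residue k c), h, ZMod.coe_valMinAbs]
  · right
    rw [← ZMod.coe_valMinAbs (residue k c), h, Int.cast_neg, ZMod.coe_valMinAbs]

theorem residue_eq_of_termClass_xa [NeZero k] {c d : ZMod (2 * k)}
    (h : termClass (xa c : QuaternionGroup k) = termClass (xa d)) :
    residue k c = residue k d := by
  simp only [termClass] at h
  exact ZMod.val_injective k (by omega)

/-- The parity of the exponent of the product of two terms of the same kind. -/
def pairParity (p : QuaternionGroup k × QuaternionGroup k) : ZMod 2 :=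
  match p with
  | (a c, a d) => parityMod k c + parityMod k d
  | (xa c, xa d) => 1 + parityMod k c + parityMod k d
  | _ => 0

open NormalForm (pairSeq card_sum_pairSeq)

/-- A pair of powers of `a` can be signed to have residue `0`, and goes to `U`; a pair of terms `xa`
multiplies to a power of `a` of residue `0`, and goes to `W`. Only the parities of the pairs
survive. -/
theorem exists_signedSums_of_pairs [NeZero k] (hk : Odd k)
    {M : Multiset (QuaternionGroup k × QuaternionGroup k)}
    (hM : ∀ p ∈ M, termClass p.1 = termClass p.2) :
    ∃ (U : Multiset (ZMod (2 * k))) (W : Multiset (QuaternionGroup k)) (w : ZMod (2 * k)),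
      (M.map pairSeq).sum = U.map a + W ∧ a w ∈ products W ∧ (0 : ZMod k) ∈ signedSums U ∧
      residue k w = 0 ∧ parityMod k U.sum + parityMod k w = (M.map pairParity).sum := by
  induction M using Multiset.induction_on with
  | empty => exact ⟨0, 0, 0, by simp, one_mem_products_zero, zero_mem_signedSums_zero, by simp⟩
  | cons p M ih =>
    obtain ⟨U, W, w, hs, hw, hz, hr, he⟩ := ih fun q hq => hM q (by simp [hq])
    have hp := hM p (by simp)
    obtain ⟨c | c, d | d⟩ := p
    · refine ⟨{c, d} + U, W, w, ?_, hw, ?_, hr, ?_⟩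
      · rw [Multiset.map_cons, Multiset.sum_cons, hs, Multiset.map_add, add_assoc]; rfl
      · have h0 : (0 : ZMod k) ∈ signedSums ({c} + {d} : Multiset (ZMod (2 * k))) := by
          rcases residue_eq_of_termClass_a hp with h | h
          · have := add_mem_signedSums (neg_residue_mem_signedSums c) (residue_mem_signedSums d)
            rwa [h, neg_add_cancel] at this
          · have := add_mem_signedSums (residue_mem_signedSums c) (residue_mem_signedSums d)
            rwa [h, neg_add_cancel] at this
        have := add_mem_signedSums h0 hz
        rwa [zero_add] at this
      · rw [Multiset.map_cons, Multiset.sum_cons, ← he]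
        simp [pairParity]; ring
    · exact absurd hp (termClass_a_ne_xa c d)
    · exact absurd hp.symm (termClass_a_ne_xa d c)
    · refine ⟨U, {xa c, xa d} + W, k + d - c + w, ?_, ?_, hz, ?_, ?_⟩
      · rw [Multiset.map_cons, Multiset.sum_cons, hs, add_left_comm]; rfl
      · rw [← a_mul_a]
        exact mul_mem_products_add ⟨[xa c, xa d], rfl, by simp⟩ hw
      · rw [map_add, map_sub, map_add, residue_natCast_self, hr,
          residue_eq_of_termClass_xa hp]
        ring
      · rw [Multiset.map_cons, Multiset.sum_cons, ← he]
        have hn : ∀ t : ZMod 2, -t = t := by decide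
        simp only [pairParity, map_add, map_sub, parityMod_natCast_self hk]
        simp only [sub_eq_add_neg, hn]
        ring

theorem isProductOne_of_pairs [NeZero k] (hk : Odd k)
    {M : Multiset (QuaternionGroup k × QuaternionGroup k)}
    (hM : ∀ p ∈ M, termClass p.1 = termClass p.2) {b c : ZMod (2 * k)}
    {V : Multiset (ZMod (2 * k))} {z : ZMod k} (hz : z ∈ signedSums V)
    (hr : residue k c - residue k b + z = 0)
    (he : 1 + parityMod k b + parityMod k c + parityMod k V.sum + (M.map pairParity).sum = 0) :
    IsProductOne ({xa b, xa c} + V.map a + (M.map pairSeq).sum) := by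
  obtain ⟨U, W, w, hs, hw, h0, hrw, hew⟩ := exists_signedSums_of_pairs hk hM
  have := isProductOne_of_signedSums hk hw (add_mem_signedSums hz h0) (b := b) (c := c)
    (by rw [hrw]; linear_combination hr) (by
      rw [Multiset.sum_add, map_add, ← he, ← hew]; ring)
  rwa [Multiset.map_add, add_assoc, add_assoc, ← hs, ← add_assoc] at this

theorem hasProductOneSubseq_of_pairs [NeZero k] (hk : Odd k)
    {M : Multiset (QuaternionGroup k × QuaternionGroup k)}
    (hM : ∀ p ∈ M, termClass p.1 = termClass p.2) {b c : ZMod (2 * k)}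
    (hbc : (xa b, xa c) ∈ M) {S : Multiset (QuaternionGroup k)} (hS : (M.map pairSeq).sum ≤ S)
    (hMc : M.card = 2 * k) (h0 : (M.map pairParity).sum = 0) :
    HasProductOneSubseq (4 * k) S := by
  refine ⟨_, hS, by rw [card_sum_pairSeq]; omega, ?_⟩
  have hcls := hM _ hbc
  obtain ⟨N, rfl⟩ := Multiset.exists_cons_of_mem hbc
  have := isProductOne_of_pairs hk (M := N) (fun p hp => hM p (by simp [hp])) (V := 0)
    zero_mem_signedSums_zero (b := b) (c := c)
    (by rw [residue_eq_of_termClass_xa hcls]; ring) (by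
      rw [Multiset.map_cons, Multiset.sum_cons] at h0
      simpa [pairParity] using h0)
  rw [Multiset.map_cons, Multiset.sum_cons]
  simpa [pairSeq] using this

/-- A sequence with two disjoint pairs of terms `xa b`, `xa c` of equal residue. -/
theorem hasProductOneSubseq_of_two_pairs (hk : Odd k) (hk3 : 3 ≤ k)
    {S : Multiset (QuaternionGroup k)} (hS : 6 * k ≤ S.card + 1) {b c b' c' : ZMod (2 * k)}
    (hle : {xa b, xa c} + {xa b', xa c'} ≤ S) (hbc : residue k b = residue k c)
    (hbc' : residue k b' = residue k c') : HasProductOneSubseq (4 * k) S := by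
  classical
  have : NeZero k := ⟨by omega⟩
  obtain ⟨l, hl⟩ := hk
  obtain ⟨R, rfl⟩ := Multiset.le_iff_exists_add.1 hle
  have hRc : 12 * l + 1 ≤ R.card := by simp at hS; omega
  -- For `k = 2l + 1` there are `l + 1` classes of powers of `a` up to sign and `2l + 1` classes of
  -- the other terms.
  have hpair : ∀ U : Multiset (QuaternionGroup k), 3 * l + 3 ≤ U.card →
      ∃ u v, {u, v} ≤ U ∧ termClass u = termClass v := fun U hU =>
    exists_pair_le_of_lt_card (N := 3 * l + 2) (fun u => (termClass_lt u).trans_le (by omega)) hU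
  have hext : ∀ t, 2 * t + (3 * l + 3) ≤ R.card + 2 →
      ∃ M : Multiset (QuaternionGroup k × QuaternionGroup k), M.card = t + 2 ∧
        (∀ p ∈ M, termClass p.1 = termClass p.2) ∧
        (M.map pairSeq).sum ≤ {xa b, xa c} + {xa b', xa c'} + R ∧
        (xa b, xa c) ::ₘ {(xa b', xa c')} ≤ M := by
    intro t ht
    obtain ⟨B, hBc, hB, hBS⟩ := exists_blocks (S := R)
      (fun T => ∃ u v, T = {u, v} ∧ termClass u = termClass v) (r := 2) (c := 3 * l + 3)
      (fun U _ hU => by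
        obtain ⟨u, v, h1, h2⟩ := hpair U hU
        exact ⟨_, h1, by simp, u, v, rfl, h2⟩) t (by omega)
    obtain ⟨C, rfl, hC⟩ := exists_map_eq_of_forall pairSeq
      (fun p => termClass p.1 = termClass p.2) (B := B) (fun T hT => by
        obtain ⟨-, u, v, rfl, h⟩ := hB T hT
        exact ⟨(u, v), rfl, h⟩)
    refine ⟨(xa b, xa c) ::ₘ (xa b', xa c') ::ₘ C, by simpa using hBc, ?_, ?_, ?_⟩
    · intro p hp
      rcases Multiset.mem_cons.1 hp with rfl | hp
      · simp [termClass, hbc]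
      rcases Multiset.mem_cons.1 hp with rfl | hp
      · simp [termClass, hbc']
      exact hC p hp
    · rw [Multiset.map_cons, Multiset.map_cons, Multiset.sum_cons, Multiset.sum_cons, ← add_assoc]
      exact add_le_add_right hBS _
    · exact (Multiset.cons_le_cons_iff _).2 (Multiset.cons_le_cons _ (Multiset.zero_le _))
  -- any selection of all but one of the pairs contains one of the two given pairs
  have hbig : ∀ M : Multiset (QuaternionGroup k × QuaternionGroup k), 2 * k + 1 ≤ M.card →
      (∀ p ∈ M, termClass p.1 = termClass p.2) →
      (M.map pairSeq).sum ≤ {xa b, xa c} + {xa b', xa c'} + R →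
      (xa b, xa c) ::ₘ {(xa b', xa c')} ≤ M →
      HasProductOneSubseq (4 * k) ({xa b, xa c} + {xa b', xa c'} + R) := by
    intro M hMc hM hMS hMle
    obtain ⟨D, rfl⟩ := Multiset.le_iff_exists_add.1 hMle
    obtain ⟨D', hD', hD'c⟩ := exists_le_card_eq (S := D) (n := 2 * k - 1) (by simp at hMc; omega)
    set M' := (xa b, xa c) ::ₘ {(xa b', xa c')} + D'
    have hM'le : M' ≤ (xa b, xa c) ::ₘ {(xa b', xa c')} + D := add_le_add_right hD' _
    -- Among `2k + 1` parities some `2k` have sum zero; just one pair is dropped, so one of the two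
    -- given pairs is kept.
    obtain ⟨T, hT, hTc, hT0⟩ := (isEGZ_zmod 2).exists_map_mul two_pos pairParity (S := M') k
      (by simp [M', hD'c]; omega)
    have hTM := fun p hp => hM p (Multiset.mem_of_le (hT.trans hM'le) hp)
    have hTS := (sum_le_sum_of_le (Multiset.map_le_map (f := pairSeq) (hT.trans hM'le))).trans hMS
    by_cases h1 : (xa b, xa c) ∈ T
    · exact hasProductOneSubseq_of_pairs ⟨l, hl⟩ hTM h1 hTS (by omega) hT0
    by_cases h2 : (xa b', xa c') ∈ T
    · exact hasProductOneSubseq_of_pairs ⟨l, hl⟩ hTM h2 hTS (by omega) hT0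
    exfalso
    have h3 : T ≤ D' := by
      have := (Multiset.le_cons_of_notMem h1).1 (by simpa [M'] using hT)
      exact (Multiset.le_cons_of_notMem h2).1 this
    have := Multiset.card_le_card h3
    omega
  -- Getting `4l + 1` new pairs out of `12l + 1` terms needs `11l + 3 ≤ 12l + 1`. This fails only
  -- for `k = 3`, where six pairs in all are certain and at least five terms remain.
  by_cases hl2 : 2 ≤ l
  · obtain ⟨M, hMc, hM, hMS, hMle⟩ := hext (4 * l + 1) (by omega)
    exact hbig M (by omega) hM hMS hMle
  obtain rfl : l = 1 := by omega
  obtain rfl : k = 3 := by omega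
  obtain ⟨M, hMc, hM, hMS, hMle⟩ := hext 4 (by omega)
  by_cases h0 : (M.map pairParity).sum = 0
  · exact hasProductOneSubseq_of_pairs ⟨1, rfl⟩ hM
      (Multiset.mem_of_le hMle (Multiset.mem_cons_self _ _)) hMS hMc h0
  obtain ⟨R', hR'⟩ := Multiset.le_iff_exists_add.1 hMS
  have hR'c : 5 ≤ R'.card := by
    have := congrArg Multiset.card hR'
    rw [Multiset.card_add _ R', card_sum_pairSeq, hMc] at this
    omega
  obtain ⟨R₁, hR₁, hR₁c⟩ := exists_le_card_eq hR'c
  have hR₁S : (M.map pairSeq).sum + R₁ ≤ {xa b, xa c} + {xa b', xa c'} + R := by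
    rw [hR']; exact add_le_add_right hR₁ _
  -- Five leftover terms either contain a seventh pair or represent each of the five classes once.
  by_cases hnd : (R₁.map termClass).Nodup
  · have hall : ∀ i < 5, ∃ u ∈ R₁, termClass u = i := by
      intro i hi
      have hsub : (⟨R₁.map termClass, hnd⟩ : Finset ℕ) ⊆ Finset.range 5 := by
        intro j hj
        obtain ⟨u, -, rfl⟩ := Multiset.mem_map.1 (show j ∈ R₁.map termClass from hj)
        exact Finset.mem_range.2 (termClass_lt u)
      have heq := Finset.eq_of_subset_of_card_le hsub (by simp [hR₁c])
      have := Finset.mem_range.2 hi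
      rw [← heq] at this
      exact Multiset.mem_map.1 this
    obtain ⟨u₀, hu₀, e₀⟩ := hall 0 (by norm_num)
    obtain ⟨u₁, hu₁, e₁⟩ := hall 1 (by norm_num)
    obtain ⟨u₂, hu₂, e₂⟩ := hall 2 (by norm_num)
    obtain ⟨u₃, hu₃, e₃⟩ := hall 3 (by norm_num)
    have hxa : ∀ d, 2 ≤ termClass (xa d : QuaternionGroup 3) := fun d => by
      simp only [termClass]; omega
    have ha : ∀ d, termClass (a d : QuaternionGroup 3) < 2 := fun d => by
      have := ZMod.natAbs_valMinAbs_le (residue 3 d)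
      simp only [termClass]; omega
    obtain ⟨z, rfl⟩ : ∃ z, u₀ = a z := by
      rcases u₀ with z | z
      exacts [⟨z, rfl⟩, absurd (hxa z) (by omega)]
    obtain ⟨y, rfl⟩ : ∃ y, u₁ = a y := by
      rcases u₁ with z | z
      exacts [⟨z, rfl⟩, absurd (hxa z) (by omega)]
    obtain ⟨f, rfl⟩ : ∃ f, u₂ = xa f := by
      rcases u₂ with z | z
      exacts [absurd (ha z) (by omega), ⟨z, rfl⟩]
    obtain ⟨g, rfl⟩ : ∃ g, u₃ = xa g := by
      rcases u₃ with z | z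
      exacts [absurd (ha z) (by omega), ⟨z, rfl⟩]
    have hVR : ({xa f, xa g} + ({y, z} : Multiset (ZMod (2 * 3))).map a) ≤ R₁ := by
      refine (Multiset.le_iff_subset ?_).2 ?_
      · have hfg : f ≠ g := by rintro rfl; omega
        have hyz : y ≠ z := by rintro rfl; omega
        simp [hfg, hyz]
      · intro w hw
        simp at hw
        rcases hw with rfl | rfl | rfl | rfl <;> assumption
    have hz : residue 3 z = 0 := by
      simp only [termClass] at e₀
      simpa using e₀
    -- The residues of `f`, `g`, `z` are `0`, `1`, `0`, and that of `y` is `±1`, so a suitable sign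
    -- of `y` cancels `g - f`.
    have hsg : ∃ t ∈ signedSums ({y, z} : Multiset (ZMod (2 * 3))),
        residue 3 g - residue 3 f + t = 0 := by
      have h1 := add_mem_signedSums (residue_mem_signedSums y) (residue_mem_signedSums z)
      have h2 := add_mem_signedSums (neg_residue_mem_signedSums y) (residue_mem_signedSums z)
      rw [hz, add_zero] at h1 h2
      simp only [termClass] at e₁ e₂ e₃
      have hy0 : residue 3 y ≠ 0 := fun h => by simp [h] at e₁
      have hf0 : residue 3 f = 0 := (ZMod.val_eq_zero _).1 (by omega)
      have hg1 : residue 3 g = 1 := ZMod.val_injective 3 (by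
        rw [show (1 : ZMod 3).val = 1 from rfl]; omega)
      rw [hf0, hg1, sub_zero]
      rcases one_add_eq_zero_or_of_ne_zero hy0 with h | h
      exacts [⟨_, h1, h⟩, ⟨_, h2, h⟩]
    obtain ⟨t, ht, htz⟩ := hsg
    have hfour : ∀ N ≤ M, N.card = 4 →
        1 + parityMod 3 f + parityMod 3 g + parityMod 3 (y + z) + (N.map pairParity).sum = 0 →
        HasProductOneSubseq (4 * 3) ({xa b, xa c} + {xa b', xa c'} + R) := by
      intro N hN hNc hNe
      refine ⟨_, ?_, ?_, isProductOne_of_pairs (M := N) (V := {y, z}) ⟨1, rfl⟩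
        (fun p hp => hM p (Multiset.mem_of_le hN hp)) ht htz (by simpa using hNe)⟩
      · rw [add_comm]
        exact (add_le_add (sum_le_sum_of_le (Multiset.map_le_map hN)) hVR).trans hR₁S
      · rw [Multiset.card_add, card_sum_pairSeq, hNc]; simp
    -- The six pairs have odd total parity, so four of them can realise either parity: even
    -- directly, odd as the complement of two pairs of even sum.
    have hdec : ∀ p q : ZMod 2, p ≠ 0 → q + 0 = 0 ∨ q + p = 0 := by decide
    obtain ⟨N, hN, hNc, hN0⟩ := (isEGZ_zmod 2).exists_map_mul two_pos pairParity (S := M) 2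
      (by omega)
    obtain ⟨N', hN', hN'c, hN'0⟩ := (isEGZ_zmod 2).exists_map_mul two_pos pairParity (S := M) 1
      (by omega)
    rcases hdec _ (1 + parityMod 3 f + parityMod 3 g + parityMod 3 (y + z)) h0 with h | h
    · exact hfour N hN hNc (by rw [hN0]; exact h)
    · refine hfour (M - N') tsub_le_self (by rw [Multiset.card_sub hN']; omega) ?_
      have : (M.map pairParity).sum = ((M - N').map pairParity).sum + (N'.map pairParity).sum := by
        rw [← Multiset.sum_add, ← Multiset.map_add, tsub_add_cancel_of_le hN']
      rw [hN'0, add_zero] at this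
      rw [← this]; exact h
  · obtain ⟨u, v, huv, hcl⟩ := exists_pair_le_of_not_nodup hnd
    refine hbig ((u, v) ::ₘ M) (by simp; omega) ?_ ?_ (hMle.trans (Multiset.le_cons_self _ _))
    · intro p hp
      rcases Multiset.mem_cons.1 hp with rfl | hp
      exacts [hcl, hM p hp]
    · rw [Multiset.map_cons, Multiset.sum_cons, add_comm]
      exact (add_le_add_right huv _).trans hR₁S

end Dicyclic

end ZeroSum

/-! ### Signed sums and subgroups -/

namespace ZeroSum.Dicyclic

open QuaternionGroup

variable {k : ℕ}

theorem mem_of_two_mul_mem (hk : Odd k) {H : AddSubgroup (ZMod k)} {g : ZMod k}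
    (h : g + g ∈ H) : g ∈ H := by
  obtain ⟨l, hl⟩ := hk
  have h1 : (l + 1) • (g + g) = g := by
    have h2 : ((k : ℕ) : ZMod k) = 0 := ZMod.natCast_self k
    have h3 : (2 * l + 1 : ZMod k) = 0 := by
      rw [hl] at h2 ⊢
      exact_mod_cast h2
    rw [nsmul_eq_mul]
    push_cast
    linear_combination g * h3
  rw [← h1]
  exact H.nsmul_mem h _

theorem signedSums_subset {L : AddSubgroup (ZMod k)} {U : Multiset (ZMod (2 * k))}
    (hU : ∀ d ∈ U, residue k d ∈ L) : signedSums U ⊆ L := by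
  rintro z ⟨P, Q, rfl, rfl⟩
  rw [map_multiset_sum, map_multiset_sum]
  refine L.sub_mem (L.multiset_sum_mem _ fun c hc => ?_) (L.multiset_sum_mem _ fun c hc => ?_)
  all_goals
    obtain ⟨d, hd, rfl⟩ := Multiset.mem_map.1 hc
    exact hU d (by simp [hd])

/-- The signed sums of a short subsequence fill the subgroup `L`, unless most residues lie in a
proper subgroup of `L`. -/
theorem exists_cover_or_exists_subgroup [NeZero k] (hk : Odd k) {L : AddSubgroup (ZMod k)}
    {D : Multiset (ZMod (2 * k))} (hD : ∀ d ∈ D, residue k d ∈ L) :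
    (∃ U ≤ D, U.card + 1 ≤ Nat.card L ∧ ∀ z ∈ L, z ∈ signedSums U) ∨
    ∃ H < L, ∃ U V, D = U + V ∧ (∀ d ∈ V, residue k d ∈ H) ∧
      U.card + Nat.card H + 1 ≤ Nat.card L := by
  classical
  -- `U` is a longest subsequence with at least `|U| + 1` signed sums.
  let P : ℕ → Prop := fun n => ∃ U ≤ D, U.card = n ∧ n + 1 ≤ (signedSums U).ncard
  have hP0 : P 0 := ⟨0, Multiset.zero_le _, rfl, by
    rw [zero_add, Nat.one_le_iff_ne_zero, ← Nat.pos_iff_ne_zero, Set.ncard_pos]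
    exact ⟨0, zero_mem_signedSums_zero⟩⟩
  obtain ⟨U, hUD, hUc, hU⟩ := Nat.findGreatest_spec (P := P) (Nat.zero_le D.card) hP0
  have hUL : signedSums U ⊆ L := signedSums_subset fun d hd => hD d (Multiset.mem_of_le hUD hd)
  have hLc : Nat.card L = (L : Set (ZMod k)).ncard := Nat.card_coe_set_eq _
  have hle := Set.ncard_le_ncard hUL
  by_cases hcov : ∀ z ∈ L, z ∈ signedSums U
  · exact Or.inl ⟨U, hUD, by omega, hcov⟩
  right
  push Not at hcov
  obtain ⟨x, hxL, hxU⟩ := hcov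
  obtain ⟨w, hw⟩ : (signedSums U).Nonempty := by
    rw [← Set.ncard_pos]; omega
  -- `H` is the stabilizer of the set of signed sums of `U`.
  let H : AddSubgroup (ZMod k) :=
    { carrier := {h | ∀ z, h + z ∈ signedSums U ↔ z ∈ signedSums U}
      zero_mem' := fun z => by rw [zero_add]
      add_mem' := fun {g h} hg hh z => by rw [add_assoc, hg, hh]
      neg_mem' := fun {g} hg z => by rw [← hg (-g + z), add_neg_cancel_left] }
  have hHL : H ≤ L := fun h hh => by
    have := L.sub_mem (hUL ((hh w).2 hw)) (hUL hw)
    rwa [add_sub_cancel_right] at this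
  have hHc : Nat.card H = (H : Set (ZMod k)).ncard := Nat.card_coe_set_eq _
  refine ⟨H, lt_of_le_of_ne hHL ?_, U, D - U, (add_tsub_cancel_of_le hUD).symm, ?_, ?_⟩
  · intro h
    have h1 : x - w ∈ H := h ▸ L.sub_mem hxL (hUL hw)
    exact hxU (by simpa using (h1 w).2 hw)
  · intro d hd
    -- By maximality, adding `d` does not enlarge the set of signed sums, so its translates by `d`
    -- and by `-d` coincide and `2d` stabilizes it.
    apply mem_of_two_mul_mem hk
    have hdU : d ::ₘ U ≤ D := by
      rw [← add_tsub_cancel_of_le hUD, ← Multiset.singleton_add, add_comm]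
      exact add_le_add_right (Multiset.singleton_le.2 hd) _
    have hmax : (signedSums (d ::ₘ U)).ncard ≤ (signedSums U).ncard := by
      by_contra! hlt
      have h1 : P (U.card + 1) := ⟨_, hdU, by simp, by omega⟩
      have h2 := Multiset.card_le_card hdU
      rw [Multiset.card_cons] at h2
      exact Nat.findGreatest_is_greatest (by omega) h2 h1
    have hplus : (· + residue k d) '' signedSums U = signedSums (d ::ₘ U) := by
      refine Set.eq_of_subset_of_ncard_le ?_ ?_
      · rintro _ ⟨z, hz, rfl⟩
        have := add_mem_signedSums (residue_mem_signedSums d) hz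
        rwa [Multiset.singleton_add, add_comm] at this
      · rwa [Set.ncard_image_of_injective _ (add_left_injective _)]
    have hminus : (· + -residue k d) '' signedSums U = signedSums (d ::ₘ U) := by
      refine Set.eq_of_subset_of_ncard_le ?_ ?_
      · rintro _ ⟨z, hz, rfl⟩
        have := add_mem_signedSums (neg_residue_mem_signedSums d) hz
        rwa [Multiset.singleton_add, add_comm] at this
      · rwa [Set.ncard_image_of_injective _ (add_left_injective _)]
    intro z
    constructor
    · intro hz
      have h1 : z + residue k d ∈ (· + residue k d) '' signedSums U := by
        rw [hplus, ← hminus]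
        exact ⟨_, hz, by ring⟩
      obtain ⟨z', hz', h⟩ := h1
      rwa [← add_left_injective _ h]
    · intro hz
      have h1 : z + residue k d ∈ (· + -residue k d) '' signedSums U := by
        rw [hminus, ← hplus]
        exact ⟨_, hz, rfl⟩
      obtain ⟨z', hz', h⟩ := h1
      have : residue k d + residue k d + z = z' := by
        simp only at h
        linear_combination -h
      rwa [this]
  · have hdisj : Disjoint (signedSums U) ((· + x) '' (H : Set (ZMod k))) := by
      rw [Set.disjoint_left]
      rintro _ hz ⟨h, hh, rfl⟩
      exact hxU ((hh x).1 hz)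
    have h1 : signedSums U ∪ (· + x) '' (H : Set (ZMod k)) ⊆ L := by
      refine Set.union_subset hUL ?_
      rintro _ ⟨h, hh, rfl⟩
      exact L.add_mem (hHL hh) hxL
    have h2 := Set.ncard_le_ncard h1
    rw [Set.ncard_union_eq hdisj, Set.ncard_image_of_injective _ (add_left_injective _)] at h2
    omega

/-- Most exponents have residues in a subgroup that is covered by the signed sums of few of them,
even after any one of them is removed. -/
theorem exists_subgroup_of_cover [NeZero k] (hk : Odd k) (A : Multiset (ZMod (2 * k))) :
    ∃ (L : AddSubgroup (ZMod k)) (C E : Multiset (ZMod (2 * k))), A = C + E ∧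
      (∀ c ∈ C, residue k c ∈ L) ∧ (∀ c ∈ E, residue k c ∉ L) ∧ E.card + Nat.card L ≤ k ∧
      ∀ y ∈ C, ∃ U, y ::ₘ U ≤ C ∧ U.card + 1 ≤ Nat.card L ∧ ∀ z ∈ L, z ∈ signedSums U := by
  classical
  let E : AddSubgroup (ZMod k) → Multiset (ZMod (2 * k)) :=
    fun L => A.filter fun c => residue k c ∉ L
  -- `L` is chosen of least order with this bound; the whole group satisfies it.
  have hex : ∃ n, ∃ L : AddSubgroup (ZMod k), Nat.card L = n ∧ (E L).card + Nat.card L ≤ k := by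
    refine ⟨_, ⊤, rfl, ?_⟩
    have h : E ⊤ = 0 := Multiset.filter_eq_nil.2 fun c _ h => h (AddSubgroup.mem_top _)
    rw [h, AddSubgroup.card_top, Nat.card_zmod]
    simp
  obtain ⟨L, hLn, hL⟩ := Nat.find_spec hex
  refine ⟨L, A.filter fun c => residue k c ∈ L, E L, (Multiset.filter_add_not _ _).symm,
    fun c hc => (Multiset.mem_filter.1 hc).2, fun c hc => (Multiset.mem_filter.1 hc).2, hL, ?_⟩
  intro y hy
  obtain ⟨D, hD⟩ := Multiset.exists_cons_of_mem hy
  have hDL : ∀ d ∈ D, residue k d ∈ L := fun d hd => by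
    have : d ∈ A.filter fun c => residue k c ∈ L := by rw [hD]; simp [hd]
    exact (Multiset.mem_filter.1 this).2
  rcases exists_cover_or_exists_subgroup hk hDL with ⟨U, hU, hUc, hcov⟩ | ⟨H, hH, U, V, hUV, hV, hc⟩
  · exact ⟨U, by rw [hD]; exact Multiset.cons_le_cons _ hU, hUc, hcov⟩
  · exfalso
    -- In passing from `L` to `H` only `y` and the terms of `U` can become exceptional, and `|U| + 1
    -- + |H| ≤ |L|`, so `H` contradicts minimality.
    refine Nat.find_min hex (m := Nat.card H) (by omega) ⟨H, rfl, ?_⟩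
    have h1 : E H ≤ E L + (y ::ₘ U) := by
      have h2 : A = E L + (y ::ₘ U) + V := by
        rw [add_assoc, Multiset.cons_add, ← hUV, ← hD, add_comm, Multiset.filter_add_not]
      have h3 : V.filter (fun c => residue k c ∉ H) = 0 :=
        Multiset.filter_eq_nil.2 fun c hc h => h (hV c hc)
      calc E H = (E L + (y ::ₘ U) + V).filter (fun c => residue k c ∉ H) := by rw [← h2]
        _ = (E L + (y ::ₘ U)).filter (fun c => residue k c ∉ H) := by
          rw [Multiset.filter_add _ _ V, h3, add_zero]
        _ ≤ _ := Multiset.filter_le _ _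
    have := Multiset.card_le_card h1
    rw [Multiset.card_add, Multiset.card_cons] at this
    omega

/-- One term of each parity is held back while `j - 1` others are chosen; one of the two then
corrects the parity. -/
theorem exists_le_card_eq_parityMod_sum_eq {R : Multiset (ZMod (2 * k))}
    (hR : ∀ t, ∃ c ∈ R, parityMod k c = t) {j : ℕ} (hj : 1 ≤ j) (hjR : j < R.card) (t : ZMod 2) :
    ∃ F ≤ R, F.card = j ∧ parityMod k F.sum = t := by
  obtain ⟨p, hp, hp0⟩ := hR 0
  obtain ⟨q, hq, hq1⟩ := hR 1
  obtain ⟨R', rfl⟩ := Multiset.exists_cons_of_mem hp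
  have hqp : q ≠ p := by rintro rfl; simp [hp0] at hq1
  obtain ⟨R, rfl⟩ := Multiset.exists_cons_of_mem ((Multiset.mem_cons.1 hq).resolve_left hqp)
  simp only [Multiset.card_cons] at hjR
  obtain ⟨F, hF, hFc⟩ := exists_le_card_eq (S := R) (n := j - 1) (by omega)
  have hdec : ∀ u t : ZMod 2, 0 + u = t ∨ 1 + u = t := by decide
  rcases hdec (parityMod k F.sum) t with h | h
  · exact ⟨p ::ₘ F, Multiset.cons_le_cons _ (hF.trans (Multiset.le_cons_self _ _)), by simp; omega,
      by rw [Multiset.sum_cons, map_add, hp0, h]⟩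
  · exact ⟨q ::ₘ F, (Multiset.cons_le_cons _ hF).trans (Multiset.le_cons_self _ _), by simp; omega,
      by rw [Multiset.sum_cons, map_add, hq1, h]⟩

theorem hasProductOneSubseq_of_sum_eq_zero {A B T : Multiset (ZMod (2 * k))} (hT : T ≤ A)
    (hTs : T.sum = 0) : HasProductOneSubseq T.card (A.map a + B.map xa) := by
  refine ⟨T.map a, (Multiset.map_le_map hT).trans (Multiset.le_add_right _ _),
    Multiset.card_map _ _, ?_⟩
  have := a_sum_mem_products T
  rwa [hTs] at this

theorem hasProductOneSubseq_of_pair (hk : Odd k) {A B U F : Multiset (ZMod (2 * k))}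
    {b c : ZMod (2 * k)} (hA : U + F ≤ A) (hB : {b, c} ≤ B) (hc : U.card + F.card + 2 = 4 * k)
    {z : ZMod k} (hz : z ∈ signedSums U) (hr : residue k c - residue k b + z + residue k F.sum = 0)
    (he : 1 + parityMod k b + parityMod k c + parityMod k U.sum + parityMod k F.sum = 0) :
    HasProductOneSubseq (4 * k) (A.map a + B.map xa) := by
  refine ⟨_, ?_, ?_, isProductOne_of_signedSums hk (a_sum_mem_products F) hz hr he⟩
  · calc _ = (U + F).map a + ({b, c} : Multiset (ZMod (2 * k))).map xa := by
          rw [Multiset.map_add]; simp only [Multiset.insert_eq_cons, Multiset.map_cons,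
            Multiset.map_singleton]; abel
      _ ≤ _ := add_le_add (Multiset.map_le_map hA) (Multiset.map_le_map hB)
  · simp; omega

theorem hasProductOneSubseq_of_pair_of_pair (hk : Odd k) {A B U F : Multiset (ZMod (2 * k))}
    {b c b' c' : ZMod (2 * k)} (hA : U + F ≤ A) (hB : {b, c} + {b', c'} ≤ B)
    (hc : U.card + F.card + 4 = 4 * k) {z : ZMod k} (hz : z ∈ signedSums U)
    (hr : residue k c - residue k b + z + (residue k c' - residue k b' + residue k F.sum) = 0)
    (he : 1 + parityMod k b + parityMod k c + parityMod k U.sum +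
      (1 + parityMod k b' + parityMod k c' + parityMod k F.sum) = 0) :
    HasProductOneSubseq (4 * k) (A.map a + B.map xa) := by
  have hw : a ((k : ZMod (2 * k)) + c' - b' + F.sum) ∈ products ({xa b', xa c'} + F.map a) := by
    rw [← a_mul_a]
    exact mul_mem_products_add ⟨[xa b', xa c'], rfl, by simp⟩ (a_sum_mem_products F)
  have hn : ∀ t : ZMod 2, -t = t := by decide
  refine ⟨_, ?_, ?_, isProductOne_of_signedSums hk hw hz (b := b) (c := c) ?_ ?_⟩
  · calc _ = (U + F).map a + ({b, c} + {b', c'} : Multiset (ZMod (2 * k))).map xa := by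
          rw [Multiset.map_add, Multiset.map_add]
          simp only [Multiset.insert_eq_cons, Multiset.map_cons, Multiset.map_singleton]
          abel
      _ ≤ _ := add_le_add (Multiset.map_le_map hA) (Multiset.map_le_map hB)
  · simp; omega
  · simp only [map_add, map_sub, residue_natCast_self]
    linear_combination hr
  · simp only [map_add, map_sub, parityMod_natCast_self hk]
    simp only [sub_eq_add_neg, hn]
    linear_combination he

end ZeroSum.Dicyclic

/-! ### Product-one sequences over dicyclic groups -/

namespace ZeroSum

theorem card_le_natCard_of_nodup {α β : Type*} [Finite β] {f : α → β} {U : Multiset α}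
    (h : (U.map f).Nodup) : U.card ≤ Nat.card β := by
  have := Fintype.ofFinite β
  have h1 := Finset.card_le_univ (⟨U.map f, h⟩ : Finset β)
  rwa [Finset.card_mk, Multiset.card_map, ← Nat.card_eq_fintype_card] at h1

theorem exists_pair_le_of_natCard_lt {α β : Type*} [Finite β] (f : α → β) {U : Multiset α}
    (h : Nat.card β < U.card) : ∃ u v, {u, v} ≤ U ∧ f u = f v :=
  exists_pair_le_of_not_nodup fun hnd => absurd (card_le_natCard_of_nodup hnd) (by omega)

theorem even_nsmul_eq_zero {n : ℕ} (h : Even n) (t : ZMod 2) : n • t = 0 := by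
  obtain ⟨m, rfl⟩ := h
  rw [← two_mul, mul_nsmul', show (2 : ℕ) • (m • t) = 0 by
    rw [nsmul_eq_mul, show ((2 : ℕ) : ZMod 2) = 0 by decide, zero_mul]]

namespace Dicyclic

open QuaternionGroup

variable {k : ℕ}

theorem parityMod_sum_of_forall {F : Multiset (ZMod (2 * k))} {t : ZMod 2}
    (h : ∀ c ∈ F, parityMod k c = t) : parityMod k F.sum = F.card • t := by
  rw [map_multiset_sum, Multiset.map_congr rfl h, Multiset.map_const', Multiset.sum_replicate]

theorem residue_sum_mem {L : AddSubgroup (ZMod k)} {F : Multiset (ZMod (2 * k))}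
    (h : ∀ c ∈ F, residue k c ∈ L) : residue k F.sum ∈ L := by
  rw [map_multiset_sum]
  refine L.multiset_sum_mem _ fun z hz => ?_
  obtain ⟨c, hc, rfl⟩ := Multiset.mem_map.1 hz
  exact h c hc

theorem residue_sum_eq_zero {F : Multiset (ZMod (2 * k))} (h : ∀ c ∈ F, residue k c = 0) :
    residue k F.sum = 0 := by
  rw [map_multiset_sum]
  refine Multiset.sum_eq_zero fun z hz => ?_
  obtain ⟨c, hc, rfl⟩ := Multiset.mem_map.1 hz
  exact h c hc

theorem exists_forall_parityMod_eq {C : Multiset (ZMod (2 * k))}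
    (h : ¬ ∀ t, ∃ c ∈ C, parityMod k c = t) : ∃ t, ∀ c ∈ C, parityMod k c = t := by
  push Not at h
  obtain ⟨t, ht⟩ := h
  have hdec : ∀ p t : ZMod 2, p ≠ t → p = t + 1 := by decide
  exact ⟨t + 1, fun c hc => hdec _ _ (ht c hc)⟩

theorem exists_le_of_residue_mem [NeZero k] (hk : Odd k) {L : AddSubgroup (ZMod k)}
    {C : Multiset (ZMod (2 * k))} (hCL : ∀ c ∈ C, residue k c ∈ L)
    (hC : 4 * k + 2 * Nat.card L ≤ C.card + 1) : ∃ T ≤ C, T.card = 4 * k ∧ T.sum = 0 := by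
  classical
  obtain ⟨m, hm⟩ := AddSubgroup.card_addSubgroup_dvd_card L
  rw [Nat.card_zmod] at hm
  have hL : 0 < Nat.card L := Nat.card_pos
  have h4 : 2 * m * (Nat.card L * 2) = 4 * k := by
    calc _ = 4 * (Nat.card L * m) := by ring
      _ = _ := by rw [← hm]
  obtain ⟨T, hT, hTc, hT0⟩ := ((isEGZ_of_isAddCyclic L).prod (isEGZ_zmod 2) hL
    two_pos).exists_map_mul (by omega) (fun c : ZMod (2 * k) =>
      ((if h : residue k c ∈ L then ⟨_, h⟩ else 0 : L), parityMod k c)) (S := C) (2 * m)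
      (by rw [h4]; omega)
  refine ⟨T, hT, by rw [hTc, h4], eq_zero_of_residue_of_parityMod hk ?_ ?_⟩
  · have h1 := congrArg (L.subtype.comp (AddMonoidHom.fst _ _)) hT0
    rw [map_zero, map_multiset_sum, Multiset.map_map] at h1
    rw [map_multiset_sum, ← h1]
    congr 1
    refine Multiset.map_congr rfl fun c hc => ?_
    simp [hCL c (Multiset.mem_of_le hT hc)]
  · have h1 := congrArg (AddMonoidHom.snd _ _) hT0
    rw [map_zero, map_multiset_sum, Multiset.map_map] at h1
    rw [map_multiset_sum, ← h1]
    rfl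

/-- With constant parity any `4k` terms have even sum, so zero-sum blocks over `L` alone suffice,
instead of over `L × ZMod 2`. -/
theorem exists_le_of_residue_mem_of_parityMod_eq [NeZero k] (hk : Odd k)
    {L : AddSubgroup (ZMod k)} {C : Multiset (ZMod (2 * k))} (hCL : ∀ c ∈ C, residue k c ∈ L)
    {t : ZMod 2} (ht : ∀ c ∈ C, parityMod k c = t) (hC : 4 * k + Nat.card L ≤ C.card + 1) :
    ∃ T ≤ C, T.card = 4 * k ∧ T.sum = 0 := by
  classical
  obtain ⟨m, hm⟩ := AddSubgroup.card_addSubgroup_dvd_card L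
  rw [Nat.card_zmod] at hm
  have hL : 0 < Nat.card L := Nat.card_pos
  have h4 : 4 * m * Nat.card L = 4 * k := by
    calc _ = 4 * (Nat.card L * m) := by ring
      _ = _ := by rw [← hm]
  obtain ⟨T, hT, hTc, hT0⟩ := (isEGZ_of_isAddCyclic L).exists_map_mul (by omega)
    (fun c : ZMod (2 * k) => (if h : residue k c ∈ L then ⟨_, h⟩ else 0 : L)) (S := C) (4 * m)
      (by rw [h4]; omega)
  refine ⟨T, hT, by rw [hTc, h4], eq_zero_of_residue_of_parityMod hk ?_ ?_⟩
  · have h1 := congrArg L.subtype hT0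
    rw [map_zero, map_multiset_sum, Multiset.map_map] at h1
    rw [map_multiset_sum, ← h1]
    congr 1
    refine Multiset.map_congr rfl fun c hc => ?_
    simp [hCL c (Multiset.mem_of_le hT hc)]
  · rw [parityMod_sum_of_forall fun c hc => ht c (Multiset.mem_of_le hT hc), hTc, h4]
    exact even_nsmul_eq_zero ⟨2 * k, by ring⟩ t

/-! ### Sequences whose signed sums cover a subgroup -/

/-- The sequence `C` has residues in `L`, and the signed sums of a short subsequence that avoids
any given term fill `L`. -/
structure Covers (L : AddSubgroup (ZMod k)) (C : Multiset (ZMod (2 * k))) : Prop where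
  mem : ∀ c ∈ C, residue k c ∈ L
  card_le : Nat.card L ≤ k
  exists_le : ∀ y ∈ C, ∃ U, y ::ₘ U ≤ C ∧ U.card + 1 ≤ Nat.card L ∧ ∀ z ∈ L, z ∈ signedSums U

variable {L : AddSubgroup (ZMod k)} {A B C : Multiset (ZMod (2 * k))}

/-- Some parity `t` occurs at least `k` times, more often than `U` can use up, and `U` avoids a term
of the other parity. So `F` can be chosen outside `U` with the right parity, after which `U`
corrects the residue. -/
theorem hasProductOneSubseq_of_mixed (hk : Odd k) (hL : Covers L C) (hCA : C ≤ A)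
    (hmix : ∀ t, ∃ c ∈ C, parityMod k c = t) (hC : 4 * k ≤ C.card + 1) {b c : ZMod (2 * k)}
    (hB : {b, c} ≤ B) (hbc : residue k b - residue k c ∈ L) :
    HasProductOneSubseq (4 * k) (A.map a + B.map xa) := by
  classical
  have hLk := hL.card_le
  have hkpos := hk.pos
  obtain ⟨t, ht⟩ : ∃ t : ZMod 2, k ≤ C.countP (fun c => parityMod k c = t) := by
    by_contra! h
    have h1 := Multiset.card_eq_countP_add_countP (fun c => parityMod k c = 0) C
    have h2 : C.countP (fun c => ¬ parityMod k c = 0) = C.countP fun c => parityMod k c = 1 := by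
      refine Multiset.countP_congr rfl fun c _ => ?_
      generalize parityMod k c = p
      revert p; decide
    have := h 0
    have := h 1
    omega
  obtain ⟨y, hy, hyt⟩ := hmix (t + 1)
  obtain ⟨U, hU, hUc, hcov⟩ := hL.exists_le y hy
  obtain ⟨R, rfl⟩ := Multiset.le_iff_exists_add.1 ((Multiset.le_cons_self U y).trans hU)
  have hyR : y ∈ R := by
    rw [← Multiset.singleton_add, add_comm] at hU
    exact Multiset.singleton_le.1 (le_of_add_le_add_left hU)
  have hR : ∀ t', ∃ c ∈ R, parityMod k c = t' := by
    intro t'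
    have hdec : ∀ t t' : ZMod 2, t' = t + 1 ∨ t' = t := by decide
    rcases hdec t t' with rfl | rfl
    · exact ⟨y, hyR, hyt⟩
    · rw [Multiset.countP_add] at ht
      have := Multiset.countP_le_card (fun c => parityMod k c = t') U
      obtain ⟨c, hc, h⟩ := Multiset.countP_pos.1 (show 0 < R.countP (fun c => parityMod k c = t')
        by omega)
      exact ⟨c, hc, h⟩
  rw [Multiset.card_add] at hC
  obtain ⟨F, hF, hFc, hFt⟩ := exists_le_card_eq_parityMod_sum_eq hR (j := 4 * k - 2 - U.card)
    (by omega) (by omega) (-(1 + parityMod k b + parityMod k c + parityMod k U.sum))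
  have hFL := residue_sum_mem fun d hd => hL.mem d (by
    rw [Multiset.mem_add]; exact Or.inr (Multiset.mem_of_le hF hd))
  refine hasProductOneSubseq_of_pair hk ((add_le_add_right hF U).trans hCA) hB (by omega)
    (hcov _ (L.sub_mem hbc hFL)) (by ring) (by rw [hFt]; ring)

theorem Covers.exists_split (hL : Covers L C) (hC : 0 < C.card) :
    ∃ U R, C = U + R ∧ U.card + 1 ≤ Nat.card L ∧ ∀ z ∈ L, z ∈ signedSums U := by
  obtain ⟨y, hy⟩ := Multiset.card_pos_iff_exists_mem.1 hC
  obtain ⟨U, hU, hUc, hcov⟩ := hL.exists_le y hy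
  obtain ⟨R, rfl⟩ := Multiset.le_iff_exists_add.1 ((Multiset.le_cons_self U y).trans hU)
  exact ⟨U, R, rfl, hUc, hcov⟩

/-- The `4k - 2` powers of `a` contribute an even number of equal parities, so parity is decided by
`b` and `c` alone. -/
theorem hasProductOneSubseq_of_const (hk : Odd k) (hL : Covers L C) (hCA : C ≤ A) {t : ZMod 2}
    (ht : ∀ c ∈ C, parityMod k c = t) (hC : 4 * k ≤ C.card + 2) {b c : ZMod (2 * k)}
    (hB : {b, c} ≤ B) (hbc : residue k b - residue k c ∈ L)
    (hpar : 1 + parityMod k b + parityMod k c = 0) :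
    HasProductOneSubseq (4 * k) (A.map a + B.map xa) := by
  have hLk := hL.card_le
  have hkpos := hk.pos
  obtain ⟨U, R, rfl, hUc, hcov⟩ := hL.exists_split (by omega)
  rw [Multiset.card_add] at hC
  obtain ⟨F, hF, hFc⟩ := exists_le_card_eq (S := R) (n := 4 * k - 2 - U.card) (by omega)
  have hFL := residue_sum_mem fun d hd => hL.mem d (by
    rw [Multiset.mem_add]; exact Or.inr (Multiset.mem_of_le hF hd))
  have hUF := add_le_add_right hF U
  have hsum := parityMod_sum_of_forall fun d hd => ht d (Multiset.mem_of_le hUF hd)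
  rw [Multiset.card_add, show U.card + F.card = 2 * (2 * k - 1) by omega,
    even_nsmul_eq_zero (even_two_mul _), Multiset.sum_add, map_add] at hsum
  refine hasProductOneSubseq_of_pair hk (hUF.trans hCA) hB (by omega)
    (hcov _ (L.sub_mem hbc hFL)) (by ring) (by linear_combination hpar + hsum)

/-- If neither pair has the right parity alone, each has total parity `1`, and the two together
cancel. -/
theorem hasProductOneSubseq_of_const_of_pairs (hk : Odd k) (hk3 : 3 ≤ k) (hL : Covers L C) (hCA : C ≤ A)
    {t : ZMod 2} (ht : ∀ c ∈ C, parityMod k c = t) (hC : 4 * k ≤ C.card + 2)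
    {b c b' c' : ZMod (2 * k)} (hB : {b, c} + {b', c'} ≤ B)
    (hbc : residue k b - residue k c ∈ L) (hbc' : residue k b' - residue k c' ∈ L) :
    HasProductOneSubseq (4 * k) (A.map a + B.map xa) := by
  have hdec : ∀ p q : ZMod 2, 1 + p + q = 0 ∨ p = q := by decide
  rcases hdec (parityMod k b) (parityMod k c) with h | h
  · exact hasProductOneSubseq_of_const hk hL hCA ht hC ((Multiset.le_add_right _ _).trans hB) hbc h
  rcases hdec (parityMod k b') (parityMod k c') with h' | h'
  · exact hasProductOneSubseq_of_const hk hL hCA ht hC ((Multiset.le_add_left _ _).trans hB)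
      hbc' h'
  have hLk := hL.card_le
  obtain ⟨U, R, rfl, hUc, hcov⟩ := hL.exists_split (by omega)
  rw [Multiset.card_add] at hC
  obtain ⟨F, hF, hFc⟩ := exists_le_card_eq (S := R) (n := 4 * k - 4 - U.card) (by omega)
  have hFL := residue_sum_mem fun d hd => hL.mem d (by
    rw [Multiset.mem_add]; exact Or.inr (Multiset.mem_of_le hF hd))
  have hUF := add_le_add_right hF U
  have hsum := parityMod_sum_of_forall fun d hd => ht d (Multiset.mem_of_le hUF hd)
  rw [Multiset.card_add, show U.card + F.card = 2 * (2 * k - 2) by omega,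
    even_nsmul_eq_zero (even_two_mul _), Multiset.sum_add, map_add] at hsum
  have h2 : ∀ p : ZMod 2, p + p = 0 := by decide
  refine hasProductOneSubseq_of_pair_of_pair hk (hUF.trans hCA) hB (by omega)
    (hcov _ (L.sub_mem (L.add_mem hbc hbc') hFL)) (by ring) ?_
  rw [h, h']
  linear_combination hsum + h2 1 + h2 (parityMod k c) + h2 (parityMod k c')

/-- More than half of all residues occur, so the set of residues meets its translate by `ρ`. -/
theorem exists_pair_residue_sub_eq [NeZero k] {B₀ : Multiset (ZMod (2 * k))}
    (hnd : (B₀.map (residue k)).Nodup) (hc : k < 2 * B₀.card) {ρ : ZMod k} (hρ : ρ ≠ 0) :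
    ∃ b c, {b, c} ≤ B₀ ∧ residue k b - residue k c = ρ := by
  classical
  let R : Finset (ZMod k) := ⟨B₀.map (residue k), hnd⟩
  have hRc : R.card = B₀.card := by simp [R]
  obtain ⟨x, hx⟩ : (R ∩ R.image (· + ρ)).Nonempty := by
    rw [Finset.nonempty_iff_ne_empty, Ne, ← Finset.disjoint_iff_inter_eq_empty]
    intro h
    have h1 := Finset.card_le_univ (R ∪ R.image (· + ρ))
    rw [Finset.card_union_of_disjoint h, Finset.card_image_of_injective _ (add_left_injective _),
      ZMod.card] at h1
    omega
  obtain ⟨h1, h2⟩ := Finset.mem_inter.1 hx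
  obtain ⟨z, hz, rfl⟩ := Finset.mem_image.1 h2
  obtain ⟨b, hb, hbz⟩ := Multiset.mem_map.1 (show z + ρ ∈ B₀.map (residue k) from h1)
  obtain ⟨c, hc, rfl⟩ := Multiset.mem_map.1 (show z ∈ B₀.map (residue k) from hz)
  refine ⟨b, c, (Multiset.le_iff_subset ?_).2 ?_, by rw [hbz]; ring⟩
  · have : b ≠ c := by
      rintro rfl
      exact hρ (by simpa using hbz)
    simpa using this
  · intro d hd
    simp at hd
    rcases hd with rfl | rfl <;> assumption

/-- The case of a nontrivial subgroup `L`. -/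
theorem hasProductOneSubseq_of_covers [NeZero k] (hk : Odd k) (hk3 : 3 ≤ k) (hL : Covers L C)
    (hCA : C ≤ A) (hB2 : 2 ≤ B.card) (hBk : B.card ≤ k + 2)
    (hC : 5 * k + Nat.card L ≤ C.card + B.card + 1) (hL1 : Nat.card L ≠ 1) :
    HasProductOneSubseq (4 * k) (A.map a + B.map xa) := by
  classical
  obtain ⟨m, hm⟩ := AddSubgroup.card_addSubgroup_dvd_card L
  rw [Nat.card_zmod] at hm
  have hLodd : Odd (Nat.card L) := by
    rw [hm, Nat.odd_mul] at hk
    exact hk.1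
  have hL3 : 3 ≤ Nat.card L := by
    obtain ⟨l, hl⟩ := hLodd
    omega
  have hquot : Nat.card (ZMod k ⧸ L) = m := by
    have h := L.card_mul_index
    rw [Nat.card_zmod, AddSubgroup.index] at h
    exact Nat.eq_of_mul_eq_mul_left (by omega : 0 < Nat.card L) (h.trans hm)
  have hpair : ∀ D : Multiset (ZMod (2 * k)), m < D.card →
      ∃ b c, {b, c} ≤ D ∧ residue k b - residue k c ∈ L := by
    intro D hD
    obtain ⟨b, c, hbc, h⟩ := exists_pair_le_of_natCard_lt
      (fun d => (residue k d : ZMod k ⧸ L)) (hquot.symm ▸ hD)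
    refine ⟨c, b, by rwa [Multiset.pair_comm], ?_⟩
    rw [sub_eq_neg_add]
    exact QuotientAddGroup.eq.1 h
  have hm3 : 3 * m ≤ k := by
    calc 3 * m ≤ Nat.card L * m := Nat.mul_le_mul_right m hL3
      _ = k := hm.symm
  by_cases hmix : ∀ t, ∃ c ∈ C, parityMod k c = t
  · by_cases hmB : m < B.card
    · obtain ⟨b, c, hbc, h⟩ := hpair B hmB
      exact hasProductOneSubseq_of_mixed hk hL hCA hmix (by omega) hbc h
    -- Here `2 ≤ |B| ≤ m` and `|L| ≥ 3`, while `k = |L| m`.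
    · have h1 : m + Nat.card L ≤ k := by nlinarith
      obtain ⟨T, hT, hTc, hT0⟩ := exists_le_of_residue_mem hk hL.mem (by omega)
      rw [← hTc]
      exact hasProductOneSubseq_of_sum_eq_zero (hT.trans hCA) hT0
  · obtain ⟨t, ht⟩ : ∃ t, ∀ c ∈ C, parityMod k c = t := exists_forall_parityMod_eq hmix
    by_cases hBle : B.card ≤ k
    · obtain ⟨T, hT, hTc, hT0⟩ := exists_le_of_residue_mem_of_parityMod_eq hk hL.mem ht (by omega)
      rw [← hTc]
      exact hasProductOneSubseq_of_sum_eq_zero (hT.trans hCA) hT0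
    · obtain ⟨b, c, hbc, h⟩ := hpair B (by omega)
      obtain ⟨D, rfl⟩ := Multiset.le_iff_exists_add.1 hbc
      rw [Multiset.card_add, Multiset.card_pair] at *
      obtain ⟨b', c', hbc', h'⟩ := hpair D (by omega)
      exact hasProductOneSubseq_of_const_of_pairs hk hk3 hL hCA ht (by omega)
        (add_le_add_right hbc' _) h h'

/-- The case of the trivial subgroup, when the powers of `a` with residue `0` have both
parities. -/
theorem hasProductOneSubseq_of_zeros_of_mixed [NeZero k] (hk : Odd k) (hk3 : 3 ≤ k)
    (hC0 : ∀ c ∈ C, residue k c = 0) (hmix : ∀ t, ∃ c ∈ C, parityMod k c = t)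
    (hC : 4 * k ≤ C.card + 2) {y : ZMod (2 * k)} (hy : residue k y ≠ 0) (hA : y ::ₘ C ≤ A)
    {B₀ : Multiset (ZMod (2 * k))} (hB₀ : B₀ ≤ B) (hnd : (B₀.map (residue k)).Nodup)
    (hB₀c : k < 2 * B₀.card) : HasProductOneSubseq (4 * k) (A.map a + B.map xa) := by
  obtain ⟨b, c, hbc, h⟩ := exists_pair_residue_sub_eq hnd hB₀c hy
  obtain ⟨F, hF, hFc, hFt⟩ := exists_le_card_eq_parityMod_sum_eq hmix (j := 4 * k - 3)
    (by omega) (by omega) (-(1 + parityMod k b + parityMod k c + parityMod k y))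
  have hF0 := residue_sum_eq_zero fun d hd => hC0 d (Multiset.mem_of_le hF hd)
  refine hasProductOneSubseq_of_pair hk (U := {y}) (F := F) ?_ (hbc.trans hB₀) ?_
    (residue_mem_signedSums y) ?_ ?_
  · exact (Multiset.cons_le_cons y hF).trans hA
  · rw [Multiset.card_singleton]; omega
  · rw [hF0]; linear_combination -h
  · rw [hFt, Multiset.sum_singleton]; ring

/-- The case of the trivial subgroup, when the powers of `a` with residue `0` have the same
parity. -/
theorem hasProductOneSubseq_of_zeros_of_const [NeZero k] (hk : Odd k) (hk3 : 3 ≤ k)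
    (hC0 : ∀ c ∈ C, residue k c = 0) {t : ZMod 2} (ht : ∀ c ∈ C, parityMod k c = t)
    (hC : 4 * k ≤ C.card + 2) {y : ZMod (2 * k)} (hy : residue k y ≠ 0) (hA : y ::ₘ C ≤ A)
    {B₀ : Multiset (ZMod (2 * k))} {b c : ZMod (2 * k)} (hB₀ : {b, c} + B₀ ≤ B)
    (hbc : residue k b = residue k c) (hpar : parityMod k b = parityMod k c)
    (hnd : (B₀.map (residue k)).Nodup)
    (hB₀c : k < 2 * B₀.card) : HasProductOneSubseq (4 * k) (A.map a + B.map xa) := by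
  obtain ⟨b', c', hbc', h⟩ := exists_pair_residue_sub_eq hnd hB₀c hy
  have h2 : ∀ p : ZMod 2, p + p = 0 := by decide
  have hF : ∀ F ≤ C, Odd F.card → residue k F.sum = 0 ∧ parityMod k F.sum = t := by
    intro F hF hFc
    constructor
    · exact residue_sum_eq_zero fun d hd => hC0 d (Multiset.mem_of_le hF hd)
    · obtain ⟨j, hj⟩ := hFc
      rw [parityMod_sum_of_forall fun d hd => ht d (Multiset.mem_of_le hF hd), hj, add_smul,
        even_nsmul_eq_zero (even_two_mul j), zero_add, one_smul]
  have hdec : ∀ p : ZMod 2, p = 0 ∨ p = 1 := by decide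
  -- Both `4k - 3` and `4k - 5` are odd, so `F` has parity `t` either way; using the extra pair `b`,
  -- `c` shifts the total parity by one.
  rcases hdec (1 + parityMod k b' + parityMod k c' + parityMod k y + t) with h0 | h1
  · obtain ⟨F, hFC, hFc⟩ := exists_le_card_eq (S := C) (n := 4 * k - 3) (by omega)
    obtain ⟨hF0, hFt⟩ := hF F hFC ⟨2 * k - 2, by omega⟩
    refine hasProductOneSubseq_of_pair hk (U := {y}) ((Multiset.cons_le_cons y hFC).trans hA)
      (hbc'.trans ((Multiset.le_add_left _ _).trans hB₀)) ?_ (residue_mem_signedSums y) ?_ ?_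
    · rw [Multiset.card_singleton]; omega
    · rw [hF0]; linear_combination -h
    · rw [hFt, Multiset.sum_singleton]; exact h0
  · obtain ⟨F, hFC, hFc⟩ := exists_le_card_eq (S := C) (n := 4 * k - 5) (by omega)
    obtain ⟨hF0, hFt⟩ := hF F hFC ⟨2 * k - 3, by omega⟩
    refine hasProductOneSubseq_of_pair_of_pair hk (U := {y}) (b := b) (c := c) (b' := b') (c' := c')
      ((Multiset.cons_le_cons y hFC).trans hA)
      ((add_le_add_right hbc' _).trans hB₀) ?_ (residue_mem_signedSums y) ?_ ?_
    · rw [Multiset.card_singleton]; omega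
    · rw [hF0, hbc]; linear_combination -h
    · rw [hFt, Multiset.sum_singleton, hpar]
      linear_combination h1 + h2 1 + h2 (parityMod k c)

/-- A sequence without two disjoint pairs of terms `xa b`, `xa c` of equal residue. -/
theorem hasProductOneSubseq_of_not_two_pairs (hk : Odd k) (hk3 : 3 ≤ k)
    (hc : 6 * k ≤ A.card + B.card + 1) (hB2 : 2 ≤ B.card)
    (hno : ∀ b c b' c', {b, c} + {b', c'} ≤ B → residue k b = residue k c →
      residue k b' ≠ residue k c') : HasProductOneSubseq (4 * k) (A.map a + B.map xa) := by
  classical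
  have : NeZero k := ⟨by omega⟩
  have hBs : (B.map (residue k)).Nodup ∨ ∃ b c B₀, B = {b, c} + B₀ ∧ residue k b = residue k c ∧
      (B₀.map (residue k)).Nodup := by
    by_cases hnd : (B.map (residue k)).Nodup
    · exact Or.inl hnd
    obtain ⟨b, c, hbc, h⟩ := exists_pair_le_of_not_nodup hnd
    obtain ⟨B₀, rfl⟩ := Multiset.le_iff_exists_add.1 hbc
    refine Or.inr ⟨b, c, B₀, rfl, h, ?_⟩
    by_contra hnd'
    obtain ⟨b', c', hbc', h'⟩ := exists_pair_le_of_not_nodup hnd'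
    exact hno b c b' c' (add_le_add_right hbc' _) h h'
  have hcard : ∀ {D : Multiset (ZMod (2 * k))}, (D.map (residue k)).Nodup → D.card ≤ k :=
    fun hD => by simpa using card_le_natCard_of_nodup hD
  have hBk : B.card ≤ k + 2 := by
    rcases hBs with h | ⟨b, c, B₀, rfl, -, h⟩
    · have := hcard h; omega
    · have := hcard h; rw [Multiset.card_add, Multiset.card_pair]; omega
  obtain ⟨L, C, E, rfl, hCL, hEL, hE, hcov⟩ := exists_subgroup_of_cover hk A
  rw [Multiset.card_add] at hc
  have hL : Covers L C := ⟨hCL, by omega, hcov⟩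
  have hCA : C ≤ C + E := Multiset.le_add_right _ _
  by_cases hL1 : Nat.card L = 1
  swap
  · exact hasProductOneSubseq_of_covers hk hk3 hL hCA hB2 hBk (by omega) hL1
  obtain rfl := AddSubgroup.card_eq_one.1 hL1
  have hC0 : ∀ c ∈ C, residue k c = 0 := fun c hc => (AddSubgroup.mem_bot).1 (hCL c hc)
  by_cases hC1 : 4 * k + 1 ≤ C.card
  · obtain ⟨T, hT, hTc, hT0⟩ := exists_le_of_residue_mem hk hL.mem (by omega)
    rw [← hTc]
    exact hasProductOneSubseq_of_sum_eq_zero (hT.trans hCA) hT0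
  have hEy : 0 < E.card → ∃ y, residue k y ≠ 0 ∧ y ::ₘ C ≤ C + E := by
    intro h
    obtain ⟨y, hy⟩ := Multiset.card_pos_iff_exists_mem.1 h
    refine ⟨y, fun h => hEL y hy (by rw [h]; exact zero_mem _), ?_⟩
    rw [← Multiset.singleton_add, add_comm]
    exact add_le_add_right (Multiset.singleton_le.2 hy) _
  by_cases hmix : ∀ t, ∃ c ∈ C, parityMod k c = t
  · rcases hBs with h | ⟨b, c, B₀, rfl, hbc, h⟩
    · have := hcard h
      obtain ⟨y, hy, hyA⟩ := hEy (by omega)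
      exact hasProductOneSubseq_of_zeros_of_mixed hk hk3 hC0 hmix (by omega) hy hyA le_rfl h
        (by omega)
    · have := hcard h
      rw [Multiset.card_add, Multiset.card_pair] at *
      by_cases hC2 : 4 * k ≤ C.card + 1
      · exact hasProductOneSubseq_of_mixed hk hL hCA hmix hC2 (Multiset.le_add_right _ _)
          (by rw [hbc, sub_self]; exact zero_mem _)
      · obtain ⟨y, hy, hyA⟩ := hEy (by omega)
        exact hasProductOneSubseq_of_zeros_of_mixed hk hk3 hC0 hmix (by omega) hy hyA
          (Multiset.le_add_left _ _) h (by omega)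
  · obtain ⟨t, ht⟩ : ∃ t, ∀ c ∈ C, parityMod k c = t := exists_forall_parityMod_eq hmix
    by_cases hC2 : 4 * k ≤ C.card
    · obtain ⟨T, hT, hTc, hT0⟩ := exists_le_of_residue_mem_of_parityMod_eq hk hL.mem ht (by omega)
      rw [← hTc]
      exact hasProductOneSubseq_of_sum_eq_zero (hT.trans hCA) hT0
    rcases hBs with h | ⟨b, c, B₀, rfl, hbc, h⟩
    -- Impossible: `|B| ≤ k`, `|E| ≤ k - 1` and `|C| ≤ 4k - 1` add up to `6k - 2` only.
    · have := hcard h; omega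
    · have := hcard h
      rw [Multiset.card_add, Multiset.card_pair] at *
      have hdec : ∀ p q : ZMod 2, 1 + p + q = 0 ∨ p = q := by decide
      rcases hdec (parityMod k b) (parityMod k c) with hp | hp
      · exact hasProductOneSubseq_of_const hk hL hCA ht (by omega) (Multiset.le_add_right _ _)
          (by rw [hbc, sub_self]; exact zero_mem _) hp
      · obtain ⟨y, hy, hyA⟩ := hEy (by omega)
        exact hasProductOneSubseq_of_zeros_of_const hk hk3 hC0 ht (by omega) hy hyA le_rfl hbc hp h
          (by omega)

theorem exists_map_add_map (S : Multiset (QuaternionGroup k)) :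
    ∃ A B : Multiset (ZMod (2 * k)), S = A.map a + B.map xa := by
  induction S using Multiset.induction_on with
  | empty => exact ⟨0, 0, rfl⟩
  | cons g S ih =>
    obtain ⟨A, B, rfl⟩ := ih
    rcases g with c | c
    · exact ⟨c ::ₘ A, B, by simp⟩
    · exact ⟨A, c ::ₘ B, by simp⟩

/-- For odd `k ≥ 3`, a sequence of length at least `6k - 1` over the dicyclic group of order `4k`
with at least two terms outside the cyclic subgroup has a product-one subsequence of
length `4k`. -/
theorem hasProductOneSubseq (hk : Odd k) (hk3 : 3 ≤ k) (hc : 6 * k ≤ A.card + B.card + 1)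
    (hB2 : 2 ≤ B.card) : HasProductOneSubseq (4 * k) (A.map a + B.map xa) := by
  by_cases hno : ∀ b c b' c', {b, c} + {b', c'} ≤ B → residue k b = residue k c →
      residue k b' ≠ residue k c'
  · exact hasProductOneSubseq_of_not_two_pairs hk hk3 hc hB2 hno
  push Not at hno
  obtain ⟨b, c, b', c', hle, h, h'⟩ := hno
  refine hasProductOneSubseq_of_two_pairs hk hk3 (by simpa using hc) ?_ h h'
  have := Multiset.map_le_map (f := (xa : ZMod (2 * k) → QuaternionGroup k)) hle
  rw [Multiset.map_add] at this
  exact this.trans (Multiset.le_add_left _ _)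

end Dicyclic

end ZeroSum

/-! ### Blocks over the product of a cyclic and a dicyclic group -/

namespace ZeroSum

theorem mem_products_sum {G ι : Type*} [Group G] {b : ι → Multiset G} {c : ι → G}
    (h : ∀ i, c i ∈ products (b i)) {B : Multiset ι} {g : G} (hg : g ∈ products (B.map c)) :
    g ∈ products (B.map b).sum := by
  obtain ⟨l, hl, rfl⟩ := hg
  induction l generalizing B with
  | nil =>
    obtain rfl : B = 0 := Multiset.map_eq_zero.1 hl.symm
    exact one_mem_products_zero
  | cons x l ih =>
    obtain ⟨i, hi, rfl⟩ := Multiset.mem_map.1 (show x ∈ B.map c by rw [← hl]; simp)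
    obtain ⟨B', rfl⟩ := Multiset.exists_cons_of_mem hi
    rw [Multiset.map_cons, ← Multiset.cons_coe, Multiset.cons_inj_right] at hl
    rw [Multiset.map_cons, Multiset.sum_cons, List.prod_cons]
    exact mul_mem_products_add (h i) (ih hl)

theorem map_prod_of_mem_products {G M : Type*} [Group G] [CommMonoid M] (φ : G →* M)
    {S : Multiset G} {g : G} (hg : g ∈ products S) : φ g = (S.map φ).prod := by
  obtain ⟨l, rfl, rfl⟩ := hg
  rw [map_list_prod, Multiset.map_coe, Multiset.prod_coe]

open scoped Pointwise in
/-- By the Cauchy-Davenport theorem, the sums of the subsequences of length `m` of a sequence of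
length at least `2 * m` over `ZMod p` take at least `m + 1` values, if every value is avoided by at
least `m` terms. -/
theorem exists_finset_sums {ι : Type*} {p : ℕ} [Fact p.Prime] (f : ι → ZMod p) (m : ℕ)
    {Y : Multiset ι} (hY : 2 * m ≤ Y.card) (h : ∀ g, m ≤ Y.countP (fun i => f i ≠ g)) :
    ∃ s : Finset (ZMod p), min p (m + 1) ≤ s.card ∧
      ∀ z ∈ s, ∃ F ≤ Y, F.card = m ∧ (F.map f).sum = z := by
  induction m generalizing Y with
  | zero =>
    refine ⟨{0}, by simp, fun z hz => ⟨0, Multiset.zero_le _, rfl, ?_⟩⟩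
    simpa using (Finset.mem_singleton.1 hz).symm
  | succ m ih =>
    have hsplit : ∀ g, Y.card = Y.countP (fun i => f i = g) + Y.countP (fun i => f i ≠ g) :=
      fun g => Multiset.card_eq_countP_add_countP _ _
    -- A term `i` of the most frequent value and a term `j` of another value form a two-element
    -- summand. Maximality ensures that, after their removal, every value is still avoided by at
    -- least `m` terms.
    obtain ⟨u, hu⟩ := Finite.exists_max fun g : ZMod p => Y.countP (fun i => f i = g)
    have hupos : 0 < Y.countP (fun i => f i = u) := by
      obtain ⟨i, hi⟩ := Multiset.card_pos_iff_exists_mem.1 (by omega : 0 < Y.card)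
      exact (Multiset.countP_pos (p := fun l => f l = f i).2 ⟨i, hi, rfl⟩).trans_le (hu (f i))
    obtain ⟨i, hi, rfl⟩ := Multiset.countP_pos.1 hupos
    obtain ⟨j, hj, hij⟩ := Multiset.countP_pos.1 ((Nat.succ_pos m).trans_le (h (f i)))
    obtain ⟨Z, rfl⟩ := Multiset.exists_cons_of_mem hi
    have hji : j ≠ i := by rintro rfl; exact hij rfl
    obtain ⟨Z, rfl⟩ := Multiset.exists_cons_of_mem ((Multiset.mem_cons.1 hj).resolve_left hji)
    simp only [Multiset.card_cons, Multiset.countP_cons, if_true] at hY h hsplit hu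
    obtain ⟨s, hs, hsF⟩ := ih (Y := Z) (by omega) fun g => by
      have h1 := h g
      have h2 := hsplit g
      have h3 := hu g
      by_cases hig : f i = g
      · have hjg : f j ≠ g := fun h => hij (h.trans hig.symm)
        simp only [hig, hjg, ne_eq, not_true_eq_false, not_false_eq_true, if_true, if_false] at *
        omega
      · by_cases hjg : f j = g
        · simp only [hig, hjg, ne_eq, not_true_eq_false, not_false_eq_true, if_true, if_false] at *
          omega
        · have h4 : Z.countP (fun l => f l = f i) ≤ Z.countP (fun l => f l ≠ g) := by
            rw [Multiset.countP_eq_card_filter, Multiset.countP_eq_card_filter]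
            refine Multiset.card_le_card (Multiset.monotone_filter_right _ fun l hl => ?_)
            rw [hl]; exact hig
          simp only [hig, hjg, hij, ne_eq, not_false_eq_true, if_true, if_false] at *
          omega
    refine ⟨s + ({f i, f j} : Finset (ZMod p)), ?_, ?_⟩
    · refine le_trans ?_ (ZMod.cauchy_davenport Fact.out ?_ (by simp))
      · rw [Finset.card_pair (Ne.symm hij)]
        omega
      · rw [← Finset.card_pos]
        have := (Fact.out : p.Prime).pos
        omega
    · intro z hz
      obtain ⟨y, hy, w, hw, rfl⟩ := Finset.mem_add.1 hz
      obtain ⟨F, hF, hFc, rfl⟩ := hsF y hy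
      rw [Finset.mem_insert, Finset.mem_singleton] at hw
      rcases hw with rfl | rfl
      · exact ⟨i ::ₘ F, Multiset.cons_le_cons _ (hF.trans (Multiset.le_cons_self _ _)),
          by simp [hFc], by simp [add_comm]⟩
      · exact ⟨j ::ₘ F, (Multiset.cons_le_cons _ hF).trans (Multiset.le_cons_self _ _),
          by simp [hFc], by simp [add_comm]⟩

theorem exists_le_card_eq_sum_eq {ι : Type*} {p : ℕ} [Fact p.Prime] (f : ι → ZMod p)
    {Y : Multiset ι} (hY : 2 * (p - 1) ≤ Y.card)
    (h : ∀ g, p - 1 ≤ Y.countP (fun i => f i ≠ g)) (t : ZMod p) :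
    ∃ F ≤ Y, F.card = p - 1 ∧ (F.map f).sum = t := by
  obtain ⟨s, hs, hsF⟩ := exists_finset_sums f (p - 1) hY h
  have hp := (Fact.out : p.Prime).pos
  have huniv : s = Finset.univ := by
    rw [← Finset.card_eq_iff_eq_univ, ZMod.card]
    have := Finset.card_le_univ s
    rw [ZMod.card] at this
    omega
  exact hsF t (huniv ▸ Finset.mem_univ t)

theorem intCast_map_sum {ι : Type*} {l : ℕ} (T : Multiset ι) (f : ι → ℤ) :
    (((T.map f).sum : ℤ) : ZMod l) = (T.map fun i => (f i : ZMod l)).sum := by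
  have := map_multiset_sum (Int.castRingHom (ZMod l)) (T.map f)
  rwa [Multiset.map_map] at this

namespace Dicyclic

open QuaternionGroup

variable {k : ℕ}

/-- The quotient map to the group of order two, with kernel the powers of `a`. -/
def kind : QuaternionGroup k →* Multiplicative (ZMod 2) where
  toFun
    | a _ => 1
    | xa _ => .ofAdd 1
  map_one' := rfl
  map_mul' := by
    rintro (c | c) (d | d)
    · rfl
    · rfl
    · rfl
    · change (1 : Multiplicative (ZMod 2)) = .ofAdd 1 * .ofAdd 1
      decide

theorem kind_a (c : ZMod (2 * k)) : kind (a c) = 1 := rfl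

theorem kind_xa (c : ZMod (2 * k)) : kind (xa c) = .ofAdd 1 := rfl

theorem kind_ne_one_iff {g : QuaternionGroup k} : kind g ≠ 1 ↔ kind g = .ofAdd 1 := by
  rcases g with c | c
  · rw [kind_a]; decide
  · rw [kind_xa]; decide

/-- The exponent of a term. -/
def expo : QuaternionGroup k → ZMod (2 * k)
  | a c => c
  | xa c => c

/-- All terms are powers of `a`, so this is the abelian statement for `ZMod N × ZMod (2k)`. -/
theorem exists_le_of_kind_eq_one {ι : Type*} (hk : 0 < k) {N : ℕ} (hN : 0 < N) (f : ι → ℤ)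
    (g : ι → QuaternionGroup k) {Y : Multiset ι} (hY : ∀ i ∈ Y, kind (g i) = 1) (j : ℕ)
    (hc : j * (N * (2 * k)) + N * (2 * k) ≤ Y.card + 1) :
    ∃ T ≤ Y, T.card = j * (N * (2 * k)) ∧ (N : ℤ) ∣ (T.map f).sum ∧ IsProductOne (T.map g) := by
  obtain ⟨T, hT, hTc, hT0⟩ := ((isEGZ_zmod N).prod (isEGZ_zmod (2 * k)) hN
    (by omega)).exists_map_mul (by positivity) (fun i => ((f i : ZMod N), expo (g i))) j hc
  refine ⟨T, hT, hTc, ?_, ?_⟩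
  · have h1 := congrArg (AddMonoidHom.fst _ _) hT0
    rw [map_zero, map_multiset_sum, Multiset.map_map] at h1
    rw [← ZMod.intCast_zmod_eq_zero_iff_dvd, intCast_map_sum]
    exact h1
  · have h1 := congrArg (AddMonoidHom.snd _ _) hT0
    rw [map_zero, map_multiset_sum, Multiset.map_map] at h1
    have h2 := a_sum_mem_products (T.map fun i => expo (g i))
    rw [show (T.map fun i => expo (g i)).sum = 0 from h1, Multiset.map_map] at h2
    have h3 : T.map (a ∘ fun i => expo (g i)) = T.map g := by
      refine Multiset.map_congr rfl fun i hi => ?_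
      have h := hY i (Multiset.mem_of_le hT hi)
      rcases hgi : g i with c | c
      · simp [hgi, expo]
      · rw [hgi, kind_xa] at h
        exact absurd h (by decide)
    rw [h3] at h2
    exact h2

/-- The product of the terms in some order. -/
noncomputable def someProd (T : Multiset (ℤ × QuaternionGroup k)) : QuaternionGroup k :=
  (T.toList.map Prod.snd).prod

theorem someProd_mem_products (T : Multiset (ℤ × QuaternionGroup k)) :
    someProd T ∈ products (T.map Prod.snd) := by
  refine ⟨T.toList.map Prod.snd, ?_, rfl⟩
  rw [← Multiset.map_coe, Multiset.coe_toList]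

theorem kind_someProd (T : Multiset (ℤ × QuaternionGroup k)) :
    kind (someProd T) = (T.map fun p => kind p.2).prod := by
  rw [map_prod_of_mem_products kind (someProd_mem_products T), Multiset.map_map]
  rfl

/-- A block of `l` terms whose first components have sum divisible by `l`. -/
def IsBlock (l : ℕ) (T : Multiset (ℤ × QuaternionGroup k)) : Prop :=
  T.card = l ∧ (l : ℤ) ∣ (T.map Prod.fst).sum

theorem exists_isBlock (l : ℕ) {U : Multiset (ℤ × QuaternionGroup k)} (hU : 2 * l - 1 ≤ U.card) :
    ∃ T ≤ U, IsBlock l T := by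
  obtain ⟨T, hT, hTc, h0⟩ := (isEGZ_zmod l).exists_map (fun p : ℤ × QuaternionGroup k =>
    (p.1 : ZMod l)) hU
  refine ⟨T, hT, hTc, ?_⟩
  rw [← ZMod.intCast_zmod_eq_zero_iff_dvd, intCast_map_sum, h0]

theorem kind_someProd_of_odd {T : Multiset (ℤ × QuaternionGroup k)} (hT : Odd T.card)
    (h : ∀ p ∈ T, kind p.2 ≠ 1) : kind (someProd T) ≠ 1 := by
  rw [kind_someProd, Multiset.map_congr rfl fun p hp => kind_ne_one_iff.1 (h p hp),
    Multiset.map_const', Multiset.prod_replicate]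
  obtain ⟨j, hj⟩ := hT
  rw [hj, pow_succ, pow_mul, show (Multiplicative.ofAdd (1 : ZMod 2)) ^ 2 = 1 by decide, one_pow]
  decide

/-- The claim of the induction on `N`. -/
def LiftsTo (k N : ℕ) : Prop :=
  ∀ S : Multiset (ℤ × QuaternionGroup k), 6 * k * N ≤ S.card + 1 →
    ∀ p q, {p, q} ≤ S → kind p.2 ≠ 1 → kind q.2 ≠ 1 →
    ∃ T ≤ S, T.card = 4 * k * N ∧ (N : ℤ) ∣ (T.map Prod.fst).sum ∧ IsProductOne (T.map Prod.snd)

theorem liftsTo_one (hk : Odd k) (hk3 : 3 ≤ k) : LiftsTo k 1 := by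
  intro S hS p q hpq hp hq
  obtain ⟨A, B, hAB⟩ := exists_map_add_map (S.map Prod.snd)
  have hc := congrArg Multiset.card hAB
  simp only [Multiset.card_map, Multiset.card_add] at hc
  have hB : 2 ≤ B.card := by
    have h1 := Multiset.countP_le_of_le (fun g => kind g ≠ 1)
      (Multiset.map_le_map (f := Prod.snd) hpq)
    have h2 : (A.map a).countP (fun g : QuaternionGroup k => kind g ≠ 1) = 0 := by
      refine Multiset.countP_eq_zero.2 fun g hg h => h ?_
      obtain ⟨c, -, rfl⟩ := Multiset.mem_map.1 hg
      exact kind_a c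
    have h3 := Multiset.countP_le_card (fun g : QuaternionGroup k => kind g ≠ 1) (B.map xa)
    have h4 : (({p, q} : Multiset (ℤ × QuaternionGroup k)).map Prod.snd).countP
        (fun g => kind g ≠ 1) = 2 := by
      rw [Multiset.insert_eq_cons, ← Multiset.cons_zero q, Multiset.map_cons, Multiset.map_cons,
        Multiset.countP_cons, Multiset.countP_cons, if_pos hp, if_pos hq]
      rfl
    rw [h4, hAB, Multiset.countP_add, h2, zero_add] at h1
    rw [Multiset.card_map] at h3
    omega
  obtain ⟨T, hT, hTc, hT1⟩ := hasProductOneSubseq hk hk3 (A := A) (B := B) (by omega) hB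
  rw [← hAB] at hT
  obtain ⟨T, hTS, rfl⟩ := exists_le_map_eq _ hT
  exact ⟨T, hTS, by simpa using hTc, by simp, hT1⟩

/-- Each block of `l` terms becomes one term, with first component its sum divided by `l`; integer
first components make this division meaningful. The two given blocks and `6kN - 3` further ones
reach exactly the length that `LiftsTo k N` requires. -/
theorem liftsTo_mul_of_blocks {l N : ℕ} (hl : 0 < l) (hN : LiftsTo k N) (hkN : 0 < k * N)
    {S : Multiset (ℤ × QuaternionGroup k)} (hS : 6 * k * (l * N) ≤ S.card + 1)
    {b₁ b₂ : Multiset (ℤ × QuaternionGroup k)} (hb : b₁ + b₂ ≤ S) (h₁ : IsBlock l b₁)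
    (h₂ : IsBlock l b₂) (hk₁ : kind (someProd b₁) ≠ 1) (hk₂ : kind (someProd b₂) ≠ 1) :
    ∃ T ≤ S, T.card = 4 * k * (l * N) ∧ ((l * N : ℕ) : ℤ) ∣ (T.map Prod.fst).sum ∧
      IsProductOne (T.map Prod.snd) := by
  obtain ⟨R, rfl⟩ := Multiset.le_iff_exists_add.1 hb
  rw [Multiset.card_add, Multiset.card_add, h₁.1, h₂.1] at hS
  have hmul : 6 * k * (l * N) = 6 * (k * N) * l := by ring
  have hsub : (6 * (k * N) - 3) * l + 3 * l = 6 * (k * N) * l := by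
    rw [← add_mul]; congr 1; omega
  obtain ⟨B, hBc, hB, hBR⟩ := exists_blocks (S := R)
    (fun T => (l : ℤ) ∣ (T.map Prod.fst).sum) (r := l) (c := 2 * l - 1)
    (fun U _ hU => exists_isBlock l hU) (6 * (k * N) - 3) (by omega)
  have hBall : ∀ T ∈ b₁ ::ₘ b₂ ::ₘ B, IsBlock l T := by
    intro T hT
    rcases Multiset.mem_cons.1 hT with rfl | hT
    · exact h₁
    rcases Multiset.mem_cons.1 hT with rfl | hT
    · exact h₂
    exact hB T hT
  let v : Multiset (ℤ × QuaternionGroup k) → ℤ × QuaternionGroup k :=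
    fun T => ((T.map Prod.fst).sum / l, someProd T)
  obtain ⟨T', hT', hT'c, hT'd, hT'1⟩ := hN ((b₁ ::ₘ b₂ ::ₘ B).map v)
    (by rw [Multiset.card_map, Multiset.card_cons, Multiset.card_cons, hBc, mul_assoc]; omega)
    (v b₁) (v b₂) (by
      rw [Multiset.map_cons, Multiset.map_cons]
      exact Multiset.cons_le_cons _ (Multiset.cons_le_cons _ (Multiset.zero_le _))) hk₁ hk₂
  obtain ⟨C, hC, rfl⟩ := exists_le_map_eq _ hT'
  have hCall : ∀ T ∈ C, IsBlock l T := fun T hT => hBall T (Multiset.mem_of_le hC hT)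
  refine ⟨C.sum, ?_, ?_, ?_, ?_⟩
  · refine (sum_le_sum_of_le hC).trans ?_
    rw [Multiset.sum_cons, Multiset.sum_cons, ← add_assoc]
    exact add_le_add_right hBR _
  · rw [card_sum_of_forall fun T hT => (hCall T hT).1]
    rw [Multiset.card_map] at hT'c
    rw [hT'c]; ring
  · rw [map_sum_sum, Multiset.map_congr rfl fun T hT =>
      (Int.mul_ediv_cancel' (hCall T hT).2).symm, Multiset.sum_map_mul_left, Nat.cast_mul]
    rw [Multiset.map_map] at hT'd
    exact mul_dvd_mul_left _ hT'd
  · rw [Multiset.map_map] at hT'1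
    have := mem_products_sum someProd_mem_products hT'1
    have h : (C.map fun T => T.map Prod.snd).sum = C.sum.map Prod.snd :=
       (map_multiset_sum (Multiset.mapAddMonoidHom Prod.snd) C).symm
    rwa [h] at this

end Dicyclic

end ZeroSum

/-! ### The lifting induction and sequences over the group when `4 ∤ n` -/

namespace ZeroSum

theorem exists_mem_products_of_map {G H : Type*} [Group G] [Group H] (φ : G →* H)
    {S : Multiset G} {h : H} (hh : h ∈ products (S.map φ)) : ∃ g ∈ products S, φ g = h := by
  obtain ⟨l, hl, rfl⟩ := hh
  induction l generalizing S with
  | nil =>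
    obtain rfl : S = 0 := Multiset.map_eq_zero.1 hl.symm
    exact ⟨1, one_mem_products_zero, map_one φ⟩
  | cons x l ih =>
    obtain ⟨g, hg, rfl⟩ := Multiset.mem_map.1 (show x ∈ S.map φ by rw [← hl]; simp)
    obtain ⟨S', rfl⟩ := Multiset.exists_cons_of_mem hg
    rw [Multiset.map_cons, ← Multiset.cons_coe, Multiset.cons_inj_right] at hl
    obtain ⟨g', hg', h'⟩ := ih hl
    refine ⟨g * g', ?_, by rw [map_mul, h', List.prod_cons]⟩
    rw [← Multiset.singleton_add]
    exact mul_mem_products_add (self_mem_products_singleton g) hg'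

namespace Dicyclic

open QuaternionGroup

variable {k : ℕ}

/-- The task is to produce two disjoint blocks whose products lie outside the cyclic subgroup, or
else to find the subsequence within the cyclic part. -/
theorem liftsTo_mul (hk3 : 3 ≤ k) {l N : ℕ} [hlp : Fact l.Prime] (hl : Odd l) (hN0 : 0 < N)
    (hN : LiftsTo k N) : LiftsTo k (l * N) := by
  classical
  intro S hS p q hpq hp hq
  have hl3 : 3 ≤ l := by
    have := hlp.out.two_le
    obtain ⟨j, hj⟩ := hl
    omega
  have hkN : 3 ≤ k * N := by nlinarith
  have hkl : 3 * l ≤ k * N * l := Nat.mul_le_mul_right l hkN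
  have hkl' : 3 * (l - 1) ≤ k * N * (l - 1) := Nat.mul_le_mul_right _ hkN
  rw [Nat.mul_sub_one] at hkl'
  have hmul : 6 * k * (l * N) = 6 * (k * N * l) := by ring
  have hXY := Multiset.filter_add_not (fun p : ℤ × QuaternionGroup k => kind p.2 ≠ 1) S
  set X := S.filter fun p => kind p.2 ≠ 1 with hX
  set Y := S.filter fun p => ¬ kind p.2 ≠ 1 with hY
  have hXk : ∀ p ∈ X, kind p.2 ≠ 1 := fun p hp => (Multiset.mem_filter.1 hp).2
  have hYk : ∀ p ∈ Y, kind p.2 = 1 := fun p hp => not_not.1 (Multiset.mem_filter.1 hp).2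
  have hpqX : {p, q} ≤ X := by
    refine Multiset.le_filter.2 ⟨hpq, fun r hr => ?_⟩
    rw [Multiset.insert_eq_cons, Multiset.mem_cons, Multiset.mem_singleton] at hr
    rcases hr with rfl | rfl <;> assumption
  have hXYc := congrArg Multiset.card hXY
  rw [Multiset.card_add] at hXYc
  -- Two blocks can be taken from `X` itself: `2l - 1` terms remain for the second, and an odd
  -- number of outside terms has its product outside.
  by_cases hXc : 3 * l - 1 ≤ X.card
  · obtain ⟨b₁, hb₁, h₁⟩ := exists_isBlock l (U := X) (by omega)
    obtain ⟨X', hX'⟩ := Multiset.le_iff_exists_add.1 hb₁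
    have hX'c := congrArg Multiset.card hX'
    rw [Multiset.card_add, h₁.1] at hX'c
    obtain ⟨b₂, hb₂, h₂⟩ := exists_isBlock l (U := X') (by omega)
    have hb : b₁ + b₂ ≤ X := by rw [hX']; exact add_le_add_right hb₂ _
    refine liftsTo_mul_of_blocks (by omega) hN (by omega) hS (hb.trans (Multiset.filter_le _ _))
      h₁ h₂ (kind_someProd_of_odd (h₁.1.symm ▸ hl) fun r hr => hXk r (Multiset.mem_of_le hb₁ hr))
      (kind_someProd_of_odd (h₂.1.symm ▸ hl) fun r hr => hXk r (Multiset.mem_of_le hb ?_))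
    rw [Multiset.mem_add]
    exact Or.inr hr
  -- If nearly all of `Y` has first component `g` modulo `l`, one subtracts `g`, divides by `l`, and
  -- stays in the cyclic part. A length divisible by `l` makes the shift by `g` harmless.
  by_cases hg : ∃ g : ZMod l, Y.countP (fun p => (p.1 : ZMod l) ≠ g) + 3 ≤ 2 * l
  · obtain ⟨g, hg⟩ := hg
    obtain ⟨g, rfl⟩ := ZMod.intCast_surjective g
    have hYc := Multiset.card_eq_countP_add_countP (fun p => (p.1 : ZMod l) = g) Y
    rw [Multiset.countP_eq_card_filter] at hYc
    simp only [ne_eq] at hg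
    have hcard : 2 * l * (N * (2 * k)) = 4 * (k * N * l) := by ring
    have hN2 : N * (2 * k) = 2 * (k * N) := by ring
    obtain ⟨T, hT, hTc, hTd, hT1⟩ := exists_le_of_kind_eq_one (by omega) hN0
      (fun p : ℤ × QuaternionGroup k => (p.1 - g) / l) Prod.snd
      (Y := Y.filter fun p => (p.1 : ZMod l) = g)
      (fun p hp => hYk p (Multiset.mem_filter.1 hp).1) (2 * l) (by
        rw [hcard, hN2]
        have : k * N ≤ k * N * l := Nat.le_mul_of_pos_right _ (by omega)
        have h3 : 3 * (k * N) ≤ k * N * l := by rw [mul_comm]; exact Nat.mul_le_mul_left _ hl3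
        have h5 : 5 * (l - 1) ≤ 2 * (k * N) * (l - 1) :=
          Nat.mul_le_mul_right _ (by omega)
        rw [Nat.mul_sub_one, Nat.mul_sub_one, mul_assoc] at h5
        omega)
    refine ⟨T, hT.trans ((Multiset.filter_le _ _).trans (Multiset.filter_le _ _)), ?_, ?_, hT1⟩
    · rw [hTc]; ring
    · have h1 : T.map Prod.fst = T.map fun p => g + l * ((p.1 - g) / l) := by
        refine Multiset.map_congr rfl fun p hp => ?_
        have h := (Multiset.mem_filter.1 (Multiset.mem_of_le hT hp)).2
        rw [Int.mul_ediv_cancel' ((ZMod.intCast_eq_intCast_iff_dvd_sub _ _ _).1 h.symm)]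
        ring
      rw [h1, Multiset.sum_map_add, Multiset.map_const', Multiset.sum_replicate,
        Multiset.sum_map_mul_left, hTc, Nat.cast_mul]
      refine dvd_add ?_ (mul_dvd_mul_left _ hTd)
      rw [nsmul_eq_mul]
      push_cast
      exact ⟨4 * k * g, by ring⟩
  -- Now every value is avoided by at least `2(l - 1)` terms of `Y`, so Cauchy–Davenport can be
  -- applied twice, completing `p` and then `q` by `l - 1` powers of `a` to a block.
  · push Not at hg
    have hYc : 4 * l ≤ Y.card := by omega
    obtain ⟨F₁, hF₁, hF₁c, hF₁s⟩ := exists_le_card_eq_sum_eq (p := l)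
      (fun p : ℤ × QuaternionGroup k => (p.1 : ZMod l)) (Y := Y) (by omega)
      (fun g => by have := hg g; omega) (-p.1)
    obtain ⟨Y', hY'⟩ := Multiset.le_iff_exists_add.1 hF₁
    have hY'c := congrArg Multiset.card hY'
    rw [Multiset.card_add] at hY'c
    obtain ⟨F₂, hF₂, hF₂c, hF₂s⟩ := exists_le_card_eq_sum_eq (p := l)
      (fun p : ℤ × QuaternionGroup k => (p.1 : ZMod l)) (Y := Y') (by omega)
      (fun g => by
        have h1 := hg g
        have h2 := Multiset.countP_le_card (fun p => (p.1 : ZMod l) ≠ g) F₁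
        rw [hY', Multiset.countP_add] at h1
        omega) (-q.1)
    have hblock : ∀ (r : ℤ × QuaternionGroup k) (F : Multiset (ℤ × QuaternionGroup k)),
        F.card = l - 1 → (F.map fun p => (p.1 : ZMod l)).sum = -r.1 → IsBlock l (r ::ₘ F) := by
      intro r F hc hs
      refine ⟨by rw [Multiset.card_cons, hc]; omega, ?_⟩
      rw [← ZMod.intCast_zmod_eq_zero_iff_dvd, intCast_map_sum, Multiset.map_cons,
        Multiset.sum_cons, hs, add_neg_cancel]
    have hkind : ∀ (r : ℤ × QuaternionGroup k) (F : Multiset (ℤ × QuaternionGroup k)),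
        kind r.2 ≠ 1 → F ≤ Y → kind (someProd (r ::ₘ F)) ≠ 1 := by
      intro r F hr hF
      rw [kind_someProd, Multiset.map_cons, Multiset.prod_cons,
        Multiset.map_congr rfl fun p hp => hYk p (Multiset.mem_of_le hF hp), Multiset.map_const',
        Multiset.prod_replicate, one_pow, mul_one]
      exact hr
    have hF₁₂ : F₁ + F₂ ≤ Y := by rw [hY']; exact add_le_add_right hF₂ _
    refine liftsTo_mul_of_blocks (by omega) hN (by omega) hS (b₁ := p ::ₘ F₁) (b₂ := q ::ₘ F₂) ?_
      (hblock p F₁ hF₁c hF₁s) (hblock q F₂ hF₂c hF₂s) (hkind p F₁ hp hF₁)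
      (hkind q F₂ hq ((Multiset.le_add_left _ _).trans hF₁₂))
    calc p ::ₘ F₁ + q ::ₘ F₂ = {p, q} + (F₁ + F₂) := by
          rw [Multiset.insert_eq_cons, ← Multiset.singleton_add, ← Multiset.singleton_add q,
            ← Multiset.singleton_add p {q}]
          abel
      _ ≤ X + Y := add_le_add hpqX hF₁₂
      _ = S := hXY

theorem liftsTo (hk : Odd k) (hk3 : 3 ≤ k) {N : ℕ} (hN : Odd N) : LiftsTo k N := by
  induction N using Nat.strong_induction_on with
  | _ N ih =>
    by_cases h1 : N = 1
    · rw [h1]; exact liftsTo_one hk hk3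
    have hp : Fact N.minFac.Prime := ⟨Nat.minFac_prime h1⟩
    obtain ⟨M, hM⟩ := N.minFac_dvd
    have hodd := hN
    rw [hM, Nat.odd_mul] at hodd
    rw [hM]
    refine liftsTo_mul hk3 hodd.1 hodd.2.pos (ih M ?_ hodd.2)
    have h2 := hp.out.two_le
    have h3 := hodd.2.pos
    calc M < N.minFac * M := by nlinarith
      _ = N := hM.symm

theorem exists_le_of_card (hk : Odd k) (hk3 : 3 ≤ k) {N : ℕ} (hN : Odd N)
    {S : Multiset (ℤ × QuaternionGroup k)} (hS : 6 * k * N ≤ S.card) :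
    ∃ T ≤ S, T.card = 4 * k * N ∧ (N : ℤ) ∣ (T.map Prod.fst).sum ∧
      IsProductOne (T.map Prod.snd) := by
  classical
  by_cases h2 : 2 ≤ (S.filter fun p => kind p.2 ≠ 1).card
  · obtain ⟨P, hP, hPc⟩ := exists_le_card_eq h2
    obtain ⟨p, q, rfl⟩ := Multiset.card_eq_two.1 hPc
    exact liftsTo hk hk3 hN S (by omega) p q (hP.trans (Multiset.filter_le _ _))
      (Multiset.mem_filter.1 (Multiset.mem_of_le hP (by simp))).2
      (Multiset.mem_filter.1 (Multiset.mem_of_le hP (by simp))).2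
  · have hXY := congrArg Multiset.card
      (Multiset.filter_add_not (fun p : ℤ × QuaternionGroup k => kind p.2 ≠ 1) S)
    rw [Multiset.card_add] at hXY
    obtain ⟨T, hT, hTc, hTd, hT1⟩ := exists_le_of_kind_eq_one hk.pos hN.pos Prod.fst Prod.snd
      (Y := S.filter fun p => ¬ kind p.2 ≠ 1) (fun p hp => not_not.1 (Multiset.mem_filter.1 hp).2)
      2 (by
        have : 2 * (N * (2 * k)) + N * (2 * k) = 6 * k * N := by ring
        omega)
    exact ⟨T, hT.trans (Multiset.filter_le _ _), by rw [hTc]; ring, hTd, hT1⟩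

end Dicyclic

namespace NormalForm

variable {n : ℕ} {s : ℤ} [h : Fact (IsAdmissible n s)]

/-- The cyclic quotient. -/
def toCyclic {N : ℕ} (hNn : N ∣ n) (hN2 : ((n / 2 : ℕ) : ZMod N) = 0) (hs : (s : ZMod N) = 1) :
    NormalForm n s →* Multiplicative (ZMod N) where
  toFun
    | y c => .ofAdd (ZMod.castHom hNn (ZMod N) c)
    | x c => .ofAdd (ZMod.castHom hNn (ZMod N) c)
  map_one' := congrArg Multiplicative.ofAdd (map_zero _)
  map_mul' := by
    rintro (c | c) (d | d)
    · exact congrArg Multiplicative.ofAdd (map_add _ _ _)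
    · refine congrArg Multiplicative.ofAdd ((map_add _ _ _).trans ?_)
      rw [map_mul, map_intCast, hs, one_mul]
      rfl
    · exact congrArg Multiplicative.ofAdd (map_add _ _ _)
    · refine congrArg Multiplicative.ofAdd ((map_add _ _ _).trans ?_)
      rw [map_add, map_mul, map_intCast, map_natCast, hs, hN2, zero_add, one_mul]
      rfl

/-- The dicyclic quotient. -/
def toDicyclic {k : ℕ} (hkn : 2 * k ∣ n) (hk2 : ((n / 2 : ℕ) : ZMod (2 * k)) = k)
    (hs : (s : ZMod (2 * k)) = -1) : NormalForm n s →* QuaternionGroup k where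
  toFun
    | y c => .a (ZMod.castHom hkn (ZMod (2 * k)) c)
    | x c => .xa (ZMod.castHom hkn (ZMod (2 * k)) c)
  map_one' := congrArg QuaternionGroup.a (map_zero _)
  map_mul' := by
    rintro (c | c) (d | d)
    · exact congrArg QuaternionGroup.a (map_add _ _ _)
    · refine congrArg QuaternionGroup.xa ((map_add _ _ _).trans ?_)
      rw [map_mul, map_intCast, hs]
      ring
    · exact congrArg QuaternionGroup.xa (map_add _ _ _)
    · refine congrArg QuaternionGroup.a ((map_add _ _ _).trans ?_)
      rw [map_add, map_mul, map_intCast, map_natCast, hs, hk2]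
      ring

/-- The maps to `ZMod N` and to the dicyclic group of order `4k` are jointly injective. An order of
the terms with product one in the dicyclic group works in the whole group, since the image in `ZMod
N` does not depend on the order. -/
theorem hasProductOneSubseq_of_odd {m : ℕ} (hm : Odd m) (hn : n = 2 * m)
    (hs : ¬ s ≡ 1 [ZMOD (n : ℤ)]) {S : Multiset (NormalForm n s)} (hS : 3 * n ≤ S.card) :
    HasProductOneSubseq (2 * n) S := by
  obtain ⟨j, hj⟩ := h.out.odd
  have hmpos := hm.pos
  let N : ℕ := Int.gcd m (s - 1)
  have hNpos : 0 < N := Int.gcd_pos_of_ne_zero_left _ (by omega)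
  obtain ⟨k, hk⟩ : N ∣ m := by exact_mod_cast Int.gcd_dvd_left (m : ℤ) (s - 1)
  obtain ⟨r, hr⟩ : (N : ℤ) ∣ s - 1 := Int.gcd_dvd_right _ _
  have hodd := hm
  rw [hk, Nat.odd_mul] at hodd
  obtain ⟨hNodd, hkodd⟩ := hodd
  have hmz : (m : ℤ) = N * k := by exact_mod_cast hk
  -- `k` divides `s + 1`
  have hkr : IsCoprime (k : ℤ) r := by
    rw [Int.isCoprime_iff_gcd_eq_one]
    have h1 : Int.gcd (N * k) (N * r) = N := by rw [← hmz, ← hr]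
    rw [Int.gcd_mul_left, Int.natAbs_natCast] at h1
    exact Nat.eq_of_mul_eq_mul_left hNpos (by rw [h1, mul_one])
  have hks : (k : ℤ) ∣ s + 1 := by
    have h1 : (m : ℤ) ∣ s ^ 2 - 1 := by
      refine Dvd.dvd.trans ?_ h.out.sq.symm.dvd
      rw [hn]; push_cast; exact dvd_mul_left _ _
    rw [hmz, show s ^ 2 - 1 = (s - 1) * (s + 1) by ring, hr, mul_assoc] at h1
    exact hkr.dvd_of_dvd_mul_left (Int.dvd_of_mul_dvd_mul_left (by omega) h1)
  have h2s : (2 : ℤ) ∣ s + 1 := ⟨j + 1, by rw [hj]; ring⟩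
  have h2k : IsCoprime (2 : ℤ) (k : ℤ) := by
    exact_mod_cast Nat.isCoprime_iff_coprime.2 (Nat.coprime_two_left.2 hkodd)
  have h2N : IsCoprime (2 : ℤ) (N : ℤ) := by
    exact_mod_cast Nat.isCoprime_iff_coprime.2 (Nat.coprime_two_left.2 hNodd)
  -- A common divisor divides `(s + 1) - (s - 1) = 2`, and `N` is odd.
  have hkN : IsCoprime (k : ℤ) (N : ℤ) := by
    obtain ⟨u, hu⟩ := hks
    obtain ⟨v, w, hvw⟩ := h2N
    exact ⟨v * u, w - v * r, by linear_combination hvw - v * hu + v * hr⟩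
  -- `k` is odd, and `k = 1` would give `m ∣ s - 1`, hence `n ∣ s - 1` as `s` is odd.
  have hk3 : 3 ≤ k := by
    by_contra hlt
    obtain ⟨i, hi⟩ := hkodd
    obtain rfl : i = 0 := by omega
    apply hs
    refine (Int.modEq_iff_dvd.2 ?_).symm
    rw [hn]; push_cast
    refine IsCoprime.mul_dvd ?_ ?_ ?_
    · rw [hmz, hi]; simpa using h2N
    · exact ⟨j, by rw [hj]; ring⟩
    · rw [hmz, hi]; simpa using Int.gcd_dvd_right (m : ℤ) (s - 1)
  have hn2 : n / 2 = m := by omega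
  have hkn : 2 * k ∣ n := ⟨N, by rw [hn, hk]; ring⟩
  have hNn : N ∣ n := ⟨2 * k, by rw [hn, hk]; ring⟩
  let ψ : NormalForm n s →* Multiplicative (ZMod N) := toCyclic hNn
    (by rw [hn2, hk, Nat.cast_mul, ZMod.natCast_self, zero_mul])
    (by
      have := (ZMod.intCast_zmod_eq_zero_iff_dvd (s - 1) N).2 ⟨r, hr⟩
      rw [Int.cast_sub, Int.cast_one] at this
      exact sub_eq_zero.1 this)
  let φ : NormalForm n s →* QuaternionGroup k := toDicyclic hkn
    (by
      obtain ⟨i, hi⟩ := hNodd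
      rw [hn2, hk, hi, show (2 * i + 1) * k = i * (2 * k) + k by ring, Nat.cast_add, Nat.cast_mul,
        ZMod.natCast_self, mul_zero, zero_add])
    (by
      have := (ZMod.intCast_zmod_eq_zero_iff_dvd (s + 1) (2 * k)).2
        (by push_cast; exact h2k.mul_dvd h2s hks)
      rw [Int.cast_add, Int.cast_one] at this
      exact eq_neg_of_add_eq_zero_left this)
  have hker : ∀ g, φ g = 1 → ψ g = 1 → g = 1 := by
    rintro (c | c) h1 h2
    · obtain ⟨c, rfl⟩ := ZMod.intCast_surjective c
      have h1 : QuaternionGroup.a (ZMod.castHom hkn (ZMod (2 * k)) (c : ZMod n)) = .a 0 := h1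
      have h2 : ZMod.castHom hNn (ZMod N) (c : ZMod n) = 0 := h2
      injection h1 with h1
      rw [map_intCast, ZMod.intCast_zmod_eq_zero_iff_dvd] at h1 h2
      rw [one_def]
      congr 1
      rw [ZMod.intCast_zmod_eq_zero_iff_dvd, hn, hk]
      push_cast at h1 ⊢
      have := (h2N.mul_left hkN).mul_dvd h1 h2
      rwa [mul_comm (N : ℤ), ← mul_assoc]
    · exact absurd h1 (by rintro ⟨⟩)
  let f : NormalForm n s → ℤ × QuaternionGroup k := fun g => ((ψ g).toAdd.val, φ g)
  have : NeZero N := ⟨by omega⟩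
  obtain ⟨T', hT', hTc, hTd, hT1⟩ := Dicyclic.exists_le_of_card hkodd hk3 hNodd (S := S.map f)
    (by rw [Multiset.card_map]; refine le_trans (le_of_eq ?_) hS; rw [hn, hk]; ring)
  obtain ⟨T, hT, rfl⟩ := exists_le_map_eq f hT'
  refine ⟨T, hT, ?_, ?_⟩
  · rw [Multiset.card_map] at hTc
    rw [hTc, hn, hk]; ring
  · rw [Multiset.map_map] at hTd hT1
    obtain ⟨g, hg, hg1⟩ := exists_mem_products_of_map φ hT1
    have hψ : ψ g = 1 := by
      rw [← ZMod.intCast_zmod_eq_zero_iff_dvd, intCast_map_sum] at hTd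
      have h1 : (T.map fun g => (ψ g).toAdd).sum = 0 := by
        rw [← hTd]
        exact congrArg _ (Multiset.map_congr rfl fun g _ => by simp [f])
      rw [map_prod_of_mem_products ψ hg, ← ofAdd_zero, ← h1, ofAdd_multiset_prod,
        Multiset.map_map]
      rfl
    rwa [hker g hg1 hψ] at hg

end NormalForm

end ZeroSum

/-! ### The main theorem -/

namespace ZeroSum.NormalForm

variable {n : ℕ} {s : ℤ} [h : Fact (IsAdmissible n s)]

/-- A subsequence of length `n` is extracted twice: after the first, `2n` terms are still left. -/
theorem hasProductOneSubseq_natCard_of_four_dvd {m : ℕ} (hm : Even m) (hm2 : 2 ≤ m)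
    (hn : n = 2 * m) (hs : ¬ s ≡ 1 [ZMOD (n : ℤ)]) {S : Multiset (NormalForm n s)}
    (hS : 3 * n ≤ S.card) : HasProductOneSubseq (2 * n) S := by
  subst hn
  obtain ⟨T, hT, hTc, hT1⟩ := hasProductOneSubseq_of_four_dvd hm hm2 hs (S := S) (by omega)
  obtain ⟨R, rfl⟩ := Multiset.le_iff_exists_add.1 hT
  rw [Multiset.card_add] at hS
  obtain ⟨T', hT', hT'c, hT'1⟩ := hasProductOneSubseq_of_four_dvd hm hm2 hs (S := R) (by omega)
  exact ⟨T + T', add_le_add_right hT' _, by rw [Multiset.card_add]; omega, hT1.add hT'1⟩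

end ZeroSum.NormalForm

open ZeroSum in
theorem theorem1p1 (n : ℕ) (s : ℤ) (hn : 8 ≤ n) (hn_even : Even n)
    (hs : s ^ 2 ≡ 1 [ZMOD (n : ℤ)])
    (hs_one : ¬ s ≡ 1 [ZMOD (n : ℤ)]) (hs_neg_one : ¬ s ≡ -1 [ZMOD (n : ℤ)]) :
    Finite (ZeroSum.Grp n s) ∧
    ZeroSum.smallDavenport (ZeroSum.Grp n s) = n ∧
    ZeroSum.etaConst (ZeroSum.Grp n s) = n + 1 ∧
    (n ≡ 0 [MOD 4] → ZeroSum.egzConst (ZeroSum.Grp n s) = 2 * n) ∧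
    (n ≡ 2 [MOD 4] → ZeroSum.egzConst (ZeroSum.Grp n s) = 3 * n) ∧
    ZeroSum.gaoConst (ZeroSum.Grp n s) = 3 * n ∧
    -- Gao's conjecture for this group
    ZeroSum.egzConst (ZeroSum.Grp n s) =
      ZeroSum.etaConst (ZeroSum.Grp n s) + Monoid.exponent (ZeroSum.Grp n s) - 1 ∧
    -- the Zhuang–Gao conjecture for this group
    ZeroSum.gaoConst (ZeroSum.Grp n s) =
      ZeroSum.smallDavenport (ZeroSum.Grp n s) + Nat.card (ZeroSum.Grp n s) := by
  have : Fact (IsAdmissible n s) := ⟨⟨hn_even, hs⟩⟩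
  have : NeZero n := ⟨by omega⟩
  let e : Grp n s ≃* NormalForm n s := equivNormalForm
  have hcard : Nat.card (Grp n s) = 2 * n := by
    rw [Nat.card_congr e.toEquiv, NormalForm.natCard]
  have hexp : Monoid.exponent (Grp n s) = Monoid.exponent (NormalForm n s) :=
    Monoid.exponent_eq_of_mulEquiv e
  have hfin : Finite (Grp n s) := Nat.finite_of_card_ne_zero (by omega)
  obtain ⟨m, hm⟩ := hn_even.two_dvd
  have hlift : ∀ {j l : ℕ}, (∀ S : Multiset (NormalForm n s), j ≤ S.card →
      HasProductOneSubseq l S) → ∀ S : Multiset (Grp n s), j ≤ S.card →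
      HasProductOneSubseq l S := by
    intro j l h S hS
    have := (h (S.map e) (by rwa [Multiset.card_map])).map e.symm
    rwa [Multiset.map_map, show (e.symm : NormalForm n s → Grp n s) ∘ e = id from
      funext e.symm_apply_apply, Multiset.map_id] at this
  have hfree := (NormalForm.isProductOneFree (s := s) (show 1 ≤ n by omega)).map e.symm
  rcases Nat.even_or_odd m with hm2 | hm2
  · have hexp' : Monoid.exponent (Grp n s) = n := by
      rw [hexp, NormalForm.exponent_of_four_dvd]
      obtain ⟨j, hj⟩ := hm2
      exact ⟨j, by omega⟩
    obtain ⟨h1, h2, h3, h4⟩ := constants_eq (G := Grp n s) (d := n) (by omega) (by omega)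
      (by simp; omega) hfree
      (by
        rw [hexp']
        refine hlift fun S hS => ?_
        subst hm
        exact NormalForm.hasProductOneSubseq_of_four_dvd hm2 (by omega) hs_one (by omega))
      (by
        rw [hcard]
        exact hlift fun S hS => NormalForm.hasProductOneSubseq_natCard_of_four_dvd hm2 (by omega)
          hm hs_one (by omega))
    rw [hexp'] at h3 ⊢
    rw [hcard] at h4 ⊢
    obtain ⟨j, hj⟩ := hm2
    refine ⟨hfin, h1, h2, fun _ => by omega, fun h => ?_, by omega, by omega, by omega⟩
    have : n % 4 = 2 := h
    omega
  · have hexp' : Monoid.exponent (Grp n s) = 2 * n := by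
      rw [hexp, NormalForm.exponent_of_odd_half hm2 hm]
    obtain ⟨h1, h2, h3, h4⟩ := constants_eq (G := Grp n s) (d := n) (by omega) (by omega)
      (by simp; omega) hfree
      (by
        rw [hexp']
        exact hlift fun S hS => NormalForm.hasProductOneSubseq_of_odd hm2 hm hs_one (by omega))
      (by
        rw [hcard]
        exact hlift fun S hS => NormalForm.hasProductOneSubseq_of_odd hm2 hm hs_one (by omega))
    rw [hexp'] at h3 ⊢
    rw [hcard] at h4 ⊢
    obtain ⟨j, hj⟩ := hm2
    refine ⟨hfin, h1, h2, fun h => ?_, fun _ => by omega, by omega, by omega, by omega⟩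
    have : n % 4 = 0 := h
    omega
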